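/- **Setting.** A *Y-shaped quiver* $Q$ has vertices $0,\dots,\rho$ ($\rho\ge 1$) and $n_{ij}$ arrows from $i$ to $j$, with $n_{ij}=0$ for $i\ge j$, such that vertex $1$ has at most two arrows out, every other vertex $i\ne 0$ has at most one arrow out, every vertex has at most one arrow in whose source is not $0$, and there is a path from $1$ to $j$ for every $j>1$. Let $r=(r_0,\dots,r_\rho)$ with $r_0=1$ be a dimension vector, and put $s_i=\sum_j n_{ji}r_j$, $s_i'=\sum_j n_{ij}r_j$, and $\tilde s_i=$ the number of paths from $0$ to $i$. Assume that $1\le r_i<s_i$ and $s_i'<s_i$ for all $i\neq 0$ (that is, the quiver flag variety $M(Q,r)$ is nondegenerate and its anticanonical class $\sum_i(s_i-s_i')c_1(W_i)$ lies in the interior of the positive orthant, so that $M(Q,r)$ is Fano with the positive orthant as ample cone). If there are two arrows out of $1$, let $R$ be the set of vertices $\neq 1$ on one of the two branches at $1$ (either one); otherwise let $R=\emptyset$. The *legs* are $\{1,\dots,\rho\}\setminus R$ and $\{1\}\cup R$; each leg is a chain starting at $1$. *Ladder diagram of a leg.* Put $w_i=\tilde s_i-r_i$. For $i\ne1$ on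 the leg let $p(i)$ be the vertex preceding $i$ on the leg. Over the columns between $x=w_{p(i)}$ (or $x=0$ if $i=1$) and $x=w_i$ the diagram consists of the unit cells with $0\le y\le r_i$. Its vertices are the origin $(0,0)$, the interior lattice points (those all four of whose adjacent cells belong to the diagram of the leg), the external points $(w_i,r_i)$, and, for $i\neq 1$ with $r_i\le r_{p(i)}$, the intersection points $(w_{p(i)},r_i)$. *Ladder quiver $L(Q)$.* The ladder diagram of $Q$ is the union of the diagram of the leg $\{1,\dots,\rho\}\setminus R$ and of the diagram of the leg $\{1\}\cup R$ rotated by $180^\circ$ via $(x,y)\mapsto(w_1-x,\,r_1-y)$; cells and vertices are the union of the cells and vertices of both. The vertices of $L(Q)$ are the vertices of the diagram, and its arrows are the lattice paths along edges of cells, going right and up, from one vertex to another with no vertex in between. Let $x_0=(0,0)$; for $i\notin R$, $i\ne 0$, let $v_i=(w_i,r_i)$, and for $i\in R$ let $v_i=(w_1-w_i,\,r_1-r_i)$. *Toric variety.* Let $\mathbb L^\vee$ be the free abelian group on symbols $e_u$, $u$ a vertex of $L(Q)$ other than $x_0$, and put $e_{x_0}=0$. An arrow $a$ from $u$ to $v$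 gets the weight $D_a=-e_u+e_v$. Let $K$ be the torus with character lattice $\mathbb L^\vee$, acting on $\mathbb C^{L(Q)_1}$ by these weights, let $w_Q=\sum_a D_a$, and let $X(Q)=\mathbb C^{L(Q)_1}/\!\!/_{w_Q}K=\operatorname{Proj}\bigoplus_{m\ge0}S_{m w_Q}$, where $S=\mathbb C[x_a : a\in L(Q)_1]$ is graded by $\mathbb L^\vee$ with $\deg x_a=D_a$. For $i\ne0$ let $D_i\in\mathbb L^\vee$ be the sum of the weights of the arrows of a path from $x_0$ to $v_i$ if $i\notin R$, respectively from $v_i$ to $v_1$ if $i\in R$; thus $D_i=e_{v_i}$, respectively $D_i=e_{v_1}-e_{v_i}$. Let $L_i$ be the sheaf on $X(Q)$ attached to $D_i$, that is, the sheaf associated to the graded module $\bigoplus_{m}S_{D_i+m w_Q}$, whose local sections are the fractions of degree $D_i$. **Statement.** For every $i\in\{1,\dots,\rho\}$ the sheaf $L_i$ is a line bundle on $X(Q)$, it is nef (nonnegative degree on every complete integral curve in $X(Q)$), and it is globally generated. The vector space $\Gamma(X(Q),L_i)$ has a basis indexed by the paths $p$ in $L(Q)$ from $x_0$ to $v_i$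 if $i\notin R$, respectively from $v_i$ to $v_1$ if $i\in R$; the basis element of $p$ is the monomial $\prod_{a\in p}x_a$. -/

import Mathlib

open CategoryTheory AlgebraicGeometry TopologicalSpace Opposite

/-! ### Line bundles, global generation, degrees and nefness on schemes -/

namespace SheafNotions

/-- A section `g` of `M` over `V` is a *frame* if multiplication `f ↦ f • g` is an isomorphism of
sheaves from `𝒪_V` to `M` restricted to `V`. -/
def IsFrame {X : Scheme.{0}} (M : X.Modules) {V : X.Opens} (g : Γ(M, V)) : Prop :=
  ∀ (W : X.Opens) (h : W ≤ V),
    Function.Bijective (fun f : Γ(X, W) => f • M.presheaf.map (homOfLE h).op g)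

/-- A line bundle is a sheaf of modules that is locally isomorphic to the structure sheaf. -/
def IsLineBundle {X : Scheme.{0}} (M : X.Modules) : Prop :=
  ∀ x : X, ∃ V : X.Opens, x ∈ V ∧ ∃ g : Γ(M, V), IsFrame M g

/-- `M` is globally generated if some family of global sections gives an epimorphism of sheaves
from a free module onto `M`. -/
def IsGloballyGenerated {X : Scheme.{0}} (M : X.Modules) : Prop :=
  Nonempty (SheafOfModules.GeneratingSections M)

/-- The section `s` of the line bundle `N` over `U`, regarded as a rational section of `N` on the
integral scheme `C`, is nonzero and vanishes to order `m` at `x`: in a local frame `g` around `x`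
it is `h • g`, where `h` is a nonzero element of the function field with order of vanishing `m`. -/
def HasOrderAt {C : Scheme.{0}} [IsIntegral C] [IsLocallyNoetherian C] (N : C.Modules)
    {U : C.Opens} (s : Γ(N, U)) (x : C) (m : ℤ) : Prop :=
  ∃ (V : C.Opens) (_ : x ∈ V) (g : Γ(N, V)) (_ : IsFrame N g) (_ : Nonempty (U ⊓ V : C.Opens))
    (h : Γ(C, U ⊓ V)),
    N.presheaf.map (homOfLE inf_le_left).op s = h • N.presheaf.map (homOfLE inf_le_right).op g ∧
    C.germToFunctionField (U ⊓ V) h ≠ 0 ∧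
    Scheme.ord (C.germToFunctionField (U ⊓ V) h) x = m

/-- `d` is the degree of the line bundle `N` on the curve `C`: the sum over the points of `C` of the
orders of vanishing of a nonzero rational section of `N`. (On a complete curve over an algebraically
closed field the sum does not depend on the section; the generic point contributes `0`.) -/
def HasDegree {C : Scheme.{0}} [IsIntegral C] [IsLocallyNoetherian C] (N : C.Modules)
    (d : ℤ) : Prop :=
  ∃ (U : C.Opens) (s : Γ(N, U)) (ord : C → ℤ),
    (∀ x, HasOrderAt N s x (ord x)) ∧ (Function.support ord).Finite ∧ d = ∑ᶠ x, ord x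

/-- A line bundle `M` on a scheme `X` over `ℂ` is nef if its restriction to every complete integral
curve in `X` has nonnegative degree. -/
def IsNef {X : Scheme.{0}} (π : X ⟶ Spec (.of ℂ)) (M : X.Modules) : Prop :=
  ∀ (C : Scheme.{0}) [IsIntegral C] [IsLocallyNoetherian C] (i : C ⟶ X) [IsClosedImmersion i]
    [IsProper (i ≫ π)], topologicalKrullDim C = 1 →
    ∃ d : ℤ, HasDegree ((Scheme.Modules.pullback i).obj M) d ∧ 0 ≤ d

end SheafNotions

/-! ### Quotients of affine varieties by tori -/

namespace TorusGIT

noncomputable section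

variable {S Λ : Type} [CommRing S] [Algebra ℂ S] [AddCommGroup Λ]
  (𝒮 : Λ → Submodule ℂ S) [SetLike.GradedMonoid 𝒮] (w : Λ)

/-- For a ring `S` graded by the character lattice `Λ` of a torus, the ring `⨁ₙ S_{n w} tⁿ` of
semi-invariants of the stability condition `w`, as a subalgebra of `S[t]`. -/
def semiInvariants : Subalgebra ℂ (Polynomial S) where
  carrier := {P | ∀ n, P.coeff n ∈ 𝒮 (n • w)}
  mul_mem' {P Q} hP hQ n := by
    rw [Polynomial.coeff_mul]
    refine Submodule.sum_mem _ fun k hk => ?_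
    have h := SetLike.mul_mem_graded (hP k.1) (hQ k.2)
    rwa [← add_smul, Finset.HasAntidiagonal.mem_antidiagonal.1 hk] at h
  add_mem' {P Q} hP hQ n := by
    rw [Polynomial.coeff_add]
    exact add_mem (hP n) (hQ n)
  algebraMap_mem' c n := by
    rw [Polynomial.algebraMap_apply, Polynomial.coeff_C]
    split_ifs with h
    · subst h
      rw [zero_smul, Algebra.algebraMap_eq_smul_one]
      exact Submodule.smul_mem _ _ SetLike.GradedOne.one_mem
    · exact zero_mem _

/-- The summand `S_{n w} tⁿ`. -/
def semiPart (n : ℕ) : Submodule ℂ (semiInvariants 𝒮 w) where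
  carrier := {P | ∀ m, m ≠ n → P.1.coeff m = 0}
  zero_mem' m _ := by simp
  add_mem' {P Q} hP hQ m hm := by simp [hP m hm, hQ m hm]
  smul_mem' c P hP m hm := by simp [hP m hm]

theorem monomial_coeff_mem (P : semiInvariants 𝒮 w) (n : ℕ) :
    Polynomial.monomial n (P.1.coeff n) ∈ semiInvariants 𝒮 w := by
  intro m
  rw [Polynomial.coeff_monomial]
  split_ifs with h
  · subst h; exact P.2 n
  · exact zero_mem _

/-- The component of degree `n`. -/
def component (n : ℕ) : semiInvariants 𝒮 w →+ semiPart 𝒮 w n where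
  toFun P := ⟨⟨_, monomial_coeff_mem 𝒮 w P n⟩, fun m hm => by
    simp [Polynomial.coeff_monomial, hm.symm]⟩
  map_zero' := by ext; simp
  map_add' P Q := by ext; simp

instance : SetLike.GradedMonoid (semiPart 𝒮 w) where
  one_mem m hm := by
    simp [Polynomial.coeff_one, hm]
  mul_mem i j P Q hP hQ m hm := by
    rw [MulMemClass.coe_mul, Polynomial.coeff_mul]
    refine Finset.sum_eq_zero fun k hk => ?_
    by_cases h : k.1 = i
    · have : k.2 ≠ j := by
        rintro rfl
        exact hm (by rw [← h]; exact (Finset.HasAntidiagonal.mem_antidiagonal.1 hk).symm)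
      rw [hQ _ this, mul_zero]
    · rw [hP _ h, zero_mul]

/-- The family of all components. -/
def decomp (P : semiInvariants 𝒮 w) : DirectSum ℕ fun n => semiPart 𝒮 w n :=
  DirectSum.mk _ P.1.support fun n => component 𝒮 w n P

theorem decomp_apply (P : semiInvariants 𝒮 w) (n : ℕ) : decomp 𝒮 w P n = component 𝒮 w n P := by
  by_cases h : n ∈ P.1.support
  · exact DirectSum.mk_apply_of_mem h
  · refine (DirectSum.mk_apply_of_notMem h).trans ?_
    ext : 2
    simp [component, Polynomial.notMem_support_iff.1 h]

theorem component_of_mem {n : ℕ} (x : semiPart 𝒮 w n) (m : ℕ) :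
    component 𝒮 w m x.1 = DirectSum.of (fun n => semiPart 𝒮 w n) n x m := by
  by_cases h : m = n
  · subst h
    rw [DirectSum.of_eq_same]
    ext k : 3
    by_cases hk : m = k
    · simp [component, hk]
    · simp [component, Polynomial.coeff_monomial, hk, x.2 k (Ne.symm hk)]
  · rw [DirectSum.of_eq_of_ne _ _ _ h]
    ext : 2
    simp [component, x.2 m h]

theorem component_coe (x : DirectSum ℕ fun n => semiPart 𝒮 w n) (m : ℕ) :
    component 𝒮 w m (DirectSum.coeAddMonoidHom (semiPart 𝒮 w) x) = x m := by
  induction x using DirectSum.induction_on with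
  | zero => simp
  | of i x => rw [DirectSum.coeAddMonoidHom_of, component_of_mem]
  | add x y hx hy => rw [map_add, map_add, hx, hy, DirectSum.add_apply]

instance : DirectSum.Decomposition (semiPart 𝒮 w) where
  decompose' := decomp 𝒮 w
  left_inv P := by
    ext m : 2
    have h := component_coe 𝒮 w (decomp 𝒮 w P) m
    rw [decomp_apply] at h
    have h' := congrArg (fun Q => Q.1.1.coeff m) h
    simpa [component] using h'
  right_inv x := by
    ext n : 1
    rw [decomp_apply, component_coe]

instance : GradedAlgebra (semiPart 𝒮 w) where

/-- The GIT quotient `Spec S //_w K = Proj (⨁ₙ S_{n w} tⁿ)` of `Spec S` by the torus `K` with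
character lattice `Λ`, for the stability condition `w`. -/
def quotient : Scheme.{0} := Proj (semiPart 𝒮 w)

/-- The structure morphism of the quotient. -/
def structureMap : quotient 𝒮 w ⟶ Spec (.of ℂ) :=
  Proj.toSpecZero (semiPart 𝒮 w) ≫
    Spec.map (CommRingCat.ofHom (algebraMap ℂ (semiPart 𝒮 w 0)))

theorem eq_monomial {n : ℕ} {q : semiInvariants 𝒮 w} (hq : q ∈ semiPart 𝒮 w n) :
    q.1 = Polynomial.monomial n (q.1.coeff n) := by
  ext m
  rw [Polynomial.coeff_monomial]
  split_ifs with h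
  · rw [h]
  · exact hq m (Ne.symm h)

theorem mul_coeff_mem (χ : Λ) {n m : ℕ} {p : S} (hp : p ∈ 𝒮 (χ + n • w)) (q : semiInvariants 𝒮 w) :
    p * q.1.coeff m ∈ 𝒮 (χ + (n + m) • w) := by
  have h := SetLike.mul_mem_graded hp (q.2 m)
  rwa [add_assoc, ← add_smul] at h

/-- The fraction field of `S[t]`, in which the sections of all the sheaves below take values. -/
abbrev FracField (S : Type) [CommRing S] : Type := FractionRing (Polynomial S)

/-- The inclusion of the ring of semi-invariants into that field. -/
def toFrac : semiInvariants 𝒮 w →+* FracField S :=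
  (algebraMap (Polynomial S) (FracField S)).comp (semiInvariants 𝒮 w).val.toRingHom

theorem toFrac_injective : Function.Injective (toFrac 𝒮 w) :=
  (IsFractionRing.injective (Polynomial S) (FracField S)).comp
    Subtype.val_injective

theorem toFrac_ne_zero {x : ProjectiveSpectrum (semiPart 𝒮 w)} {q : semiInvariants 𝒮 w}
    (hq : q ∉ x.asHomogeneousIdeal) : toFrac 𝒮 w q ≠ 0 := fun h => hq (by
  rw [(map_eq_zero_iff _ (toFrac_injective 𝒮 w)).1 h]; exact zero_mem _)

theorem toFrac_eq {n : ℕ} {q : semiInvariants 𝒮 w} (hq : q ∈ semiPart 𝒮 w n) :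
    toFrac 𝒮 w q = algebraMap (Polynomial S) (FracField S)
      (Polynomial.monomial n (q.1.coeff n)) := by
  rw [← eq_monomial 𝒮 w hq]; rfl

variable [IsDomain S]

/-- The inclusion of the local ring at `x` into that field, `p / q ↦ p / q`. -/
def localToFrac (x : ProjectiveSpectrum (semiPart 𝒮 w)) :
    HomogeneousLocalization.AtPrime (semiPart 𝒮 w) x.asHomogeneousIdeal.toIdeal →+* FracField S :=
  (IsLocalization.lift (M := x.asHomogeneousIdeal.toIdeal.primeCompl)
    (S := Localization x.asHomogeneousIdeal.toIdeal.primeCompl) (g := toFrac 𝒮 w) fun q =>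
      IsUnit.mk0 _ fun h => q.2 (by
        rw [(map_eq_zero_iff _ (toFrac_injective 𝒮 w)).1 h]; exact zero_mem _)).comp
    (algebraMap _ _)

variable (χ : Λ)

/-- A function on an open set is a fraction of degree `χ` if it is of the form `p / q` with
`p ∈ S_{χ + n w}`, `q ∈ S_{n w}` and `q` not vanishing anywhere on the open set. -/
def IsFraction {U : Opens (ProjectiveSpectrum.top (semiPart 𝒮 w))} (s : U → FracField S) : Prop :=
  ∃ (n : ℕ) (p : S) (q : semiInvariants 𝒮 w), p ∈ 𝒮 (χ + n • w) ∧
    q ∈ semiPart 𝒮 w n ∧ ∀ x : U, q ∉ x.1.asHomogeneousIdeal ∧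
      s x = algebraMap _ (FracField S) (Polynomial.monomial n p) / toFrac 𝒮 w q

/-- Being a fraction passes to smaller open sets. -/
def isFractionPrelocal :
    TopCat.PrelocalPredicate fun _ : ProjectiveSpectrum.top (semiPart 𝒮 w) => FracField S where
  pred s := IsFraction 𝒮 w χ s
  res := by
    rintro V U i s ⟨n, p, q, hp, hq, h⟩
    exact ⟨n, p, q, hp, hq, fun x => h (i x)⟩

/-- Functions that are locally fractions of degree `χ`. -/
def isLocallyFraction :
    TopCat.LocalPredicate fun _ : ProjectiveSpectrum.top (semiPart 𝒮 w) => FracField S :=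
  (isFractionPrelocal 𝒮 w χ).sheafify

/-- The value of a fraction in the local ring at `x`. -/
theorem localToFrac_mk (x : ProjectiveSpectrum (semiPart 𝒮 w))
    (c : HomogeneousLocalization.NumDenSameDeg (semiPart 𝒮 w)
      x.asHomogeneousIdeal.toIdeal.primeCompl) :
    localToFrac 𝒮 w x (HomogeneousLocalization.mk c) = toFrac 𝒮 w c.num / toFrac 𝒮 w c.den := by
  have h0 : toFrac 𝒮 w c.den ≠ 0 := toFrac_ne_zero 𝒮 w (x := x) c.den_mem
  change IsLocalization.lift _ (HomogeneousLocalization.val (HomogeneousLocalization.mk c)) = _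
  rw [HomogeneousLocalization.val_mk, Localization.mk_eq_mk', IsLocalization.lift_mk'_spec]
  exact (mul_div_cancel₀ _ h0).symm

/-- The sections over `U` of the sheaf attached to the character `χ`: the functions that are
locally fractions of degree `χ`. -/
def sections (U : Opens (ProjectiveSpectrum.top (semiPart 𝒮 w))) :
    Submodule ℂ (U → FracField S) where
  carrier := {s | (isLocallyFraction 𝒮 w χ).pred s}
  zero_mem' x := ⟨U, x.2, 𝟙 _, 0, 0, 1, zero_mem _, SetLike.GradedOne.one_mem, fun y =>
    ⟨fun h => y.1.isPrime.ne_top ((Ideal.eq_top_iff_one _).2 h), by simp⟩⟩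
  add_mem' {s s'} hs hs' x := by
    obtain ⟨V, hV, i, n, p, q, hp, hq, h⟩ := hs x
    obtain ⟨V', hV', i', n', p', q', hp', hq', h'⟩ := hs' x
    refine ⟨V ⊓ V', ⟨hV, hV'⟩, Opens.infLELeft _ _ ≫ i, n + n',
      p * q'.1.coeff n' + p' * q.1.coeff n, q * q', ?_, SetLike.mul_mem_graded hq hq', ?_⟩
    · refine add_mem (mul_coeff_mem 𝒮 w χ hp q') ?_
      have := mul_coeff_mem 𝒮 w χ (m := n) hp' q
      rwa [add_comm n' n] at this
    · intro y
      obtain ⟨h1, h2⟩ := h ⟨y.1, y.2.1⟩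
      obtain ⟨h1', h2'⟩ := h' ⟨y.1, y.2.2⟩
      refine ⟨fun hm => (y.1.isPrime.mem_or_mem hm).elim h1 h1', ?_⟩
      have e : s (i ⟨y.1, y.2.1⟩) + s' (i' ⟨y.1, y.2.2⟩) = _ := congrArg₂ (· + ·) h2 h2'
      refine Eq.trans e ?_
      have n1 := toFrac_ne_zero 𝒮 w h1
      have n2 := toFrac_ne_zero 𝒮 w h1'
      rw [div_add_div _ _ n1 n2, map_mul (toFrac 𝒮 w), map_add (Polynomial.monomial (n + n')),
        map_add (algebraMap (Polynomial S) (FracField S)), toFrac_eq 𝒮 w hq, toFrac_eq 𝒮 w hq',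
        ← Polynomial.monomial_mul_monomial, add_comm n n', ← Polynomial.monomial_mul_monomial,
        map_mul, map_mul]
      ring
  smul_mem' c s hs x := by
    obtain ⟨V, hV, i, n, p, q, hp, hq, h⟩ := hs x
    refine ⟨V, hV, i, n, c • p, q, Submodule.smul_mem _ _ hp, hq, fun y => ⟨(h y).1, ?_⟩⟩
    refine (congrArg (c • ·) (h y).2).trans ?_
    rw [← Polynomial.smul_monomial, Algebra.smul_def, Algebra.smul_def, map_mul,
      ← IsScalarTower.algebraMap_apply, mul_div_assoc]

theorem smul_mem (U : Opens (ProjectiveSpectrum.top (semiPart 𝒮 w)))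
    (f : (ProjectiveSpectrum.Proj.structureSheaf (semiPart 𝒮 w)).1.obj (op U))
    (s : sections 𝒮 w χ U) :
    (fun x => localToFrac 𝒮 w x.1 (f.1 x) * s.1 x) ∈ sections 𝒮 w χ U := by
  intro x
  obtain ⟨V, hV, i, n, p, q, hp, hq, h⟩ := s.2 x
  obtain ⟨V', hV', i', n', a, b, hb, h'⟩ := f.2 x
  refine ⟨V ⊓ V', ⟨hV, hV'⟩, Opens.infLELeft _ _ ≫ i, n + n', p * a.1.1.coeff n', q * b.1,
    mul_coeff_mem 𝒮 w χ hp a.1, SetLike.mul_mem_graded hq b.2, fun y => ?_⟩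
  obtain ⟨h1, h2⟩ := h ⟨y.1, y.2.1⟩
  have h3 := h' ⟨y.1, y.2.2⟩
  have h4 := hb ⟨y.1, y.2.2⟩
  refine ⟨fun hm => (y.1.isPrime.mem_or_mem hm).elim h1 h4, ?_⟩
  have e : localToFrac 𝒮 w y.1 (f.1 (i' ⟨y.1, y.2.2⟩)) * s.1 (i ⟨y.1, y.2.1⟩) = _ :=
    congrArg₂ (· * ·) ((congrArg (localToFrac 𝒮 w y.1) h3).trans (localToFrac_mk 𝒮 w y.1 _)) h2
  refine Eq.trans e ?_
  have n1 := toFrac_ne_zero 𝒮 w h1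
  have n2 := toFrac_ne_zero 𝒮 w (x := y.1) h4
  rw [← Polynomial.monomial_mul_monomial, map_mul, map_mul, ← toFrac_eq 𝒮 w a.2, mul_comm,
    div_mul_div_comm]

/-- The sections of the structure sheaf over `U` act on the sections of the sheaf attached to `χ` by
multiplication. -/
instance sectionsModule (U : (Opens (ProjectiveSpectrum.top (semiPart 𝒮 w)))ᵒᵖ) :
    Module ((ProjectiveSpectrum.Proj.structureSheaf (semiPart 𝒮 w)).1.obj U)
      (sections 𝒮 w χ U.unop) where
  smul f s := ⟨_, smul_mem 𝒮 w χ U.unop f s⟩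
  one_smul s := by
    ext x
    exact (congrArg (· * s.1 x) (map_one (localToFrac 𝒮 w x.1))).trans (one_mul _)
  mul_smul f g s := by
    ext x
    exact (congrArg (· * s.1 x) (map_mul (localToFrac 𝒮 w x.1) _ _)).trans (mul_assoc _ _ _)
  smul_zero f := by
    ext x
    exact mul_zero _
  zero_smul s := by
    ext x
    exact (congrArg (· * s.1 x) (map_zero (localToFrac 𝒮 w x.1))).trans (zero_mul _)
  smul_add f s s' := by
    ext x
    exact mul_add _ _ _
  add_smul f g s := by
    ext x
    exact (congrArg (· * s.1 x) (map_add (localToFrac 𝒮 w x.1) _ _)).trans (add_mul _ _ _)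

/-- The presheaf of abelian groups underlying the sheaf attached to `χ`. -/
def presheafAb : TopCat.Presheaf Ab.{0} (quotient 𝒮 w) where
  obj U := .of (sections 𝒮 w χ U.unop)
  map i := AddCommGrpCat.ofHom
    { toFun s := ⟨fun x => s.1 (i.unop x), (isLocallyFraction 𝒮 w χ).res i.unop s.1 s.2⟩
      map_zero' := rfl
      map_add' _ _ := rfl }

/-- The sheaf on the quotient attached to the character `χ`: the sheaf of `χ`-semi-invariant
functions, that is the sheaf associated to the graded module `⨁ₙ S_{χ + n w} tⁿ`. Its sections over
`U` are `sections 𝒮 w χ U`. -/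
def sheaf : (quotient 𝒮 w).Modules where
  val :=
    letI (U : (quotient 𝒮 w).Opensᵒᵖ) :
        Module ((quotient 𝒮 w).ringCatSheaf.obj.obj U) ((presheafAb 𝒮 w χ).obj U) :=
      sectionsModule 𝒮 w χ U
    .ofPresheaf (presheafAb 𝒮 w χ) fun _ _ _ _ _ ↦ rfl
  isSheaf := (TopCat.Presheaf.isSheaf_iff_isSheaf_comp (forget AddCommGrpCat) _).2
    (TopCat.subsheafToTypes (isLocallyFraction 𝒮 w χ)).2

/-- The sections of the sheaf attached to `χ` form a complex vector space, with pointwise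
operations. -/
instance (U : (quotient 𝒮 w).Opens) : Module ℂ Γ(sheaf 𝒮 w χ, U) :=
  inferInstanceAs (Module ℂ (sections 𝒮 w χ U))

/-- An element of `S` of degree `χ` as a global section of the sheaf attached to `χ`. -/
def globalSection {p : S} (hp : p ∈ 𝒮 χ) : Γ(sheaf 𝒮 w χ, ⊤) :=
  (⟨fun _ => algebraMap _ (FracField S) (Polynomial.C p), fun x => ⟨⊤, trivial, 𝟙 _, 0, p, 1,
    by rwa [zero_smul, add_zero], SetLike.GradedOne.one_mem, fun y =>
      ⟨fun h => y.1.isPrime.ne_top ((Ideal.eq_top_iff_one _).2 h), by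
        rw [map_one, div_one]; rfl⟩⟩⟩ : sections 𝒮 w χ ⊤)

end

end TorusGIT

/-! ### Toric quotient varieties of quivers -/

namespace ToricQuiver

noncomputable section

variable {V : Type} [Quiver.{0} V] (x₀ : V)

/-- The character lattice of the torus `K = (ℂ*)^(V ∖ {x₀})`. -/
abbrev Characters : Type := {v : V // v ≠ x₀} → ℤ

open Classical in
/-- The standard basis vector `e v` of the character lattice, with `e x₀ = 0`. -/
def e (v : V) : Characters x₀ := fun u => if u.1 = v then 1 else 0

/-- The weight `D_a = - e_i + e_j` of an arrow `a` from `i` to `j`. -/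
def weight (a : Quiver.Total V) : Characters x₀ := e x₀ a.right - e x₀ a.left

/-- The stability condition, the sum of the weights of all arrows. -/
def stability : Characters x₀ := ∑ᶠ a : Quiver.Total V, weight x₀ a

/-- The coordinate ring of `ℂ^(arrows)`. -/
abbrev Coord (V : Type) [Quiver.{0} V] : Type := MvPolynomial (Quiver.Total V) ℂ

/-- The grading of the coordinate ring by the weights of the arrows. -/
abbrev grading : Characters x₀ → Submodule ℂ (Coord V) :=
  MvPolynomial.weightedHomogeneousSubmodule ℂ (weight x₀)

instance : SetLike.GradedMonoid (grading x₀) :=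
  MvPolynomial.WeightedHomogeneousSubmodule.gradedMonoid

/-- The toric variety `ℂ^(arrows) //_w K` of the quiver. -/
abbrev variety : Scheme.{0} := TorusGIT.quotient (grading x₀) (stability x₀)

/-- The monomial of a path, the product of the variables of its arrows. -/
def pathMonomial {u : V} : ∀ {v : V}, Quiver.Path u v → Coord V
  | _, .nil => 1
  | _, .cons p a => pathMonomial p * MvPolynomial.X ⟨_, _, a⟩

theorem pathMonomial_mem {u v : V} (p : Quiver.Path u v) :
    pathMonomial p ∈ grading x₀ (e x₀ v - e x₀ u) := by
  induction p with
  | nil => rw [sub_self]; exact SetLike.GradedOne.one_mem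
  | @cons b c p a ih =>
    have h : MvPolynomial.X ⟨b, c, a⟩ ∈ grading x₀ (weight x₀ ⟨b, c, a⟩) :=
      MvPolynomial.isWeightedHomogeneous_X ℂ _ _
    have h' := SetLike.mul_mem_graded ih h
    rwa [weight, sub_add_sub_cancel'] at h'

end

end ToricQuiver

/-! ### Y-shaped quivers and their ladder quivers -/

namespace YShaped

noncomputable section

variable {ρ : ℕ} (n : Fin (ρ + 1) → Fin (ρ + 1) → ℕ) (r : Fin (ρ + 1) → ℕ)

/-- A quiver with vertices `0, …, ρ` and `n i j` arrows from `i` to `j` is *Y-shaped*. -/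
structure IsYShaped : Prop where
  one_le : 1 ≤ ρ
  acyclic : ∀ i j, j ≤ i → n i j = 0
  out_one : ∑ j, n 1 j ≤ 2
  out_le : ∀ i, i ≠ 0 → i ≠ 1 → ∑ j, n i j ≤ 1
  in_le : ∀ j, ∑ i ∈ Finset.univ.erase 0, n i j ≤ 1
  path : ∀ j, 1 < j → Relation.ReflTransGen (fun i j => 0 < n i j) 1 j

/-- The number `s_i = ∑ⱼ n_{ji} r_j`. -/
def sIn (i : Fin (ρ + 1)) : ℕ := ∑ j, n j i * r j

/-- The number `s'_i = ∑ⱼ n_{ij} r_j`. -/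
def sOut (i : Fin (ρ + 1)) : ℕ := ∑ j, n i j * r j

/-- The number `s̃_i` of paths from `0` to `i`. -/
def sTilde (i : Fin (ρ + 1)) : ℕ :=
  if i = 0 then 1 else ∑ j : {j // j < i}, n j.1 i * sTilde j.1
termination_by i
decreasing_by exact j.2

/-- `r` is the dimension vector of a nondegenerate quiver flag variety whose anticanonical class
`∑ᵢ (s_i - s'_i) c₁(W_i)` lies in the interior of the positive orthant. -/
def IsFano : Prop :=
  r 0 = 1 ∧ ∀ i, i ≠ 0 → 1 ≤ r i ∧ r i < sIn n r i ∧ sOut n r i < sIn n r i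

/-- `R` is the set of vertices of the branch whose ladder diagram is rotated: one of the two branches
at the vertex `1` if there are two arrows out of `1`, and empty otherwise. -/
def IsRotatedBranch (R : Finset (Fin (ρ + 1))) : Prop :=
  (∑ j, n 1 j ≤ 1 ∧ R = ∅) ∨ (∑ j, n 1 j = 2 ∧ ∃ b, 0 < n 1 b ∧
    ∀ j, j ∈ R ↔ Relation.ReflTransGen (fun i j => 0 < n i j) b j)

/-- The width `s̃_i - r_i` of the ladder diagram of the Grassmannian `Gr(s̃_i, r_i)`, whose height
is `r_i`. -/
def width (i : Fin (ρ + 1)) : ℤ := sTilde n i - r i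

/-- The width belonging to the vertex that precedes `i` on its leg (`0` for `i = 1`). -/
def prevWidth (i : Fin (ρ + 1)) : ℤ := ∑ j ∈ Finset.univ.erase 0, n j i * width n r j

/-- The height belonging to the vertex that precedes `i` on its leg (`0` for `i = 1`). -/
def prevHeight (i : Fin (ρ + 1)) : ℕ := ∑ j ∈ Finset.univ.erase 0, n j i * r j

/-- The unit cells, given by their lower left corners, of the ladder diagram of a leg with set of
vertices `A`: over the columns between the previous width and `s̃_i - r_i` the height is `r_i`. -/
def legCells (A : Finset (Fin (ρ + 1))) : Finset (ℤ × ℤ) :=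
  A.biUnion fun i => Finset.Ico (prevWidth n r i) (width n r i) ×ˢ Finset.Ico 0 (r i : ℤ)

/-- The vertices of the ladder diagram of a leg: the origin, the interior lattice points, the external
vertices `(s̃_i - r_i, r_i)`, and the intersection points where the upper edge of the block of `i`
meets the right edge of the previous block. -/
def legVertices (A : Finset (Fin (ρ + 1))) : Finset (ℤ × ℤ) :=
  {(0, 0)} ∪
  {p ∈ legCells n r A | p - (1, 0) ∈ legCells n r A ∧ p - (0, 1) ∈ legCells n r A ∧
    p - (1, 1) ∈ legCells n r A} ∪
  A.image (fun i => (width n r i, (r i : ℤ))) ∪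
  {i ∈ A | r i ≤ prevHeight n r i}.image (fun i => (prevWidth n r i, (r i : ℤ)))

/-- The rotation by `180°` that exchanges the origin and `(s̃_1 - r_1, r_1)`, on points. -/
def rotate (p : ℤ × ℤ) : ℤ × ℤ := (width n r 1, (r 1 : ℤ)) - p

variable (R : Finset (Fin (ρ + 1)))

/-- The leg that is not rotated. -/
def leg : Finset (Fin (ρ + 1)) := Finset.univ \ insert 0 R

/-- The cells of the ladder diagram: those of the leg that is not rotated, and those of the rotated
leg (a cell `p` is rotated to the cell with upper right corner `rotate p`). -/
def cells : Finset (ℤ × ℤ) :=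
  legCells n r (leg R) ∪ (legCells n r (insert 1 R)).image (fun p => rotate n r p - (1, 1))

/-- The vertices of the ladder diagram. -/
def vertices : Finset (ℤ × ℤ) :=
  legVertices n r (leg R) ∪ (legVertices n r (insert 1 R)).image (rotate n r)

/-- One step to the right or upwards along an edge of a cell in `A`. -/
def Step (A : Finset (ℤ × ℤ)) (p q : ℤ × ℤ) : Prop :=
  (q = p + (1, 0) ∧ (p ∈ A ∨ p - (0, 1) ∈ A)) ∨ (q = p + (0, 1) ∧ (p ∈ A ∨ p - (1, 0) ∈ A))

/-- The vertices of the ladder quiver. -/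
def Vertex : Type := {p : ℤ × ℤ // p ∈ vertices n r R}

/-- The arrows of the ladder quiver: the lattice paths along edges of the ladder diagram, going right
and upwards from one vertex to another, with no vertex in between. -/
@[ext]
structure Arrow (u v : Vertex n r R) : Type where
  /-- The lattice points strictly between the ends. -/
  mid : List (ℤ × ℤ)
  isChain : List.IsChain (Step (cells n r R)) (u.1 :: (mid ++ [v.1]))
  notMem : ∀ p ∈ mid, p ∉ vertices n r R

/-- The ladder quiver. -/
instance ladderQuiver : Quiver.{0} (Vertex n r R) := ⟨Arrow n r R⟩

theorem Step.lt {A : Finset (ℤ × ℤ)} {p q : ℤ × ℤ} (h : Step A p q) : p < q := by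
  rcases h with ⟨rfl, -⟩ | ⟨rfl, -⟩ <;> simp [Prod.lt_iff]

theorem Arrow.pairwise {u v : Vertex n r R} (a : Arrow n r R u v) :
    (u.1 :: (a.mid ++ [v.1])).Pairwise (· < ·) :=
  (a.isChain.imp fun _ _ h => h.lt).pairwise

instance (u v : Vertex n r R) : Finite (Arrow n r R u v) := by
  let f (a : Arrow n r R u v) : (Finset.Icc u.1 v.1).powerset := ⟨a.mid.toFinset, by
    have h := a.pairwise
    rw [List.pairwise_cons, List.pairwise_append] at h
    refine Finset.mem_powerset.2 fun p hp => ?_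
    rw [List.mem_toFinset] at hp
    exact Finset.mem_Icc.2 ⟨(h.1 p (by simp [hp])).le, (h.2.2.2 p hp v.1 (by simp)).le⟩⟩
  refine Finite.of_injective f fun a b hab => ?_
  have ha := a.pairwise
  have hb := b.pairwise
  rw [List.pairwise_cons, List.pairwise_append] at ha hb
  have h : a.mid.toFinset = b.mid.toFinset := congrArg Subtype.val hab
  ext1
  refine List.Perm.eq_of_pairwise (fun x y _ _ h1 h2 => (lt_asymm h1 h2).elim) ha.2.1 hb.2.1 ?_
  exact List.perm_of_nodup_nodup_toFinset_eq (ha.2.1.imp fun h => h.ne) (hb.2.1.imp fun h => h.ne) h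

instance : Finite (Vertex n r R) := inferInstanceAs (Finite {p : ℤ × ℤ // p ∈ vertices n r R})

instance : Finite (Quiver.Total (Vertex n r R)) := by
  refine Finite.of_injective
    (fun a => (⟨a.left, a.right, a.hom⟩ : Σ u v : Vertex n r R, Arrow n r R u v)) ?_
  rintro ⟨u, v, a⟩ ⟨u', v', a'⟩ h
  cases h
  rfl

/-- The vertex `x₀ = (0, 0)`. -/
def origin : Vertex n r R := ⟨(0, 0), by simp [vertices, legVertices]⟩

/-- The external vertex `v_1 = (s̃_1 - r_1, r_1)`. -/
def extOne : Vertex n r R := ⟨(width n r 1, (r 1 : ℤ)), Finset.mem_union_right _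
  (Finset.mem_image.2 ⟨(0, 0), by simp [legVertices], by simp [rotate]⟩)⟩

theorem ext_mem {A : Finset (Fin (ρ + 1))} {i : Fin (ρ + 1)} (h : i ∈ A) :
    (width n r i, (r i : ℤ)) ∈ legVertices n r A :=
  Finset.mem_union_left _ (Finset.mem_union_right _ (Finset.mem_image_of_mem _ h))

/-- The external vertex `v_i` for `i ≠ 0`. -/
def ext (i : Fin (ρ + 1)) (hi : i ≠ 0) : Vertex n r R :=
  if h : i ∈ R then
    ⟨rotate n r (width n r i, (r i : ℤ)), Finset.mem_union_right _
      (Finset.mem_image_of_mem _ (ext_mem n r (Finset.mem_insert_of_mem h)))⟩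
  else
    ⟨(width n r i, (r i : ℤ)), Finset.mem_union_left _ (ext_mem n r (by simp [leg, hi, h]))⟩

/-- The start of the paths that belong to `i`: the paths for `i` on the leg that is not rotated lead
from `x₀` to `v_i`, and the paths for `i` on the rotated leg lead from `v_i` to `v_1`. -/
def pathStart (i : Fin (ρ + 1)) (hi : i ≠ 0) : Vertex n r R :=
  if i ∈ R then ext n r R i hi else origin n r R

/-- The end of the paths that belong to `i`. -/
def pathEnd (i : Fin (ρ + 1)) (hi : i ≠ 0) : Vertex n r R :=
  if i ∈ R then extOne n r R else ext n r R i hi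

/-- The toric variety `X(Q)`. -/
abbrev ladderVariety : Scheme.{0} := ToricQuiver.variety (origin n r R)

/-- The structure morphism of `X(Q)`. -/
def ladderStructureMap : ladderVariety n r R ⟶ Spec (.of ℂ) :=
  TorusGIT.structureMap (ToricQuiver.grading (origin n r R)) (ToricQuiver.stability (origin n r R))

/-- The divisor class `D_i` of a path between the two ends that belong to `i`, as a character: the
sum of the weights of the arrows of any such path. -/
def divisorClass (i : Fin (ρ + 1)) (hi : i ≠ 0) : ToricQuiver.Characters (origin n r R) :=
  ToricQuiver.e (origin n r R) (pathEnd n r R i hi) -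
    ToricQuiver.e (origin n r R) (pathStart n r R i hi)

/-- The sheaf `L_i` on `X(Q)` attached to the divisor class `D_i`. -/
abbrev ladderSheaf (i : Fin (ρ + 1)) (hi : i ≠ 0) : (ladderVariety n r R).Modules :=
  TorusGIT.sheaf (ToricQuiver.grading (origin n r R)) (ToricQuiver.stability (origin n r R))
    (divisorClass n r R i hi)

/-- The global section of `L_i` given by a path: the product of the variables of its arrows. -/
def pathSection (i : Fin (ρ + 1)) (hi : i ≠ 0)
    (p : Quiver.Path (pathStart n r R i hi) (pathEnd n r R i hi)) : Γ(ladderSheaf n r R i hi, ⊤) :=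
  TorusGIT.globalSection _ _ _ (ToricQuiver.pathMonomial_mem (origin n r R) p)

end

end YShaped

/-! ### Frames, and pullback of line bundles and of global generation -/

namespace SheafNotions

/-! Monomials of degree `m w_Q` are flows `b` on the ladder quiver whose divergence is `m` times
that of the flow with one unit on every arrow; for `m > 0` these are the stable flows
(`IsStableFlow`). At every point of `X(Q)` some stable monomial `x^b` does not vanish. If `b` is
positive along a path from `u` to `v`, then the monomial of the path divides `x^b`, and
multiplication by it trivialises the sheaf of degree `e_v - e_u` wherever `x^b ≠ 0`
(`isFrame_globalSection`). So local triviality and global generation of `L_i` follow once every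
stable flow is known to carry a path between the two ends that belong to `i` (`carries_path`).
Nefness is then formal: a nonzero section of a globally generated line bundle on a curve has no
poles.

The paths come from a cut argument. Contracting the lattice points that are not vertices turns the
sum over the arrows into a sum over the edges of the diagram (`exists_equiv`, `sum_arrows`), in
which the interior vertices cancel. What is left writes `w_Q` as a combination of the `D_i` whose
coefficients are at least `s_i - s'_i`, hence positive (`edgeSum_anchor`, `exists_sum_eq`).
Therefore a set of vertices that a stable flow does not leave, and whose indicator does not increase
along any `D_i`, is constant along each `D_i` (`not_all_neg`). Applied to the vertices reachable
from `x₀`, this gives a path from `x₀` to `v_1`. For the other `v_i` one takes the vertices that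
reach `v_i`, or that are reachable from it. The only way the two legs could interfere is a path from
the left part to the right part, and by planarity such a path meets the one from `x₀` to `v_1`
(`exists_crossing`).

For the basis, a global section is a single element `c` of the fraction field, and some power of any
stable monomial multiplies `c` into the polynomial ring (`exists_eq_const`). Every arrow is avoided
by some stable flow, since a path along two sides of a cell can be exchanged for the other two
sides. Hence no variable can occur in a denominator, and `c` is a polynomial of degree `D_i`
(`exists_eq_globalSection`). Its monomials are unit flows between two vertices of an acyclic quiver,
that is, paths (`exists_pathFlow_eq`). -/

theorem IsFrame.restrict {X : Scheme.{0}} {M : X.Modules} {V : X.Opens} {g : Γ(M, V)}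
    (hg : IsFrame M g) {W : X.Opens} (h : W ≤ V) : IsFrame M (M.presheaf.map (homOfLE h).op g) := by
  intro U hU
  have := hg U (hU.trans h)
  have e : M.presheaf.map (homOfLE hU).op (M.presheaf.map (homOfLE h).op g) =
      M.presheaf.map (homOfLE (hU.trans h)).op g := by
    rw [← ConcreteCategory.comp_apply, ← Functor.map_comp]
    rfl
  rwa [e]

/-- The family of restrictions of a global section. -/
noncomputable def familyOfSection {X : Scheme.{0}} {M : X.Modules} (s : Γ(M, ⊤)) :
    SheafOfModules.sections (show SheafOfModules X.ringCatSheaf from M) :=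
  PresheafOfModules.sectionsMk (fun U => M.presheaf.map (homOfLE le_top : U.unop ⟶ ⊤).op s) (by
    intro U V f
    change (M.presheaf.map f) (M.presheaf.map (homOfLE le_top : U.unop ⟶ ⊤).op s) = _
    rw [← ConcreteCategory.comp_apply, ← Functor.map_comp]
    rfl)

/-- The structure sheaf as a sheaf of modules. -/
noncomputable abbrev structureModule (X : Scheme.{0}) : X.Modules :=
  SheafOfModules.unit X.ringCatSheaf

/-- The morphism from the structure sheaf given by a global section. -/
noncomputable def homOfSection {X : Scheme.{0}} {M : X.Modules} (s : Γ(M, ⊤)) :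
    structureModule X ⟶ M :=
  (SheafOfModules.unitHomEquiv (show SheafOfModules X.ringCatSheaf from M)).symm (familyOfSection s)

/-- Over `U` the morphism is `f ↦ f • s`, so the frame condition says exactly that it is bijective
on sections. The converse `exists_isFrame_of_iso` takes the image of `1`. -/
theorem isIso_homOfSection {X : Scheme.{0}} {M : X.Modules} {s : Γ(M, ⊤)} (hs : IsFrame M s) :
    IsIso (homOfSection s) := by
  rw [Scheme.Modules.Hom.isIso_iff_isIso_app]
  intro U
  rw [ConcreteCategory.isIso_iff_bijective]
  exact hs U le_top

theorem app_map {X : Scheme.{0}} {M N : X.Modules} (φ : M ⟶ N) {U V : X.Opens} (h : U ≤ V)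
    (s : Γ(M, V)) :
    φ.app U (M.presheaf.map (homOfLE h).op s) = N.presheaf.map (homOfLE h).op (φ.app V s) :=
  ConcreteCategory.congr_hom (φ.mapPresheaf.naturality (homOfLE h).op) s

theorem exists_isFrame_of_iso {X : Scheme.{0}} {M : X.Modules} (e : structureModule X ≅ M) :
    ∃ s : Γ(M, ⊤), IsFrame M s := by
  let u : Γ(structureModule X, ⊤) := (1 : Γ(X, ⊤))
  refine ⟨e.hom.app ⊤ u, fun W h => ?_⟩
  have hb : Function.Bijective (e.hom.app W) := by
    rw [← ConcreteCategory.isIso_iff_bijective]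
    infer_instance
  have : (fun f : Γ(X, W) => f • M.presheaf.map (homOfLE h).op (e.hom.app ⊤ u)) =
      e.hom.app W := by
    funext f
    rw [← app_map, ← Scheme.Modules.Hom.app_smul]
    congr 1
    change f * X.presheaf.map (homOfLE h).op (1 : Γ(X, ⊤)) = f
    rw [map_one, mul_one]
  rwa [this]

/-- The two conditions differ only by the ring isomorphism between functions on `W` and on `i ''ᵁ
W`, and every open set inside the image of `i` has the form `i ''ᵁ W`. -/
theorem isFrame_restrict {X Y : Scheme.{0}} (i : X ⟶ Y) [IsOpenImmersion i] {M : Y.Modules}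
    (g : Γ(M, i ''ᵁ ⊤)) :
    IsFrame (M.restrict i) (V := ⊤) g ↔ IsFrame M g := by
  have key (W : X.Opens) : Function.Bijective
      (fun f : Γ(X, W) => f • (M.restrict i).presheaf.map (homOfLE le_top : W ⟶ ⊤).op g) ↔
      Function.Bijective (fun f : Γ(Y, i ''ᵁ W) =>
        f • M.presheaf.map (homOfLE (i.image_mono (le_top : W ≤ ⊤))).op g) := by
    have hb : Function.Bijective (i.appIso W).inv := by
      rw [← ConcreteCategory.isIso_iff_bijective]
      infer_instance
    rw [← hb.of_comp_iff]
    rfl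
  constructor
  · intro h W hW
    obtain ⟨W, rfl⟩ : ∃ W', W = i ''ᵁ W' := ⟨i ⁻¹ᵁ W, by
      rw [Scheme.Hom.image_preimage_eq_opensRange_inf, right_eq_inf]
      simpa using hW⟩
    exact (key W).1 (h W le_top)
  · intro h W hW
    exact (key W).2 (h _ _)

theorem IsFrame.isIso_restrict {X : Scheme.{0}} {M : X.Modules} {V : X.Opens} {g : Γ(M, V)}
    (hg : IsFrame M g) : Nonempty (structureModule V ≅ M.restrict V.ι) := by
  have h := (isFrame_restrict V.ι (M := M) _).2 (hg.restrict (W := V.ι ''ᵁ ⊤) (by simp))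
  exact ⟨@asIso _ _ _ _ _ (isIso_homOfSection h)⟩

/-- The whole space gives a terminal object of each comma category, which is therefore connected.
Finality is what makes the pullback of the structure sheaf the structure sheaf. -/
theorem final_opensMap {X Y : Scheme.{0}} (f : X ⟶ Y) : (Opens.map f.base).Final where
  out U :=
    isConnected_of_isTerminal (StructuredArrow U (Opens.map f.base))
      (x := StructuredArrow.mk (Y := (⊤ : Y.Opens)) (homOfLE le_top))
      (Limits.IsTerminal.ofUniqueHom (fun V => StructuredArrow.homMk (homOfLE le_top) rfl)
        fun _ _ => by ext; rfl)

theorem nonempty_pullback_structureModule {X Y : Scheme.{0}} (f : X ⟶ Y) :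
    Nonempty (structureModule X ≅ (Scheme.Modules.pullback f).obj (structureModule Y)) :=
  haveI : (SheafOfModules.pushforward.{0} f.toRingCatSheafHom).IsRightAdjoint :=
    (Scheme.Modules.pullbackPushforwardAdjunction f).isRightAdjoint
  haveI := final_opensMap f
  haveI := SheafOfModules.instIsIsoPullbackObjUnitToUnitOfFinal.{0} f.toRingCatSheafHom
  ⟨(asIso (SheafOfModules.pullbackObjUnitToUnit f.toRingCatSheafHom)).symm⟩

/-- Restriction to an open set is itself a pullback, so it commutes with pullback along `f`; over
the preimage of an open set with a frame only the structure sheaf has to be pulled back. -/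
theorem IsLineBundle.pullback {X Y : Scheme.{0}} (f : X ⟶ Y) {M : Y.Modules}
    (hM : IsLineBundle M) : IsLineBundle ((Scheme.Modules.pullback f).obj M) := by
  intro x
  obtain ⟨V, hxV, g, hg⟩ := hM (f x)
  obtain ⟨e⟩ := hg.isIso_restrict
  let U : X.Opens := f ⁻¹ᵁ V
  obtain ⟨e'⟩ := nonempty_pullback_structureModule (f ∣_ V)
  let E : structureModule U ≅ ((Scheme.Modules.pullback f).obj M).restrict U.ι :=
    e' ≪≫ (Scheme.Modules.pullback (f ∣_ V)).mapIso (e ≪≫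
      (Scheme.Modules.restrictFunctorIsoPullback V.ι).app M) ≪≫
      (Scheme.Modules.pullbackComp (f ∣_ V) V.ι).app M ≪≫
      (Scheme.Modules.pullbackCongr (morphismRestrict_ι f V)).app M ≪≫
      ((Scheme.Modules.pullbackComp U.ι f).app M).symm ≪≫
      ((Scheme.Modules.restrictFunctorIsoPullback U.ι).app _).symm
  obtain ⟨s, hs⟩ := exists_isFrame_of_iso E
  exact ⟨U.ι ''ᵁ ⊤, by simpa [U] using hxV, s, (isFrame_restrict U.ι s).1 hs⟩

/-- Pullback is a left adjoint and fixes structure sheaves, so it takes an epimorphism from a free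
module to another one. -/
theorem IsGloballyGenerated.pullback {X Y : Scheme.{0}} (f : X ⟶ Y) {M : Y.Modules}
    (hM : IsGloballyGenerated M) : IsGloballyGenerated ((Scheme.Modules.pullback f).obj M) := by
  obtain ⟨G⟩ := hM
  obtain ⟨e⟩ := nonempty_pullback_structureModule f
  let F : SheafOfModules Y.ringCatSheaf ⥤ SheafOfModules X.ringCatSheaf := Scheme.Modules.pullback f
  have : Limits.PreservesColimitsOfSize.{0, 0} F :=
    (Scheme.Modules.pullbackPushforwardAdjunction f).leftAdjoint_preservesColimits
  exact ⟨SheafOfModules.GeneratingSections.map G F e⟩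

end SheafNotions

/-! ### Nefness of globally generated line bundles -/

namespace SheafNotions

theorem eq_of_locally_eq {X : Scheme.{0}} (M : X.Modules) {U : X.Opens} (s t : Γ(M, U))
    (h : ∀ x ∈ U, ∃ (V : X.Opens) (_ : x ∈ V) (hV : V ≤ U),
      M.presheaf.map (homOfLE hV).op s = M.presheaf.map (homOfLE hV).op t) : s = t := by
  choose V hxV hV e using h
  refine TopCat.Sheaf.eq_of_locally_eq' ⟨M.presheaf, M.isSheaf⟩ (fun x : U => V x.1 x.2) U
    (fun x => homOfLE (hV x.1 x.2)) (fun x hx => ?_) s t fun x => e x.1 x.2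
  exact Opens.mem_iSup.2 ⟨⟨x, hx⟩, hxV x hx⟩

/-- Two morphisms out of `M` that agree on the given sections agree locally on everything, because
near each point every section is a multiple of one of the given ones. -/
theorem isGloballyGenerated_of_isFrame {X : Scheme.{0}} {M : X.Modules} {I : Type}
    (s : I → Γ(M, ⊤)) (h : ∀ x : X, ∃ (i : I) (V : X.Opens), x ∈ V ∧
      IsFrame M (M.presheaf.map (homOfLE le_top : V ⟶ ⊤).op (s i))) : IsGloballyGenerated M := by
  let M' : SheafOfModules X.ringCatSheaf := M
  let σ (i : I) : M'.sections := familyOfSection (s i)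
  refine ⟨{ I := I, s := σ, epi := ⟨fun {N} a b hab => ?_⟩ }⟩
  let N' : X.Modules := N
  let a' : M ⟶ N' := a
  let b' : M ⟶ N' := b
  have hab' (i : I) : SheafOfModules.sectionsMap (M := M') a (σ i) =
      SheafOfModules.sectionsMap (M := M') b (σ i) := by
    have h1 := congrFun (congrArg (SheafOfModules.freeHomEquiv N) hab) i
    change SheafOfModules.sectionsMap (M := M') a
      (SheafOfModules.freeHomEquiv M' ((SheafOfModules.freeHomEquiv M').symm σ) i) =
      SheafOfModules.sectionsMap (M := M') b
      (SheafOfModules.freeHomEquiv M' ((SheafOfModules.freeHomEquiv M').symm σ) i) at h1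
    rwa [Equiv.apply_symm_apply] at h1
  have key (i : I) (V : X.Opens) : a'.app V (M.presheaf.map (homOfLE le_top : V ⟶ ⊤).op (s i)) =
      b'.app V (M.presheaf.map (homOfLE le_top : V ⟶ ⊤).op (s i)) :=
    congrArg (fun t : SheafOfModules.sections N => t.eval (op V)) (hab' i)
  suffices a' = b' from this
  ext U m
  refine eq_of_locally_eq N' _ _ fun x hx => ?_
  obtain ⟨i, V, hxV, hV⟩ := h x
  refine ⟨U ⊓ V, ⟨hx, hxV⟩, inf_le_left, ?_⟩
  obtain ⟨f, hf⟩ := (hV (U ⊓ V) inf_le_right).2 (M.presheaf.map (homOfLE inf_le_left).op m)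
  rw [← app_map, ← app_map, ← hf]
  simp only [Scheme.Modules.Hom.app_smul, app_map, key]

theorem ord_nonneg {C : Scheme.{0}} [IsIntegral C] [IsLocallyNoetherian C] {U : C.Opens}
    [Nonempty U] {f : Γ(C, U)} (hf : f ≠ 0) {x : C} (hx : x ∈ U) :
    0 ≤ Scheme.ord (C.germToFunctionField U f) x := by
  have h := Scheme.ord_le_smul hx hf (1 : C.functionField)
  have h1 : Scheme.ord (1 : C.functionField) x = 0 := by
    have := Scheme.ord_of_isUnit (f := (1 : Γ(C, U))) isUnit_one hx
    rwa [map_one] at this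
  rwa [h1, Algebra.smul_def, mul_one] at h

/-- `Z` has finitely many irreducible components. A point of `Z` of codimension one is the generic
point of a component: otherwise it, that generic point and the generic point of `C` would form a
chain of length two. -/
theorem finite_coheight_eq_one {C : Scheme.{0}} [IsIntegral C] [NoetherianSpace C] {Z : Set C}
    (hZ : IsClosed Z)
    (hη : genericPoint C ∉ Z) : {x ∈ Z | Order.coheight x = 1}.Finite := by
  obtain ⟨S, hS, hc, hi, rfl⟩ := NoetherianSpace.exists_finite_set_isClosed_irreducible hZ
  refine Set.Finite.subset (hS.biUnion (t := fun T => {x | x ∈ T ∧ ∃ h : T ∈ S,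
    x = (hi T h).genericPoint}) fun T hT => Set.Finite.subset (Set.finite_singleton
      (hi T hT).genericPoint) fun x hx => hx.2.2) ?_
  rintro x ⟨⟨T, hT, hxT⟩, hx⟩
  refine Set.mem_biUnion hT ⟨hxT, hT, ?_⟩
  have hg := (hi T hT).isGenericPoint_genericPoint (hc T hT)
  by_contra hne
  have h1 : x < (hi T hT).genericPoint := by
    have h0 : (hi T hT).genericPoint ⤳ x := hg.specializes hxT
    exact lt_of_le_not_ge h0 fun h => hne (Specializes.antisymm h h0).eq
  have h2 : (hi T hT).genericPoint < (⊤ : C) := by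
    refine lt_of_le_not_ge le_top fun e => hη ⟨T, hT, ?_⟩
    have e' : (hi T hT).genericPoint ⤳ genericPoint C := e
    exact e'.mem_closed (hc T hT) hg.mem
  have h3 := Order.coheight_add_one_le h1
  have h4 := Order.coheight_pos_of_lt_top h2
  rw [hx] at h3
  have h5 := Order.one_le_iff_pos.2 h4
  have := (add_le_add_left h5 1).trans h3
  norm_num at this

/-- The function is a unit off its zero locus, and orders at points of codimension other than one
are zero, so `finite_coheight_eq_one` applies to the zero locus. -/
theorem finite_ord_ne_zero {C : Scheme.{0}} [IsIntegral C] [IsLocallyNoetherian C]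
    [NoetherianSpace C] {U : C.Opens} [Nonempty U] {f : Γ(C, U)}
    (hf : f ≠ 0) : {x ∈ U | Scheme.ord (C.germToFunctionField U f) x ≠ 0}.Finite := by
  have hb : C.basicOpen f ≠ ⊥ := fun h => hf ((basicOpen_eq_bot_iff f).1 h)
  have hne : Nonempty (C.basicOpen f) := by
    rw [Ne, ← Opens.not_nonempty_iff_eq_bot, not_not] at hb
    exact hb.to_subtype
  refine (finite_coheight_eq_one (Z := (C.basicOpen f : Set C)ᶜ)
    (C.basicOpen f).isOpen.isClosed_compl ?_).subset ?_
  · rw [Set.mem_compl_iff, not_not]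
    exact ((genericPoint_spec C).mem_open_set_iff (C.basicOpen f).isOpen).mpr (by simpa using hne)
  · rintro x ⟨hx, h⟩
    refine ⟨fun hxb => h ?_, ?_⟩
    · have := Scheme.ord_of_isUnit (U := C.basicOpen f) (RingedSpace.isUnit_res_basicOpen _ f) hxb
      rw [← this]
      congr 1
      exact (TopCat.Presheaf.germ_res_apply _ _ _ _ _).symm
    · by_contra h1
      exact h (Scheme.ord_eq_zero_of_coheight_neq_one h1 _)

/-- If all global sections were zero, the epimorphism from the free module would be zero, hence so
would the identity of `M`, which a frame over a nonempty open set forbids. -/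
theorem exists_section_ne_zero {X : Scheme.{0}} [IsIntegral X] {M : X.Modules}
    (h : IsLineBundle M) (hG : IsGloballyGenerated M) : ∃ s : Γ(M, ⊤), s ≠ 0 := by
  obtain ⟨G⟩ := hG
  by_contra! h0
  let M' : SheafOfModules X.ringCatSheaf := M
  let G' : M'.GeneratingSections := G
  have hs (i) : G'.s i = PresheafOfModules.sectionsMap 0 (G'.s i) := by
    refine PresheafOfModules.sections_ext _ _ fun U => ?_
    have h1 := PresheafOfModules.sections_property (G'.s i) (homOfLE le_top : U.unop ⟶ ⊤).op
    have h2 : (G'.s i).1 (op ⊤) = 0 := h0 _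
    rw [h2] at h1
    have h3 : M.presheaf.map (homOfLE le_top : U.unop ⟶ ⊤).op 0 = 0 := map_zero _
    exact h1.symm.trans h3
  have hid : 𝟙 M' = 0 := by
    have := G'.epi
    rw [← cancel_epi (M'.freeHomEquiv.symm G'.s)]
    apply M'.freeHomEquiv.injective
    funext i
    change SheafOfModules.sectionsMap (𝟙 M')
      (SheafOfModules.freeHomEquiv M' ((SheafOfModules.freeHomEquiv M').symm G'.s) i) =
      SheafOfModules.sectionsMap (M := M') (N := M') 0
      (SheafOfModules.freeHomEquiv M' ((SheafOfModules.freeHomEquiv M').symm G'.s) i)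
    rw [Equiv.apply_symm_apply]
    exact hs i
  obtain ⟨x⟩ := (inferInstance : Nonempty X)
  obtain ⟨V, hxV, g, hg⟩ := h x
  have : Nonempty V := ⟨⟨x, hxV⟩⟩
  have hz (t : Γ(M, V)) : t = 0 :=
    congrArg (fun φ : M ⟶ M => φ.app V t) hid
  exact zero_ne_one ((hg V le_rfl).1 ((hz _).trans (hz _).symm))

/-- The degree on the curve may be computed from a nonzero global section of the pullback. Such a
section is regular, so all its orders are nonnegative. -/
theorem IsLineBundle.isNef {X : Scheme.{0}} (π : X ⟶ Spec (.of ℂ)) {M : X.Modules}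
    (hM : IsLineBundle M) (hG : IsGloballyGenerated M) : IsNef π M := by
  intro C _ _ i _ _ _
  have : CompactSpace C := by
    have := QuasiCompact.isCompact_preimage (f := i ≫ π) ⊤ isOpen_univ isCompact_univ
    exact ⟨this⟩
  have : IsNoetherian C := {}
  set N := (Scheme.Modules.pullback i).obj M
  have hN : IsLineBundle N := hM.pullback i
  obtain ⟨s, hs⟩ := exists_section_ne_zero hN (hG.pullback i)
  choose V hxV g hg using hN
  have hne (x : C) : Nonempty ((⊤ : C.Opens) ⊓ V x : C.Opens) := ⟨⟨x, trivial, hxV x⟩⟩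
  choose h hh using fun x => (hg x (⊤ ⊓ V x) inf_le_right).2
    (N.presheaf.map (homOfLE inf_le_left).op s)
  dsimp only at hh
  -- Any two charts overlap because `C` is irreducible. If the section vanished in one chart, its
  -- expression in any other chart would vanish on the overlap, hence be zero since `C` is integral,
  -- and the section itself would be zero.
  have h_ne (x : C) : h x ≠ 0 := by
    intro h0
    refine hs (eq_of_locally_eq N _ _ fun y _ => ⟨⊤ ⊓ V y, ⟨trivial, hxV y⟩, inf_le_left, ?_⟩)
    have hxy : Nonempty ((⊤ ⊓ V x) ⊓ (⊤ ⊓ V y) : C.Opens) := by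
      have := nonempty_preirreducible_inter (⊤ ⊓ V x).isOpen (⊤ ⊓ V y).isOpen
        ⟨x, trivial, hxV x⟩ ⟨y, trivial, hxV y⟩
      exact this.to_subtype
    rw [map_zero, ← hh y]
    suffices h y = 0 by rw [this, zero_smul]
    apply map_injective_of_isIntegral C
      (homOfLE inf_le_right : (⊤ ⊓ V x) ⊓ (⊤ ⊓ V y) ⟶ (⊤ ⊓ V y))
    apply (hg y _ (inf_le_right.trans inf_le_right)).1
    dsimp only
    rw [map_zero, zero_smul]
    have e1 := congrArg (N.presheaf.map (homOfLE (inf_le_right :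
      (⊤ ⊓ V x) ⊓ (⊤ ⊓ V y) ≤ (⊤ ⊓ V y))).op) (hh y)
    have e2 := congrArg (N.presheaf.map (homOfLE (inf_le_left :
      (⊤ ⊓ V x) ⊓ (⊤ ⊓ V y) ≤ (⊤ ⊓ V x))).op) (hh x)
    rw [h0, zero_smul, map_zero, ← ConcreteCategory.comp_apply, ← Functor.map_comp] at e2
    rw [Scheme.Modules.map_smul, ← ConcreteCategory.comp_apply, ← Functor.map_comp,
      ← ConcreteCategory.comp_apply, ← Functor.map_comp] at e1
    exact e1.trans e2.symm
  -- The orders are read off in finitely many charts only, so that their support is a finite union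
  -- of finite sets.
  obtain ⟨t, ht⟩ := CompactSpace.elim_nhds_subcover (fun x => (V x : Set C))
    fun x => (V x).isOpen.mem_nhds (hxV x)
  have hj (x : C) : ∃ y ∈ t, x ∈ V y := by
    have : x ∈ ⋃ y ∈ t, (V y : Set C) := by rw [ht]; trivial
    simpa using this
  choose j hjt hjV using hj
  refine ⟨∑ᶠ x, Scheme.ord (C.germToFunctionField (⊤ ⊓ V (j x)) (h (j x))) x,
    ⟨⊤, s, _, fun x => ⟨V (j x), hjV x, g (j x), hg (j x), hne (j x), h (j x), (hh _).symm, ?_, rfl⟩,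
    ?_, rfl⟩, finsum_nonneg fun x => ord_nonneg (h_ne _) ⟨trivial, hjV x⟩⟩
  · rw [Ne, map_eq_zero_iff _ (Scheme.germToFunctionField_injective _ _)]
    exact h_ne _
  · refine (t.finite_toSet.biUnion fun y _ => finite_ord_ne_zero (h_ne y)).subset fun x hx => ?_
    exact Set.mem_biUnion (hjt x) ⟨⟨trivial, hjV x⟩, hx⟩

end SheafNotions

/-! ### Frames and global sections on a torus quotient -/

namespace TorusGIT

noncomputable section

variable {S Λ : Type} [CommRing S] [Algebra ℂ S] [AddCommGroup Λ]
  (𝒮 : Λ → Submodule ℂ S) [SetLike.GradedMonoid 𝒮] (w : Λ)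

/-- The semi-invariant `f tⁿ` given by `f ∈ S_{n w}`. -/
def semiMonomial {n : ℕ} {f : S} (hf : f ∈ 𝒮 (n • w)) : semiInvariants 𝒮 w :=
  ⟨Polynomial.monomial n f, fun m => by
    rw [Polynomial.coeff_monomial]
    split_ifs with h
    · subst h; exact hf
    · exact zero_mem _⟩

theorem semiMonomial_mem {n : ℕ} {f : S} (hf : f ∈ 𝒮 (n • w)) :
    semiMonomial 𝒮 w hf ∈ semiPart 𝒮 w n := fun m hm => by
  simp [semiMonomial, Polynomial.coeff_monomial, hm.symm]

theorem coeff_semiMonomial {n : ℕ} {f : S} (hf : f ∈ 𝒮 (n • w)) :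
    (semiMonomial 𝒮 w hf).1.coeff n = f := by
  simp [semiMonomial]

theorem coeff_decompose (P : semiInvariants 𝒮 w) (n m : ℕ) :
    (DirectSum.decompose (semiPart 𝒮 w) P n : semiInvariants 𝒮 w).1.coeff m =
      if n = m then P.1.coeff n else 0 := by
  change (decomp 𝒮 w P n : semiInvariants 𝒮 w).1.coeff m = _
  rw [decomp_apply]
  exact Polynomial.coeff_monomial

/-- Every point of the quotient has a semi-invariant of positive degree not vanishing at it. -/
theorem exists_notMem (x : ProjectiveSpectrum (semiPart 𝒮 w)) :
    ∃ n, 0 < n ∧ ∃ q ∈ semiPart 𝒮 w n, q ∉ x.asHomogeneousIdeal := by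
  by_contra! h
  refine x.not_irrelevant_le fun q hq => ?_
  have hq : (DirectSum.decompose (semiPart 𝒮 w) q 0 : semiInvariants 𝒮 w) = 0 := hq
  classical
  rw [← DirectSum.sum_support_decompose (semiPart 𝒮 w) q]
  refine Ideal.sum_mem _ fun n _ => ?_
  rcases Nat.eq_zero_or_pos n with rfl | hn
  · rw [hq]; exact zero_mem _
  · exact h n hn _ (SetLike.coe_mem _)

variable [IsDomain S]

theorem localToFrac_injective (x : ProjectiveSpectrum (semiPart 𝒮 w)) :
    Function.Injective (localToFrac 𝒮 w x) := by
  rw [injective_iff_map_eq_zero]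
  intro a ha
  obtain ⟨c, rfl⟩ := HomogeneousLocalization.mk_surjective a
  rw [localToFrac_mk, div_eq_zero_iff] at ha
  have h0 : toFrac 𝒮 w c.num = 0 := ha.resolve_right (toFrac_ne_zero 𝒮 w (x := x) c.den_mem)
  have h1 : (c.num : semiInvariants 𝒮 w) = 0 :=
    (map_eq_zero_iff _ (toFrac_injective 𝒮 w)).1 h0
  rw [HomogeneousLocalization.ext_iff_val, HomogeneousLocalization.val_mk,
    HomogeneousLocalization.val_zero, h1, Localization.mk_zero]

variable {χ : Λ}

/-- The section given by `p` is a frame wherever a semi-invariant divisible by `p` does not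
vanish. -/
theorem isFrame_globalSection {p h : S} (hp : p ∈ 𝒮 χ) {m : ℕ} (hh : h ∈ 𝒮 (m • w - χ))
    (hph : p * h ∈ 𝒮 (m • w)) (hp0 : p ≠ 0) {V : (quotient 𝒮 w).Opens}
    (hV : ∀ x : ProjectiveSpectrum (semiPart 𝒮 w), x ∈ V →
      semiMonomial 𝒮 w hph ∉ x.asHomogeneousIdeal) :
    SheafNotions.IsFrame (sheaf 𝒮 w χ)
      ((sheaf 𝒮 w χ).presheaf.map (homOfLE le_top : V ⟶ ⊤).op (globalSection 𝒮 w χ hp)) := by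
  intro W hW
  set ι := algebraMap (Polynomial S) (FracField S)
  have hι : Function.Injective ι := IsFractionRing.injective _ _
  have hp1 : ι (Polynomial.C p) ≠ 0 := by
    rw [Ne, map_eq_zero_iff _ hι, Polynomial.C_eq_zero]
    exact hp0
  constructor
  · intro f f' hff'
    apply Subtype.ext
    funext x
    apply localToFrac_injective 𝒮 w x.1
    have := congrArg (fun s : sections 𝒮 w χ W => s.1 x) hff'
    exact mul_right_cancel₀ hp1 this
  · intro s
    let s' : sections 𝒮 w χ W := s
    -- Division by `p`: a fraction `P / Q` of degree `χ` is `p` times `(P * h) / (Q * (p * h))`,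
    -- which has degree zero and a denominator without zeros on `W`.
    have hmem {n : ℕ} {P : S} (hP : P ∈ 𝒮 (χ + n • w)) : P * h ∈ 𝒮 ((n + m) • w) := by
      have := SetLike.mul_mem_graded hP hh
      rwa [show χ + n • w + (m • w - χ) = (n + m) • w by rw [add_smul]; abel] at this
    have hval (n : ℕ) (P : S) (Q : semiInvariants 𝒮 w) (hP : P ∈ 𝒮 (χ + n • w))
        (hQ : Q ∈ semiPart 𝒮 w n) (y : ProjectiveSpectrum (semiPart 𝒮 w))
        (hQy : Q ∉ y.asHomogeneousIdeal) (hden : Q * semiMonomial 𝒮 w hph ∈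
          y.asHomogeneousIdeal.toIdeal.primeCompl) :
        localToFrac 𝒮 w y (HomogeneousLocalization.mk ⟨n + m,
          ⟨_, semiMonomial_mem 𝒮 w (hmem hP)⟩,
          ⟨_, SetLike.mul_mem_graded hQ (semiMonomial_mem 𝒮 w hph)⟩, hden⟩) *
          ι (Polynomial.C p) = ι (Polynomial.monomial n P) / toFrac 𝒮 w Q := by
      have h1 := toFrac_ne_zero 𝒮 w hQy
      have h2 := toFrac_ne_zero 𝒮 w (x := y) hden
      rw [localToFrac_mk]
      dsimp only at h2 ⊢
      rw [div_mul_eq_mul_div, div_eq_div_iff h2 h1, map_mul (toFrac 𝒮 w)]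
      have e1 : toFrac 𝒮 w (semiMonomial 𝒮 w (hmem hP)) =
        ι (Polynomial.monomial (n + m) (P * h)) := rfl
      have e2 : toFrac 𝒮 w (semiMonomial 𝒮 w hph) = ι (Polynomial.monomial m (p * h)) := rfl
      rw [e1, e2]
      have e3 : ι (Polynomial.monomial (n + m) (P * h)) * ι (Polynomial.C p) =
          ι (Polynomial.monomial n P) * ι (Polynomial.monomial m (p * h)) := by
        rw [← map_mul, ← map_mul, Polynomial.monomial_mul_monomial, Polynomial.monomial_mul_C]
        congr 2
        ring
      rw [e3]
      ring
    have hden {Q : semiInvariants 𝒮 w} {y : ProjectiveSpectrum (semiPart 𝒮 w)} (hy : y ∈ W)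
        (hQy : Q ∉ y.asHomogeneousIdeal) : Q * semiMonomial 𝒮 w hph ∈
          y.asHomogeneousIdeal.toIdeal.primeCompl := fun hm =>
      (y.isPrime.mem_or_mem hm).elim hQy (hV y (hW hy))
    have hex (x : W) : ∃ a, localToFrac 𝒮 w x.1 a * ι (Polynomial.C p) = s'.1 x := by
      obtain ⟨V', hxV', i, n, P, Q, hP, hQ, hPQ⟩ := s'.2 x
      obtain ⟨h1, h2⟩ := hPQ ⟨x.1, hxV'⟩
      exact ⟨_, (hval n P Q hP hQ x.1 h1 (hden x.2 h1)).trans h2.symm⟩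
    choose f hf using hex
    refine ⟨(⟨f, fun x => ?_⟩ : (ProjectiveSpectrum.Proj.structureSheaf (semiPart 𝒮 w)).1.obj (op W)),
      Subtype.ext (funext hf)⟩
    obtain ⟨V', hxV', i, n, P, Q, hP, hQ, hPQ⟩ := s'.2 x
    refine ⟨V', hxV', i, n + m, ⟨_, semiMonomial_mem 𝒮 w (hmem hP)⟩,
      ⟨_, SetLike.mul_mem_graded hQ (semiMonomial_mem 𝒮 w hph)⟩,
      fun y => hden (i.le y.2) (hPQ y).1, fun y => ?_⟩
    apply localToFrac_injective 𝒮 w y.1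
    apply mul_right_cancel₀ hp1
    refine (hf ⟨y.1, i.le y.2⟩).trans ?_
    refine Eq.trans ?_ (hval n P Q hP hQ y.1 (hPQ y).1 (hden (i.le y.2) (hPQ y).1)).symm
    exact (hPQ y).2

omit [IsDomain S] in
theorem semiMonomial_mem_irrelevant {n : ℕ} (hn : 0 < n) {f : S} (hf : f ∈ 𝒮 (n • w)) :
    semiMonomial 𝒮 w hf ∈ HomogeneousIdeal.irrelevant (semiPart 𝒮 w) := by
  change (DirectSum.decompose (semiPart 𝒮 w) _ 0 : semiInvariants 𝒮 w) = 0
  exact DirectSum.decompose_of_mem_ne _ (semiMonomial_mem 𝒮 w hf) hn.ne'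

/-- The generic point of the quotient. -/
def zeroPoint {n : ℕ} (hn : 0 < n) {f : S} (hf : f ∈ 𝒮 (n • w)) (hf0 : f ≠ 0) :
    ProjectiveSpectrum (semiPart 𝒮 w) where
  asHomogeneousIdeal := ⊥
  isPrime := Ideal.isPrime_bot
  not_irrelevant_le h := hf0 (by
    have h1 : semiMonomial 𝒮 w hf = 0 := h (semiMonomial_mem_irrelevant 𝒮 w hn hf)
    have h2 := coeff_semiMonomial 𝒮 w hf
    rw [h1] at h2
    exact h2.symm)

/-- A global section is a constant function with values in the fraction field, and it becomes an
element of `S` after multiplication by a power of any given semi-invariant of positive degree. -/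
theorem exists_eq_const {n₀ : ℕ} (hn₀ : 0 < n₀) {f₀ : S} (hf₀ : f₀ ∈ 𝒮 (n₀ • w)) (hf₀' : f₀ ≠ 0)
    (s : sections 𝒮 w χ ⊤) : ∃ c : FracField S, (∀ x, s.1 x = c) ∧
      ∀ m, 0 < m → ∀ f ∈ 𝒮 (m • w), ∃ k, ∃ u ∈ 𝒮 (χ + (k * m) • w),
        algebraMap (Polynomial S) (FracField S) (Polynomial.C (f ^ k)) * c =
          algebraMap (Polynomial S) (FracField S) (Polynomial.C u) := by
  set ι := algebraMap (Polynomial S) (FracField S)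
  have hι : Function.Injective ι := IsFractionRing.injective _ _
  let ξ := zeroPoint 𝒮 w hn₀ hf₀ hf₀'
  -- The zero ideal lies in every nonempty open set. So each local fraction representing `s` also
  -- computes the value of `s` at `ξ`, which makes `s` constant.
  have hξ (V : Opens (ProjectiveSpectrum.top (semiPart 𝒮 w)))
      (x : ProjectiveSpectrum (semiPart 𝒮 w)) (hx : x ∈ V) : ξ ∈ V := by
    by_contra h
    obtain ⟨T, hT⟩ := (ProjectiveSpectrum.isOpen_iff _ _).1 V.isOpen
    have h1 : ξ ∈ V.carrierᶜ := h
    have h2 : x ∉ V.carrierᶜ := fun h => h hx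
    erw [hT] at h1 h2
    refine h2 fun t ht => ?_
    have : t = 0 := h1 ht
    rw [this]
    exact zero_mem x.asHomogeneousIdeal.toIdeal
  let c := s.1 ⟨ξ, trivial⟩
  have hc (x) : s.1 x = c := by
    obtain ⟨V, hxV, i, n, P, Q, hP, hQ, hPQ⟩ := s.2 x
    exact (hPQ ⟨x.1, hxV⟩).2.trans (hPQ ⟨ξ, hξ V x.1 hxV⟩).2.symm
  refine ⟨c, hc, fun m hm f hf => ?_⟩
  -- The ideal of denominators of `c`: all graded pieces of its elements multiply `c` into `S`, in
  -- the expected degree.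
  let J : Ideal (semiInvariants 𝒮 w) :=
    { carrier := {g | ∀ k, ∃ u ∈ 𝒮 (χ + k • w),
        ι (Polynomial.C (g.1.coeff k)) * c = ι (Polynomial.C u)}
      zero_mem' := fun k => ⟨0, zero_mem _, by simp⟩
      add_mem' := fun {g g'} hg hg' k => by
        obtain ⟨u, hu, e⟩ := hg k
        obtain ⟨u', hu', e'⟩ := hg' k
        refine ⟨u + u', add_mem hu hu', ?_⟩
        rw [map_add Polynomial.C, map_add ι, ← e, ← e', ← add_mul, ← map_add, ← map_add]
        rfl
      smul_mem' := fun a g hg k => by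
        choose u hu e using hg
        refine ⟨∑ ij ∈ Finset.HasAntidiagonal.antidiagonal k, u ij.2 * a.1.coeff ij.1,
          Submodule.sum_mem _ fun ij hij => ?_, ?_⟩
        · have := mul_coeff_mem 𝒮 w χ (m := ij.1) (hu ij.2) a
          rwa [add_comm ij.2, Finset.HasAntidiagonal.mem_antidiagonal.1 hij] at this
        · rw [smul_eq_mul, MulMemClass.coe_mul, Polynomial.coeff_mul, map_sum, map_sum, map_sum,
            map_sum, Finset.sum_mul]
          refine Finset.sum_congr rfl fun ij _ => ?_
          rw [map_mul, map_mul, map_mul, map_mul, ← e]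
          ring }
  have hJ : J.IsHomogeneous (semiPart 𝒮 w) := by
    intro i g hg k
    rw [coeff_decompose]
    split_ifs with h
    · subst h; exact hg i
    · exact ⟨0, zero_mem _, by simp⟩
  -- The radical of a homogeneous ideal is the intersection of the homogeneous primes above it. A
  -- homogeneous prime not containing `f tᵐ` is a point of the quotient, and there a local
  -- denominator of `s` belongs to `J` but not to the prime.
  have hrad : semiMonomial 𝒮 w hf ∈ J.radical := by
    rw [hJ.radical_eq, Ideal.mem_sInf]
    intro 𝔭 h𝔭
    obtain ⟨h1, h2, h3⟩ := h𝔭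
    by_contra hn
    let x : ProjectiveSpectrum (semiPart 𝒮 w) := ⟨⟨𝔭, h1⟩, h3, fun h => hn (h (semiMonomial_mem_irrelevant 𝒮 w hm hf))⟩
    obtain ⟨V, hxV, i, n, P, Q, hP, hQ, hPQ⟩ := s.2 ⟨x, trivial⟩
    obtain ⟨h4, h5⟩ := hPQ ⟨x, hxV⟩
    refine h4 (h2 fun k => ?_)
    by_cases hk : k = n
    · subst hk
      refine ⟨P, hP, ?_⟩
      have e : c = _ := (hc ⟨x, trivial⟩).symm.trans h5
      rw [e, toFrac_eq 𝒮 w hQ]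
      have h6 := toFrac_ne_zero 𝒮 w h4
      rw [toFrac_eq 𝒮 w hQ] at h6
      rw [← mul_div_assoc, div_eq_iff h6, ← map_mul, ← map_mul, Polynomial.C_mul_monomial,
        Polynomial.C_mul_monomial, mul_comm]
    · exact ⟨0, zero_mem _, by rw [hQ k hk]; simp⟩
  obtain ⟨k, hk⟩ := hrad
  obtain ⟨u, hu, e⟩ := hk (k * m)
  refine ⟨k, u, hu, ?_⟩
  rw [← e]
  congr 3
  change f ^ k = ((Polynomial.monomial m f) ^ k).coeff (k * m)
  rw [Polynomial.monomial_pow, mul_comm, Polynomial.coeff_monomial_same]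

end

end TorusGIT

/-! ### Flows on a quiver as exponents of monomials -/

namespace ToricQuiver

noncomputable section

variable {V : Type} [Quiver.{0} V]

open Classical in
/-- The divergence of a flow: what flows into a vertex minus what flows out of it. -/
def divergence : (Quiver.Total V →₀ ℕ) →+ (V → ℤ) :=
  Finsupp.weight fun a => Pi.single a.right 1 - Pi.single a.left 1

/-- The flow along a path. -/
def pathFlow {u : V} : ∀ {v : V}, Quiver.Path u v → Quiver.Total V →₀ ℕ
  | _, .nil => 0
  | _, .cons p a => pathFlow p + Finsupp.single ⟨_, _, a⟩ 1

theorem pathMonomial_eq {u v : V} (p : Quiver.Path u v) :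
    pathMonomial p = MvPolynomial.monomial (pathFlow p) 1 := by
  induction p with
  | nil => rfl
  | cons p a ih => rw [pathMonomial, ih, pathFlow, MvPolynomial.X, MvPolynomial.monomial_mul, one_mul]

open Classical in
theorem divergence_single (a : Quiver.Total V) (k : ℕ) :
    divergence (Finsupp.single a k) = k • (Pi.single a.right 1 - Pi.single a.left 1) := by
  rw [divergence, Finsupp.weight_apply, Finsupp.sum_single_index (by simp)]

open Classical in
theorem divergence_apply (b : Quiver.Total V →₀ ℕ) (v : V) :
    divergence b v = ∑ a ∈ b.support,
      (b a : ℤ) * ((if a.right = v then 1 else 0) - (if a.left = v then 1 else 0)) := by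
  rw [divergence, Finsupp.weight_apply, Finsupp.sum, Finset.sum_apply]
  refine Finset.sum_congr rfl fun a _ => ?_
  simp [Pi.single_apply, eq_comm]

open Classical in
theorem divergence_pathFlow {u v : V} (p : Quiver.Path u v) :
    divergence (pathFlow p) = Pi.single v 1 - Pi.single u 1 := by
  induction p with
  | nil => rw [pathFlow, map_zero, sub_self]
  | cons p a ih => rw [pathFlow, map_add, ih, divergence_single, one_smul, sub_add_sub_cancel']

theorem sum_divergence [Fintype V] (b : Quiver.Total V →₀ ℕ) : ∑ v, divergence b v = 0 := by
  classical
  induction b using Finsupp.induction_linear with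
  | zero => simp
  | add f g hf hg => simp [Finset.sum_add_distrib, hf, hg]
  | single a k =>
    rw [divergence_single]
    simp [← Finset.mul_sum]

/-- The flow of one unit along every arrow. -/
def unitFlow (V : Type) [Quiver.{0} V] [Finite (Quiver.Total V)] : Quiver.Total V →₀ ℕ :=
  Finsupp.equivFunOnFinite.symm 1

theorem unitFlow_apply [Finite (Quiver.Total V)] (a : Quiver.Total V) : unitFlow V a = 1 := rfl

variable (x₀ : V)

theorem weight_eq_divergence (b : Quiver.Total V →₀ ℕ) :
    Finsupp.weight (weight x₀) b = fun u => divergence b u.1 := by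
  classical
  induction b using Finsupp.induction_linear with
  | zero => rw [map_zero, map_zero]; rfl
  | add f g hf hg => rw [map_add, map_add, hf, hg]; rfl
  | single a k =>
    rw [divergence_single, Finsupp.weight_apply, Finsupp.sum_single_index (by simp)]
    funext u
    simp [weight, e, Pi.single_apply]

theorem stability_eq_divergence [Finite (Quiver.Total V)] :
    stability x₀ = fun u => divergence (unitFlow V) u.1 := by
  rw [← weight_eq_divergence, Finsupp.weight_apply]
  have := Fintype.ofFinite (Quiver.Total V)
  rw [stability, finsum_eq_sum_of_fintype, Finsupp.sum_fintype _ _ (by simp)]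
  simp [unitFlow_apply]

omit [Quiver V] in
open Classical in
theorem e_sub_e_eq (u v : V) :
    e x₀ v - e x₀ u = fun z => (Pi.single v 1 - Pi.single u 1 : V → ℤ) z.1 := by
  funext z
  simp [e, Pi.single_apply]

variable {x₀}

-- Characters forget the coordinate at `x₀`. Since divergences have total sum zero, nothing is lost,
-- and degrees of monomials can be compared as divergences on all vertices.
omit [Quiver V] in
theorem eq_of_sum_eq_zero [Fintype V] {f g : V → ℤ} (hf : ∑ v, f v = 0) (hg : ∑ v, g v = 0)
    (h : (fun u : {v // v ≠ x₀} => f u.1) = fun u => g u.1) : f = g := by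
  classical
  have h' (v : V) (hv : v ≠ x₀) : f v = g v := congrFun h ⟨v, hv⟩
  funext v
  by_cases hv : v = x₀
  · subst hv
    rw [← Finset.add_sum_erase _ _ (Finset.mem_univ v)] at hf hg
    rw [Finset.sum_congr rfl fun z hz => h' z (Finset.ne_of_mem_erase hz)] at hf
    linarith
  · exact h' v hv

theorem weight_eq_smul_stability_iff [Finite V] [Finite (Quiver.Total V)]
    {b : Quiver.Total V →₀ ℕ} {m : ℕ} :
    Finsupp.weight (weight x₀) b = m • stability x₀ ↔
      divergence b = m • divergence (unitFlow V) := by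
  have := Fintype.ofFinite V
  rw [weight_eq_divergence, stability_eq_divergence]
  constructor
  · intro h
    refine eq_of_sum_eq_zero (sum_divergence b) ?_ h
    simp [← Finset.mul_sum, sum_divergence]
  · intro h
    rw [h]
    rfl

open Classical in
theorem weight_eq_e_sub_e_iff [Finite V] {b : Quiver.Total V →₀ ℕ} {u v : V} :
    Finsupp.weight (weight x₀) b = e x₀ v - e x₀ u ↔
      divergence b = Pi.single v 1 - Pi.single u 1 := by
  have := Fintype.ofFinite V
  rw [weight_eq_divergence, e_sub_e_eq]
  constructor
  · intro h
    refine eq_of_sum_eq_zero (sum_divergence b) ?_ h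
    simp
  · intro h
    rw [h]

section Acyclic

variable {ht : V → ℤ} (hht : ∀ {u v : V}, (u ⟶ v) → ht u < ht v)

include hht

theorem ht_le_of_pathFlow {u v : V} (p : Quiver.Path u v) {a : Quiver.Total V}
    (h : pathFlow p a ≠ 0) : ht a.right ≤ ht v := by
  classical
  induction p with
  | nil => exact absurd rfl h
  | cons p c ih =>
    rw [pathFlow, Finsupp.add_apply, Finsupp.single_apply] at h
    split_ifs at h with hc
    · subst hc; exact le_rfl
    · exact (ih h).trans (hht c).le

/-- The height strictly increases along a path, so no arrow is used twice. This turns containment of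
supports into divisibility of monomials. -/
theorem pathFlow_le_one {u v : V} (p : Quiver.Path u v) (a : Quiver.Total V) :
    pathFlow p a ≤ 1 := by
  classical
  induction p with
  | nil => exact Nat.zero_le _
  | cons p c ih =>
    rw [pathFlow, Finsupp.add_apply, Finsupp.single_apply]
    split_ifs with hc
    · subst hc
      have : pathFlow p ⟨_, _, c⟩ = 0 := by
        by_contra h
        exact (ht_le_of_pathFlow hht p h).not_gt (hht c)
      omega
    · exact ih

/-- The last arrow can be recovered from the flow: if the last arrows differed, that of `p` would
occur earlier in `q`, although its head is the common end `v`, which is higher than all earlier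
vertices of `q`. -/
theorem pathFlow_injective {u v : V} :
    Function.Injective (pathFlow : Quiver.Path u v → Quiver.Total V →₀ ℕ) := by
  classical
  intro p q h
  induction p with
  | nil =>
    cases q with
    | nil => rfl
    | cons q c =>
      have := congrArg (fun f => f ⟨_, _, c⟩) h
      simp [pathFlow] at this
  | cons p c ih =>
    cases q with
    | nil =>
      have := congrArg (fun f => f ⟨_, _, c⟩) h
      simp [pathFlow] at this
    | @cons t _ q c' =>
      have hcc : (⟨_, _, c⟩ : Quiver.Total V) = ⟨_, _, c'⟩ := by
        by_contra hne
        have := congrArg (fun f => f ⟨_, _, c⟩) h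
        simp only [pathFlow, Finsupp.add_apply, Finsupp.single_apply, if_true, if_neg (Ne.symm hne),
          add_zero] at this
        exact (ht_le_of_pathFlow hht q (by rw [← this]; omega)).not_gt (hht c')
      cases hcc
      rw [pathFlow, pathFlow, add_left_inj] at h
      rw [ih h]

open Classical in
/-- A flow from `u` to `v` of one unit is the flow along a path. -/
theorem exists_pathFlow_eq {u : V} (N : ℕ) :
    ∀ {v : V} {b : Quiver.Total V →₀ ℕ}, b.degree = N →
      divergence b = Pi.single v 1 - Pi.single u 1 → ∃ p : Quiver.Path u v, pathFlow p = b := by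
  induction N with
  | zero =>
    intro v b hb h
    rw [Finsupp.degree_eq_zero_iff] at hb
    subst hb
    have h1 := congrFun h v
    by_cases huv : v = u
    · subst huv; exact ⟨.nil, rfl⟩
    · simp [huv] at h1
  | succ N ih =>
    intro v b hb h
    have hne : b.support.Nonempty := by
      rw [Finsupp.support_nonempty_iff]
      rintro rfl
      simp at hb
    -- No arrow used by `b` leaves a head of maximal height, so the divergence there is positive.
    -- Only `v` allows this, and `a` can be split off as the last arrow of the path.
    obtain ⟨a, ha, hmax⟩ := b.support.exists_max_image (fun a => ht a.right) hne
    have hpos : 0 < divergence b a.right := by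
      rw [divergence_apply]
      refine Finset.sum_pos' (fun c hc => ?_) ⟨a, ha, ?_⟩
      · have : c.left ≠ a.right := fun h' => by
          have h1 := hmax c hc
          have h2 := hht c.hom
          rw [h'] at h2
          exact h1.not_gt h2
        rw [if_neg this]
        split_ifs <;> simp
      · have : a.left ≠ a.right := fun h' => by
          have h2 := hht a.hom
          rw [h'] at h2
          exact lt_irrefl _ h2
        rw [if_neg this, if_pos rfl]
        have := Nat.pos_of_ne_zero (Finsupp.mem_support_iff.1 ha)
        simpa using this
    have hav : a.right = v := by
      by_contra hne
      rw [h] at hpos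
      simp only [Pi.sub_apply, Pi.single_apply, if_neg hne] at hpos
      split_ifs at hpos <;> omega
    obtain ⟨l, v', c⟩ := a
    dsimp only at hav
    subst hav
    have hle : Finsupp.single (⟨l, v', c⟩ : Quiver.Total V) 1 ≤ b := by
      rw [Finsupp.single_le_iff]
      exact Nat.one_le_iff_ne_zero.2 (Finsupp.mem_support_iff.1 ha)
    obtain ⟨b', rfl⟩ := exists_add_of_le hle
    obtain ⟨p, hp⟩ := ih (v := l) (b := b') (by
      rw [map_add, Finsupp.degree_single] at hb; omega) (by
      rw [map_add, divergence_single, one_smul] at h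
      rw [← sub_eq_zero] at h ⊢
      rw [← h]
      abel)
    exact ⟨p.cons c, by rw [pathFlow, hp, add_comm]⟩

end Acyclic

end

end ToricQuiver

/-! ### Bases of global sections -/

namespace TorusGIT

noncomputable section

variable {S Λ : Type} [CommRing S] [Algebra ℂ S] [AddCommGroup Λ]
  (𝒮 : Λ → Submodule ℂ S) [SetLike.GradedMonoid 𝒮] (w : Λ) [IsDomain S] (χ : Λ)

variable (S) in
/-- The inclusion of `S` into the fraction field of `S[t]`. -/
def constFrac : S →ₗ[ℂ] FracField S :=
  (IsScalarTower.toAlgHom ℂ (Polynomial S) (FracField S)).toLinearMap ∘ₗ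
    Polynomial.CAlgHom.toLinearMap

/-- The global sections given by the elements of the degree of a character. -/
def sectionMap : 𝒮 χ →ₗ[ℂ] sections 𝒮 w χ ⊤ where
  toFun p := globalSection 𝒮 w χ p.2
  map_add' p q := Subtype.ext (funext fun _ => map_add (constFrac S) p.1 q.1)
  map_smul' c p := Subtype.ext (funext fun _ => map_smul (constFrac S) c p.1)

/-- The point `x` guarantees that the quotient is not empty; on the empty space all sections
coincide. -/
theorem sectionMap_injective (x : ProjectiveSpectrum (semiPart 𝒮 w)) :
    Function.Injective (sectionMap 𝒮 w χ) := by
  intro p q h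
  have h' : algebraMap _ (FracField S) (Polynomial.C p.1) =
    algebraMap _ (FracField S) (Polynomial.C q.1) :=
    congrArg (fun s => s.1 ⟨x, trivial⟩) h
  exact Subtype.ext (Polynomial.C_injective (IsFractionRing.injective (Polynomial S) _ h'))

variable {χ}

/-- A basis of the degree of `χ` gives a basis of the global sections if all of them come from
the degree of `χ`. -/
theorem exists_basis_sections (x : ProjectiveSpectrum (semiPart 𝒮 w)) {I : Type} {g : I → S}
    (hg : ∀ i, g i ∈ 𝒮 χ) (hli : LinearIndependent ℂ g)
    (hsp : ∀ q ∈ 𝒮 χ, q ∈ Submodule.span ℂ (Set.range g))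
    (hs : ∀ s : sections 𝒮 w χ ⊤, ∃ (p : S) (hp : p ∈ 𝒮 χ), globalSection 𝒮 w χ hp = s) :
    ∃ b : Module.Basis I ℂ Γ(sheaf 𝒮 w χ, ⊤), ∀ i, b i = globalSection 𝒮 w χ (hg i) := by
  have hbij : Function.Bijective (sectionMap 𝒮 w χ) :=
    ⟨sectionMap_injective 𝒮 w χ x, fun s => let ⟨p, hp, h⟩ := hs s; ⟨⟨p, hp⟩, h⟩⟩
  let g' : I → 𝒮 χ := fun i => ⟨g i, hg i⟩
  have hli' : LinearIndependent ℂ g' := LinearIndependent.of_comp (𝒮 χ).subtype hli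
  have hsp' : ⊤ ≤ Submodule.span ℂ (Set.range g') := by
    rintro q -
    have h := hsp q.1 q.2
    have h2 : Set.range g = (𝒮 χ).subtype '' Set.range g' := by
      rw [← Set.range_comp]; rfl
    rw [h2, ← Submodule.map_span] at h
    obtain ⟨q', hq', e⟩ := h
    rwa [← Subtype.ext e]
  let b := (Module.Basis.mk hli' hsp').map (LinearEquiv.ofBijective _ hbij)
  exact ⟨b, fun i => congrArg (sectionMap 𝒮 w χ) (Module.Basis.mk_apply hli' hsp' i)⟩

end

end TorusGIT

/-! ### Stable flows: frames and sections on a toric quiver variety -/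

namespace ToricQuiver

noncomputable section

variable {V : Type} [Quiver.{0} V] [Finite V] [Finite (Quiver.Total V)] (x₀ : V)
  {ht : V → ℤ}

variable (V) in
/-- A flow with a positive multiple of the divergence of the flow of one unit along every arrow. -/
def IsStableFlow (m : ℕ) (b : Quiver.Total V →₀ ℕ) : Prop :=
  0 < m ∧ divergence b = m • divergence (unitFlow V)

theorem monomial_mem_grading {m : ℕ} {b : Quiver.Total V →₀ ℕ} (hb : IsStableFlow V m b) :
    (MvPolynomial.monomial b 1 : Coord V) ∈ grading x₀ (m • stability x₀) :=
  MvPolynomial.isWeightedHomogeneous_monomial _ _ _ (weight_eq_smul_stability_iff.2 hb.2)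

/-- Some monomial of positive degree does not vanish at a given point. -/
theorem exists_isStableFlow_notMem
    (x : ProjectiveSpectrum (TorusGIT.semiPart (grading x₀) (stability x₀))) :
    ∃ (m : ℕ) (b : Quiver.Total V →₀ ℕ) (hb : IsStableFlow V m b),
      TorusGIT.semiMonomial _ _ (monomial_mem_grading x₀ hb) ∉ x.asHomogeneousIdeal := by
  obtain ⟨m, hm, q, hq, hqx⟩ := TorusGIT.exists_notMem _ _ x
  by_contra! h
  have hb (b) (hb : b ∈ (q.1.coeff m).support) : IsStableFlow V m b :=
    ⟨hm, weight_eq_smul_stability_iff.1 (q.2 m (MvPolynomial.mem_support_iff.1 hb))⟩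
  -- A semi-invariant is a linear combination of stable monomials, so it would vanish at `x` if all
  -- of them did.
  have e : q = ∑ b ∈ (q.1.coeff m).support.attach,
      MvPolynomial.coeff b.1 (q.1.coeff m) •
        TorusGIT.semiMonomial _ _ (monomial_mem_grading x₀ (hb b.1 b.2)) := by
    apply Subtype.ext
    refine (TorusGIT.eq_monomial _ _ hq).trans
      ((congrArg (Polynomial.monomial m) (MvPolynomial.as_sum (q.1.coeff m))).trans ?_)
    rw [map_sum, AddSubmonoidClass.coe_finsetSum, ← Finset.sum_attach]
    refine Finset.sum_congr rfl fun b _ => ?_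
    change _ = MvPolynomial.coeff b.1 (q.1.coeff m) • Polynomial.monomial m _
    rw [Polynomial.smul_monomial, MvPolynomial.smul_monomial, smul_eq_mul, mul_one]
  refine hqx ?_
  rw [e]
  refine Ideal.sum_mem x.asHomogeneousIdeal.toIdeal fun b _ => ?_
  rw [Algebra.smul_def]
  exact Ideal.mul_mem_left x.asHomogeneousIdeal.toIdeal _ (h m b.1 (hb b.1 b.2))

variable (hht : ∀ {u v : V}, (u ⟶ v) → ht u < ht v)

include hht in
/-- If every stable flow carries a path from `u` to `v`, then the sections given by the paths are
local frames. -/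
theorem exists_isFrame {u v : V}
    (hpath : ∀ m b, IsStableFlow V m b →
      ∃ p : Quiver.Path u v, ∀ a, pathFlow p a ≠ 0 → b a ≠ 0) (x : variety x₀) :
    ∃ (p : Quiver.Path u v) (U : (variety x₀).Opens), x ∈ U ∧
      SheafNotions.IsFrame (TorusGIT.sheaf (grading x₀) (stability x₀) (e x₀ v - e x₀ u))
        ((TorusGIT.sheaf (grading x₀) (stability x₀) (e x₀ v - e x₀ u)).presheaf.map
          (homOfLE le_top : U ⟶ ⊤).op
          (TorusGIT.globalSection _ _ _ (pathMonomial_mem x₀ p))) := by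
  obtain ⟨m, b, hb, hx⟩ := exists_isStableFlow_notMem x₀ x
  obtain ⟨p, hp⟩ := hpath m b hb
  -- The monomial of `p` divides `x^b`; the cofactor `x^c` plays the role of `h` in
  -- `isFrame_globalSection`, on the open set where `x^b` does not vanish.
  have hle : pathFlow p ≤ b := fun a => by
    by_cases h : pathFlow p a = 0
    · rw [h]; exact Nat.zero_le _
    · exact (pathFlow_le_one hht p a).trans (Nat.one_le_iff_ne_zero.2 (hp a h))
  obtain ⟨c, rfl⟩ := exists_add_of_le hle
  have hmul : pathMonomial p * MvPolynomial.monomial c 1 =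
      MvPolynomial.monomial (pathFlow p + c) 1 := by
    rw [pathMonomial_eq, MvPolynomial.monomial_mul, one_mul]
  have hmem := monomial_mem_grading x₀ hb
  rw [← hmul] at hmem
  have hc : (MvPolynomial.monomial c 1 : Coord V) ∈
      grading x₀ (m • stability x₀ - (e x₀ v - e x₀ u)) := by
    classical
    refine MvPolynomial.isWeightedHomogeneous_monomial _ _ _ ?_
    rw [eq_sub_iff_add_eq, ← weight_eq_smul_stability_iff.2 hb.2, map_add,
      ← weight_eq_e_sub_e_iff.2 (divergence_pathFlow p), add_comm]
  refine ⟨p, ProjectiveSpectrum.basicOpen _ (TorusGIT.semiMonomial _ _ hmem), ?_,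
    TorusGIT.isFrame_globalSection _ _ (pathMonomial_mem x₀ p) hc hmem ?_ fun y hy => hy⟩
  · change TorusGIT.semiMonomial _ _ hmem ∉ x.asHomogeneousIdeal
    convert hx using 3
  · rw [pathMonomial_eq, Ne, MvPolynomial.monomial_eq_zero]
    exact one_ne_zero

include hht in
theorem isLineBundle_sheaf {u v : V}
    (hpath : ∀ m b, IsStableFlow V m b →
      ∃ p : Quiver.Path u v, ∀ a, pathFlow p a ≠ 0 → b a ≠ 0) :
    SheafNotions.IsLineBundle
      (TorusGIT.sheaf (grading x₀) (stability x₀) (e x₀ v - e x₀ u)) := fun x =>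
  let ⟨_, U, hx, h⟩ := exists_isFrame x₀ hht hpath x
  ⟨U, hx, _, h⟩

include hht in
theorem isGloballyGenerated_sheaf {u v : V}
    (hpath : ∀ m b, IsStableFlow V m b →
      ∃ p : Quiver.Path u v, ∀ a, pathFlow p a ≠ 0 → b a ≠ 0) :
    SheafNotions.IsGloballyGenerated
      (TorusGIT.sheaf (grading x₀) (stability x₀) (e x₀ v - e x₀ u)) := by
  refine SheafNotions.isGloballyGenerated_of_isFrame (I := ULift.{0} (Quiver.Path u v))
    (fun p => TorusGIT.globalSection _ _ _ (pathMonomial_mem x₀ p.down)) fun x => ?_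
  obtain ⟨p, h⟩ := exists_isFrame x₀ hht hpath x
  exact ⟨⟨p⟩, h⟩

omit [Finite V] [Finite (Quiver.Total V)] in
theorem monomial_dvd_of_forall_le {k : Quiver.Total V →₀ ℕ} {u : Coord V}
    (h : ∀ d, MvPolynomial.coeff d u ≠ 0 → k ≤ d) : MvPolynomial.monomial k 1 ∣ u := by
  rw [MvPolynomial.monomial_one_dvd_iff_modMonomial_eq_zero]
  ext d
  by_cases hd : k ≤ d
  · rw [MvPolynomial.coeff_modMonomial_of_le _ hd, MvPolynomial.coeff_zero]
  · rw [MvPolynomial.coeff_modMonomial_of_not_le _ hd, MvPolynomial.coeff_zero]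
    by_contra hne
    exact hd (h d hne)

omit [Finite V] [Finite (Quiver.Total V)] in
theorem le_of_monomial_mul_eq {k l : Quiver.Total V →₀ ℕ} {u u' : Coord V}
    (h : MvPolynomial.monomial l 1 * u = MvPolynomial.monomial k 1 * u') {d : Quiver.Total V →₀ ℕ}
    (hd : MvPolynomial.coeff d u ≠ 0) : k ≤ l + d := by
  have h2 : MvPolynomial.coeff (l + d) (MvPolynomial.monomial l 1 * u) ≠ 0 := by
    rwa [MvPolynomial.coeff_monomial_mul, one_mul]
  rw [h, MvPolynomial.coeff_monomial_mul'] at h2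
  by_contra hn
  rw [if_neg hn] at h2
  exact h2 rfl

/-- If no arrow is used by all stable flows, then every global section of the sheaf attached to a
character is given by a polynomial. -/
theorem exists_eq_globalSection
    (hfix : ∀ a : Quiver.Total V, ∃ m b, IsStableFlow V m b ∧ b a = 0) (χ : Characters x₀)
    (s : TorusGIT.sections (grading x₀) (stability x₀) χ ⊤) :
    ∃ (p : Coord V) (hp : p ∈ grading x₀ χ), TorusGIT.globalSection _ _ χ hp = s := by
  have hunit : IsStableFlow V 1 (unitFlow V) := ⟨one_pos, (one_smul _ _).symm⟩
  obtain ⟨c, hc, hmul⟩ := TorusGIT.exists_eq_const _ _ one_pos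
    (monomial_mem_grading x₀ hunit) (by simp) s
  let ι : Coord V →+* TorusGIT.FracField (Coord V) :=
    (algebraMap (Polynomial (Coord V)) (TorusGIT.FracField (Coord V))).comp Polynomial.C
  have hι : Function.Injective ι := (IsFractionRing.injective (Polynomial (Coord V)) _).comp
    Polynomial.C_injective
  have hmul' (m b) (hb : IsStableFlow V m b) : ∃ k, ∃ u ∈ grading x₀ (χ + (k * m) • stability x₀),
      ι (MvPolynomial.monomial (k • b) 1) * c = ι u := by
    obtain ⟨k, u, hu, e⟩ := hmul m hb.1 _ (monomial_mem_grading x₀ hb)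
    refine ⟨k, u, hu, ?_⟩
    rw [MvPolynomial.monomial_pow, one_pow] at e
    exact e
  obtain ⟨k, u, hu, e⟩ := hmul' 1 _ hunit
  -- Let `b` be a stable flow avoiding the arrow `a`. Computing `c` with both flows gives `x^(l • b)
  -- * u = x^(k • unitFlow) * u'`. The first factor does not involve the variable of `a`, so that
  -- variable occurs at least `k` times in every monomial of `u`.
  have hdvd : MvPolynomial.monomial (k • unitFlow V) 1 ∣ u := by
    refine monomial_dvd_of_forall_le fun d hd a => ?_
    obtain ⟨m, b, hb, hba⟩ := hfix a
    obtain ⟨l, u', hu', e'⟩ := hmul' m b hb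
    have h1 : MvPolynomial.monomial (l • b) 1 * u =
        MvPolynomial.monomial (k • unitFlow V) 1 * u' := by
      apply hι
      rw [map_mul, map_mul, ← e, ← e']
      ring
    simpa [hba] using le_of_monomial_mul_eq h1 hd a
  obtain ⟨p, rfl⟩ := hdvd
  have hp : p ∈ grading x₀ χ := by
    intro d hd
    have h1 := hu (d := k • unitFlow V + d) (by rwa [MvPolynomial.coeff_monomial_mul, one_mul])
    rw [map_add, map_nsmul, weight_eq_smul_stability_iff.2 hunit.2, one_smul, mul_one,
      add_comm] at h1
    exact add_right_cancel h1
  refine ⟨p, hp, Subtype.ext (funext fun x => ?_)⟩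
  refine Eq.trans ?_ (hc x).symm
  rw [map_mul] at e
  refine (mul_left_cancel₀ ?_ e).symm
  rw [Ne, map_eq_zero_iff _ hι, MvPolynomial.monomial_eq_zero]
  exact one_ne_zero

omit [Finite V] [Finite (Quiver.Total V)] in
include hht in
theorem linearIndependent_pathMonomial (u v : V) :
    LinearIndependent ℂ (pathMonomial : Quiver.Path u v → Coord V) := by
  rw [linearIndependent_iff']
  intro s g hg p hp
  classical
  have h := congrArg (MvPolynomial.coeff (pathFlow p)) hg
  rw [MvPolynomial.coeff_sum, MvPolynomial.coeff_zero, Finset.sum_eq_single p] at h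
  · simpa [pathMonomial_eq] using h
  · intro q _ hq
    rw [MvPolynomial.coeff_smul, pathMonomial_eq, MvPolynomial.coeff_monomial,
      if_neg fun h => hq (pathFlow_injective hht h), smul_zero]
  · exact fun h => absurd hp h

-- The exponents that occur in this degree are unit flows from `u` to `v`, and by
-- `exists_pathFlow_eq` these are flows along paths.
omit [Finite (Quiver.Total V)] in
include hht in
theorem exists_sum_pathMonomial {u v : V} {q : Coord V} (hq : q ∈ grading x₀ (e x₀ v - e x₀ u)) :
    ∃ (s : Finset (Quiver.Path u v)) (g : Quiver.Path u v → ℂ),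
      q = ∑ p ∈ s, g p • pathMonomial p := by
  classical
  have h (d) (hd : d ∈ q.support) : ∃ p : Quiver.Path u v, pathFlow p = d :=
    exists_pathFlow_eq hht _ rfl (weight_eq_e_sub_e_iff.1 (hq (MvPolynomial.mem_support_iff.1 hd)))
  choose f hf using h
  have hinj : Function.Injective fun d : q.support => f d.1 d.2 := fun d d' hdd => by
    have := congrArg pathFlow hdd
    rwa [hf, hf, Subtype.coe_inj] at this
  refine ⟨q.support.attach.map ⟨_, hinj⟩, fun p => MvPolynomial.coeff (pathFlow p) q, ?_⟩
  refine (MvPolynomial.as_sum q).trans ?_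
  rw [Finset.sum_map, ← Finset.sum_attach]
  refine Finset.sum_congr rfl fun d _ => ?_
  simp only [Function.Embedding.coeFn_mk]
  rw [pathMonomial_eq, hf, MvPolynomial.smul_monomial, smul_eq_mul, mul_one]

include hht in
/-- If moreover every stable flow carries a path from `u` to `v`, then the paths from `u` to `v`
form a basis of the global sections. -/
theorem exists_basis_sections {u v : V}
    (hfix : ∀ a : Quiver.Total V, ∃ m b, IsStableFlow V m b ∧ b a = 0) :
    ∃ b : Module.Basis (Quiver.Path u v) ℂ
        Γ(TorusGIT.sheaf (grading x₀) (stability x₀) (e x₀ v - e x₀ u), ⊤),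
      ∀ p, b p = TorusGIT.globalSection _ _ _ (pathMonomial_mem x₀ p) := by
  have hunit : IsStableFlow V 1 (unitFlow V) := ⟨one_pos, (one_smul _ _).symm⟩
  refine TorusGIT.exists_basis_sections _ _
    (TorusGIT.zeroPoint _ _ one_pos (monomial_mem_grading x₀ hunit) (by simp))
    (fun p : Quiver.Path u v => pathMonomial_mem x₀ p) (linearIndependent_pathMonomial hht u v)
    (fun q hq => ?_) (exists_eq_globalSection x₀ hfix _)
  obtain ⟨t, g, rfl⟩ := exists_sum_pathMonomial x₀ hht hq
  exact Submodule.sum_mem _ fun p _ => Submodule.smul_mem _ _ (Submodule.subset_span ⟨p, rfl⟩)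

end

end ToricQuiver

/-! ### Lattice paths and the arrows of the ladder quiver -/

namespace YShaped

variable {ρ : ℕ} {n : Fin (ρ + 1) → Fin (ρ + 1) → ℕ} {r : Fin (ρ + 1) → ℕ}
  {R : Finset (Fin (ρ + 1))}

theorem Arrow.lt {u v : Vertex n r R} (a : u ⟶ v) : u.1 < v.1 := by
  have h := Arrow.pairwise n r R a
  rw [List.pairwise_cons] at h
  exact h.1 _ (by simp)

/-- The antidiagonal on which a lattice point lies. -/
def level (z : ℤ × ℤ) : ℤ := z.1 + z.2

theorem Step.level_eq {A : Finset (ℤ × ℤ)} {z z' : ℤ × ℤ} (h : Step A z z') :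
    level z' = level z + 1 := by
  rcases h with ⟨rfl, -⟩ | ⟨rfl, -⟩ <;> simp [level] <;> ring

theorem level_lt {u v : Vertex n r R} (a : u ⟶ v) : level u.1 < level v.1 := by
  have h := Arrow.lt a
  rw [Prod.lt_iff] at h
  unfold level
  rcases h with h | h <;> linarith [h.1, h.2]

/-- There are only finitely many cells, so walking backwards or forwards along edges has to stop.
This bound drives the inductions in `exists_pathFrom` and `exists_pathTo`. -/
theorem exists_level_lt (A : Finset (ℤ × ℤ)) :
    ∃ N : ℕ, ∀ z z', Step A z z' → -N < level z ∧ level z' < N := by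
  obtain ⟨b, hb⟩ := (A.image fun p => |level p|).bddAbove
  have hb' (p) (hp : p ∈ A) : |level p| ≤ b := hb (by simpa using ⟨p.1, p.2, hp, rfl⟩)
  -- The start of an edge lies on the level of the lower left corner of a cell or one above it, and
  -- the end one level further; hence at most `b + 2`.
  refine ⟨(b + 3).toNat, fun z z' h => ?_⟩
  rw [h.level_eq]
  rcases h with ⟨-, h | h⟩ | ⟨-, h | h⟩ <;>
  · have := abs_le.1 (hb' _ h)
    simp only [level, Prod.fst_sub, Prod.snd_sub] at this ⊢
    omega

/-- The lattice paths from the vertex `u` to `z` that meet no vertex after `u`, as the list of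
their points after `u`. -/
inductive PathFrom (n : Fin (ρ + 1) → Fin (ρ + 1) → ℕ) (r : Fin (ρ + 1) → ℕ)
    (R : Finset (Fin (ρ + 1))) (u : ℤ × ℤ) : List (ℤ × ℤ) → ℤ × ℤ → Prop
  | nil : u ∈ vertices n r R → PathFrom n r R u [] u
  | snoc {l : List (ℤ × ℤ)} {z z' : ℤ × ℤ} : PathFrom n r R u l z → Step (cells n r R) z z' →
      z' ∉ vertices n r R → PathFrom n r R u (l ++ [z']) z'

/-- The lattice paths from `z` to the vertex `v` that meet no vertex before `v`, as the list of
their points after `z`. -/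
inductive PathTo (n : Fin (ρ + 1) → Fin (ρ + 1) → ℕ) (r : Fin (ρ + 1) → ℕ)
    (R : Finset (Fin (ρ + 1))) (v : ℤ × ℤ) : ℤ × ℤ → List (ℤ × ℤ) → Prop
  | nil : v ∈ vertices n r R → PathTo n r R v v []
  | cons {l : List (ℤ × ℤ)} {z z' : ℤ × ℤ} : z ∉ vertices n r R → Step (cells n r R) z z' →
      PathTo n r R v z' l → PathTo n r R v z (z' :: l)

theorem PathFrom.mem {u z : ℤ × ℤ} {l : List (ℤ × ℤ)} (h : PathFrom n r R u l z) :
    u ∈ vertices n r R := by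
  induction h with
  | nil h => exact h
  | snoc _ _ _ ih => exact ih

theorem PathTo.mem {v z : ℤ × ℤ} {l : List (ℤ × ℤ)} (h : PathTo n r R v z l) :
    v ∈ vertices n r R := by
  induction h with
  | nil h => exact h
  | cons _ _ _ ih => exact ih

theorem PathFrom.notMem {u z : ℤ × ℤ} {l : List (ℤ × ℤ)} (h : PathFrom n r R u l z) :
    ∀ p ∈ l, p ∉ vertices n r R := by
  induction h with
  | nil h => simp
  | snoc _ _ h ih =>
    intro p hp
    rw [List.mem_append, List.mem_singleton] at hp
    rcases hp with hp | rfl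
    exacts [ih p hp, h]

theorem PathFrom.getLast {u z : ℤ × ℤ} {l : List (ℤ × ℤ)} (h : PathFrom n r R u l z) :
    (u :: l).getLast (List.cons_ne_nil _ _) = z := by
  cases h with
  | nil h => rfl
  | snoc _ _ h => simp

theorem PathFrom.isChain {u z : ℤ × ℤ} {l : List (ℤ × ℤ)} (h : PathFrom n r R u l z) :
    ∀ {z' q}, Step (cells n r R) z z' → List.IsChain (Step (cells n r R)) (z' :: q) →
      List.IsChain (Step (cells n r R)) (u :: (l ++ z' :: q)) := by
  induction h with
  | nil h => exact fun h1 h2 => List.IsChain.cons_cons h1 h2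
  | snoc _ hs _ ih =>
    intro z' q h1 h2
    rw [List.append_assoc]
    exact ih hs (List.IsChain.cons_cons h1 h2)

theorem PathTo.isChain {v z : ℤ × ℤ} {l : List (ℤ × ℤ)} (h : PathTo n r R v z l) :
    List.IsChain (Step (cells n r R)) (z :: l) := by
  induction h with
  | nil h => exact List.IsChain.singleton _
  | cons _ hs _ ih => exact List.IsChain.cons_cons hs ih

theorem PathTo.exists_eq {v z : ℤ × ℤ} {l : List (ℤ × ℤ)} (h : PathTo n r R v z l) :
    ∃ m, z :: l = m ++ [v] ∧ ∀ p ∈ m, p ∉ vertices n r R := by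
  induction h with
  | nil h => exact ⟨[], rfl, by simp⟩
  | @cons l z z' hz hs _ ih =>
    obtain ⟨m, hm, hp⟩ := ih
    exact ⟨z :: m, by rw [hm]; rfl, by simpa using ⟨hz, fun a b => hp (a, b)⟩⟩

theorem exists_arrow {u v z z' : ℤ × ℤ} {l q : List (ℤ × ℤ)} (h : PathFrom n r R u l z)
    (hs : Step (cells n r R) z z') (h' : PathTo n r R v z' q) :
    ∃ a : Quiver.Total (Vertex n r R), a.left.1 = u ∧ a.right.1 = v ∧
      a.hom.mid ++ [a.right.1] = l ++ z' :: q := by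
  obtain ⟨m, hm, hp⟩ := h'.exists_eq
  have hc := h.isChain hs h'.isChain
  rw [hm, ← List.append_assoc] at hc
  refine ⟨⟨⟨u, h.mem⟩, ⟨v, h'.mem⟩, ⟨l ++ m, hc, fun p hp' => ?_⟩⟩, rfl, rfl,
    (List.append_assoc _ _ _).trans (congrArg (l ++ ·) hm.symm)⟩
  rw [List.mem_append] at hp'
  exact hp'.elim (h.notMem p) (hp p)

theorem exists_pathTo {v : ℤ × ℤ} (hv : v ∈ vertices n r R) :
    ∀ (m : List (ℤ × ℤ)) (u : ℤ × ℤ), List.IsChain (Step (cells n r R)) (u :: (m ++ [v])) →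
      (∀ p ∈ m, p ∉ vertices n r R) →
      ∃ z l, Step (cells n r R) u z ∧ PathTo n r R v z l ∧ m ++ [v] = z :: l := by
  intro m
  induction m with
  | nil =>
    intro u hc _
    exact ⟨v, [], by simpa using hc, .nil hv, rfl⟩
  | cons p m ih =>
    intro u hc hm
    rw [List.cons_append, List.isChain_cons_cons] at hc
    obtain ⟨z, l, hs, h, e⟩ := ih p hc.2 fun q hq => hm q (List.mem_cons_of_mem _ hq)
    exact ⟨p, z :: l, hc.1, .cons (hm p List.mem_cons_self) hs h, by rw [← e]; rfl⟩

theorem total_ext {a a' : Quiver.Total (Vertex n r R)} (hl : a.left.1 = a'.left.1)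
    (h : a.hom.mid ++ [a.right.1] = a'.hom.mid ++ [a'.right.1]) : a = a' := by
  obtain ⟨u, v, a⟩ := a
  obtain ⟨u', v', a'⟩ := a'
  obtain ⟨h1, h2⟩ := List.append_inj' h rfl
  obtain rfl : u = u' := Subtype.ext hl
  obtain rfl : v = v' := Subtype.ext (by simpa using h2)
  obtain rfl : a = a' := Arrow.ext h1
  rfl

/-- The lattice points that are not vertices are divided into those where paths can only split
and those where they can only merge, and `φ` leads from them back respectively forth to a
vertex. -/
structure IsContraction (n : Fin (ρ + 1) → Fin (ρ + 1) → ℕ) (r : Fin (ρ + 1) → ℕ)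
    (R : Finset (Fin (ρ + 1))) (sp mg : ℤ × ℤ → Prop) (φ : ℤ × ℤ → ℤ × ℤ) : Prop where
  cases_left : ∀ {z z'}, Step (cells n r R) z z' → z ∈ vertices n r R ∨ sp z ∨ mg z
  cases_right : ∀ {z z'}, Step (cells n r R) z z' → z' ∈ vertices n r R ∨ sp z' ∨ mg z'
  sp_notMem : ∀ {z}, sp z → z ∉ vertices n r R
  mg_notMem : ∀ {z}, mg z → z ∉ vertices n r R
  not_mg : ∀ {z}, sp z → ¬ mg z
  of_mem : ∀ {z}, z ∈ vertices n r R → φ z = z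
  pred : ∀ {z}, sp z → ∃ z₀, (∀ z₁, Step (cells n r R) z₁ z ↔ z₁ = z₀) ∧
    (z₀ ∈ vertices n r R ∨ sp z₀) ∧ φ z₀ = φ z
  succ : ∀ {z}, mg z → ∃ z₀, (∀ z₁, Step (cells n r R) z z₁ ↔ z₁ = z₀) ∧
    (z₀ ∈ vertices n r R ∨ mg z₀) ∧ φ z₀ = φ z

/-- The edges between the part of a lattice path where it can split and the part where it can
merge. -/
def Transverse (n : Fin (ρ + 1) → Fin (ρ + 1) → ℕ) (r : Fin (ρ + 1) → ℕ)
    (R : Finset (Fin (ρ + 1))) (sp mg : ℤ × ℤ → Prop) (z z' : ℤ × ℤ) : Prop :=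
  Step (cells n r R) z z' ∧ (z ∈ vertices n r R ∨ sp z) ∧ (z' ∈ vertices n r R ∨ mg z')

namespace IsContraction

variable {sp mg : ℤ × ℤ → Prop} {φ : ℤ × ℤ → ℤ × ℤ} (C : IsContraction n r R sp mg φ)

include C

/-- A split point has exactly one incoming edge, and it comes from a split point or a vertex;
following these edges backwards ends at the vertex `φ z`. -/
theorem exists_pathFrom {z : ℤ × ℤ} (hz : z ∈ vertices n r R ∨ sp z) :
    ∃ l, PathFrom n r R (φ z) l z := by
  obtain ⟨N, hN⟩ := exists_level_lt (cells n r R)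
  have key (k : ℕ) : ∀ z, (z ∈ vertices n r R ∨ sp z) → level z + N ≤ k →
      ∃ l, PathFrom n r R (φ z) l z := by
    induction k with
    | zero =>
      intro z hz hk
      rcases hz with hz | hz
      · exact ⟨[], by rw [C.of_mem hz]; exact .nil hz⟩
      · obtain ⟨z₀, h0, -, -⟩ := C.pred hz
        have h1 := (h0 z₀).2 rfl
        have h2 := hN _ _ h1
        rw [h1.level_eq] at hk
        push_cast at hk
        linarith
    | succ k ih =>
      intro z hz hk
      rcases hz with hz | hz
      · exact ⟨[], by rw [C.of_mem hz]; exact .nil hz⟩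
      · obtain ⟨z₀, h0, hz0, e⟩ := C.pred hz
        have h1 := (h0 z₀).2 rfl
        obtain ⟨l, hl⟩ := ih z₀ hz0 (by rw [h1.level_eq] at hk; push_cast at hk; linarith)
        rw [e] at hl
        exact ⟨_, hl.snoc h1 (C.sp_notMem hz)⟩
  exact key (level z + N).toNat z hz (Int.self_le_toNat _)

theorem exists_pathTo {z : ℤ × ℤ} (hz : z ∈ vertices n r R ∨ mg z) :
    ∃ l, PathTo n r R (φ z) z l := by
  obtain ⟨N, hN⟩ := exists_level_lt (cells n r R)
  have key (k : ℕ) : ∀ z, (z ∈ vertices n r R ∨ mg z) → N - level z ≤ k →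
      ∃ l, PathTo n r R (φ z) z l := by
    induction k with
    | zero =>
      intro z hz hk
      rcases hz with hz | hz
      · exact ⟨[], by rw [C.of_mem hz]; exact .nil hz⟩
      · obtain ⟨z₀, h0, -, -⟩ := C.succ hz
        have h1 := (h0 z₀).2 rfl
        have h2 := hN _ _ h1
        rw [h1.level_eq] at h2
        push_cast at hk
        linarith
    | succ k ih =>
      intro z hz hk
      rcases hz with hz | hz
      · exact ⟨[], by rw [C.of_mem hz]; exact .nil hz⟩
      · obtain ⟨z₀, h0, hz0, e⟩ := C.succ hz
        have h1 := (h0 z₀).2 rfl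
        obtain ⟨l, hl⟩ := ih z₀ hz0 (by rw [h1.level_eq]; push_cast at hk; linarith)
        rw [e] at hl
        exact ⟨_, .cons (C.mg_notMem hz) h1 hl⟩
  exact key (N - level z).toNat z hz (Int.self_le_toNat _)

theorem pathFrom_unique {u u' z : ℤ × ℤ} {l l' : List (ℤ × ℤ)}
    (hz : z ∈ vertices n r R ∨ sp z) (h : PathFrom n r R u l z) (h' : PathFrom n r R u' l' z) :
    u = u' ∧ l = l' := by
  induction h generalizing l' with
  | nil hu =>
    cases h' with
    | nil _ => exact ⟨rfl, rfl⟩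
    | snoc _ _ h => exact absurd hu h
  | snoc _ hs hn ih =>
    cases h' with
    | nil hu => exact absurd hu hn
    | snoc h' hs' _ =>
      obtain ⟨z₀, h0, hz0, -⟩ := C.pred (hz.resolve_left hn)
      obtain rfl := (h0 _).1 hs
      obtain rfl := (h0 _).1 hs'
      obtain ⟨rfl, rfl⟩ := ih hz0 h'
      exact ⟨rfl, rfl⟩

theorem pathTo_unique {v v' z : ℤ × ℤ} {l l' : List (ℤ × ℤ)}
    (hz : z ∈ vertices n r R ∨ mg z) (h : PathTo n r R v z l) (h' : PathTo n r R v' z l') :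
    v = v' ∧ l = l' := by
  induction h generalizing l' with
  | nil hu =>
    cases h' with
    | nil _ => exact ⟨rfl, rfl⟩
    | cons h _ _ => exact absurd hu h
  | cons hn hs _ ih =>
    cases h' with
    | nil hu => exact absurd hu hn
    | cons _ hs' h' =>
      obtain ⟨z₀, h0, hz0, -⟩ := C.succ (hz.resolve_left hn)
      obtain rfl := (h0 _).1 hs
      obtain rfl := (h0 _).1 hs'
      obtain ⟨rfl, rfl⟩ := ih hz0 h'
      exact ⟨rfl, rfl⟩

theorem mem_left {z z' : ℤ × ℤ} (h : Step (cells n r R) z z') : φ z ∈ vertices n r R := by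
  rcases C.cases_left h with h | h | h
  · exact (C.exists_pathFrom (.inl h)).choose_spec.mem
  · exact (C.exists_pathFrom (.inr h)).choose_spec.mem
  · exact (C.exists_pathTo (.inr h)).choose_spec.mem

theorem mem_right {z z' : ℤ × ℤ} (h : Step (cells n r R) z z') : φ z' ∈ vertices n r R := by
  rcases C.cases_right h with h | h | h
  · exact (C.exists_pathFrom (.inl h)).choose_spec.mem
  · exact (C.exists_pathFrom (.inr h)).choose_spec.mem
  · exact (C.exists_pathTo (.inr h)).choose_spec.mem

/-- Edges that are not transverse are contracted. -/
theorem eq_of_not_transverse {z z' : ℤ × ℤ} (h : Step (cells n r R) z z')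
    (ht : ¬ Transverse n r R sp mg z z') : φ z = φ z' := by
  have h2 : mg z ∨ sp z' := by
    by_contra! hn
    refine ht ⟨h, ?_, ?_⟩
    · have := C.cases_left h
      tauto
    · have := C.cases_right h
      tauto
  rcases h2 with h2 | h2
  · obtain ⟨z₀, h0, -, e⟩ := C.succ h2
    rw [(h0 _).1 h, e]
  · obtain ⟨z₀, h0, -, e⟩ := C.pred h2
    rw [(h0 _).1 h, e]

theorem pathFrom_sp {u z : ℤ × ℤ} {l : List (ℤ × ℤ)}
    (hz : z ∈ vertices n r R ∨ sp z) (h : PathFrom n r R u l z) : ∀ p ∈ l, sp p := by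
  induction h with
  | nil hu => simp
  | snoc _ hs hn ih =>
    obtain ⟨z₀, h0, hz0, -⟩ := C.pred (hz.resolve_left hn)
    obtain rfl := (h0 _).1 hs
    intro p hp
    rw [List.mem_append, List.mem_singleton] at hp
    rcases hp with hp | rfl
    exacts [ih hz0 p hp, hz.resolve_left hn]

theorem reflTransGen_pathFrom {u z : ℤ × ℤ} {l : List (ℤ × ℤ)}
    (hz : z ∈ vertices n r R ∨ sp z) (h : PathFrom n r R u l z) :
    Relation.ReflTransGen
      (fun z z' => Step (cells n r R) z z' ∧ ¬ Transverse n r R sp mg z z') u z := by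
  induction h with
  | nil hu => exact .refl
  | snoc _ hs hn ih =>
    have h := hz.resolve_left hn
    obtain ⟨z₀, h0, hz0, -⟩ := C.pred h
    obtain rfl := (h0 _).1 hs
    exact (ih hz0).tail ⟨hs, fun ht => ht.2.2.elim hn (C.not_mg h)⟩

theorem reflTransGen_pathTo {v z : ℤ × ℤ} {l : List (ℤ × ℤ)}
    (hz : z ∈ vertices n r R ∨ mg z) (h : PathTo n r R v z l) :
    Relation.ReflTransGen
      (fun z z' => Step (cells n r R) z z' ∧ ¬ Transverse n r R sp mg z z') z v := by
  induction h with
  | nil hu => exact .refl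
  | cons hn hs _ ih =>
    have h := hz.resolve_left hn
    obtain ⟨z₀, h0, hz0, -⟩ := C.succ h
    obtain rfl := (h0 _).1 hs
    exact (ih hz0).head ⟨hs, fun ht => ht.2.1.elim hn fun h' => C.not_mg h' h⟩

/-- There are lattice paths without transverse edges from the vertex of the start of a transverse
edge to the start, and from the end to the vertex of the end. -/
theorem reflTransGen {z z' : ℤ × ℤ} (h : Transverse n r R sp mg z z') :
    Relation.ReflTransGen
      (fun z z' => Step (cells n r R) z z' ∧ ¬ Transverse n r R sp mg z z') (φ z) z ∧
    Relation.ReflTransGen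
      (fun z z' => Step (cells n r R) z z' ∧ ¬ Transverse n r R sp mg z z') z' (φ z') :=
  ⟨C.reflTransGen_pathFrom h.2.1 (C.exists_pathFrom h.2.1).choose_spec,
    C.reflTransGen_pathTo h.2.2 (C.exists_pathTo h.2.2).choose_spec⟩

/-- After its start a lattice path consists of split points up to the first point that is not one.
The edge into that point is transverse. -/
theorem exists_transverse {v z' : ℤ × ℤ} {q : List (ℤ × ℤ)} (h' : PathTo n r R v z' q) :
    ∀ {u z : ℤ × ℤ} {l : List (ℤ × ℤ)}, PathFrom n r R u l z → (z ∈ vertices n r R ∨ sp z) →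
      Step (cells n r R) z z' →
      ∃ z₁ z₁' l₁ q₁, PathFrom n r R u l₁ z₁ ∧ Transverse n r R sp mg z₁ z₁' ∧
        PathTo n r R v z₁' q₁ ∧ l ++ z' :: q = l₁ ++ z₁' :: q₁ := by
  induction h' with
  | nil hv =>
    intro u z l h hz hs
    exact ⟨z, v, l, [], h, ⟨hs, hz, .inl hv⟩, .nil hv, rfl⟩
  | @cons q z' z'' hn hs' h' ih =>
    intro u z l h hz hs
    rcases (C.cases_right hs).resolve_left hn with hsp | hmg
    · obtain ⟨z₁, z₁', l₁, q₁, h1, h2, h3, h4⟩ := ih (h.snoc hs hn) (.inr hsp) hs'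
      exact ⟨z₁, z₁', l₁, q₁, h1, h2, h3, by rw [← h4, List.append_assoc]; rfl⟩
    · exact ⟨z, z', l, z'' :: q, h, ⟨hs, hz, .inr hmg⟩, .cons hn hs' h', rfl⟩

/-- If the second transverse edge came later on the path, the head `z'` of the first would be among
the points before it, all of which are split points, whereas `z'` is a vertex or a merge point. -/
theorem transverse_unique {u z z' z₁ z₁' : ℤ × ℤ} {l l₁ q q₁ : List (ℤ × ℤ)}
    (h : PathFrom n r R u l z) (ht : Transverse n r R sp mg z z')
    (h₁ : PathFrom n r R u l₁ z₁) (ht₁ : Transverse n r R sp mg z₁ z₁')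
    (e : l ++ z' :: q = l₁ ++ z₁' :: q₁) (hle : l.length ≤ l₁.length) : z = z₁ ∧ z' = z₁' := by
  obtain ⟨m, rfl⟩ : ∃ m, l₁ = l ++ m := by
    have h1 : l <+: l₁ ++ z₁' :: q₁ := ⟨_, e⟩
    obtain ⟨m, hm⟩ := List.prefix_of_prefix_length_le h1 (List.prefix_append _ _) hle
    exact ⟨m, hm.symm⟩
  rw [List.append_assoc, List.append_cancel_left_eq] at e
  cases m with
  | nil =>
    rw [List.append_nil] at h₁
    exact ⟨h.getLast.symm.trans h₁.getLast, (List.cons.inj e).1⟩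
  | cons p m =>
    obtain ⟨rfl, -⟩ := List.cons.inj e
    have hs := C.pathFrom_sp ht₁.2.1 h₁ z' (by simp)
    exact (ht.2.2.elim (C.sp_notMem hs) (C.not_mg hs)).elim

/-- The arrows correspond to the transverse edges. -/
theorem exists_equiv : ∃ E : {e : (ℤ × ℤ) × (ℤ × ℤ) // Transverse n r R sp mg e.1 e.2} ≃
    Quiver.Total (Vertex n r R), ∀ e, (E e).left.1 = φ e.1.1 ∧ (E e).right.1 = φ e.1.2 := by
  have key (e : {e : (ℤ × ℤ) × (ℤ × ℤ) // Transverse n r R sp mg e.1 e.2}) :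
      ∃ (a : Quiver.Total (Vertex n r R)) (l q : List (ℤ × ℤ)),
        PathFrom n r R (φ e.1.1) l e.1.1 ∧ PathTo n r R (φ e.1.2) e.1.2 q ∧
        a.left.1 = φ e.1.1 ∧ a.right.1 = φ e.1.2 ∧
        a.hom.mid ++ [a.right.1] = l ++ e.1.2 :: q := by
    obtain ⟨l, hl⟩ := C.exists_pathFrom e.2.2.1
    obtain ⟨q, hq⟩ := C.exists_pathTo e.2.2.2
    obtain ⟨a, h⟩ := exists_arrow hl e.2.1 hq
    exact ⟨a, l, q, hl, hq, h⟩
  choose f l q hl hq h1 h2 h3 using key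
  refine ⟨Equiv.ofBijective f ⟨fun e e' he => ?_, fun a => ?_⟩, fun e => ⟨h1 e, h2 e⟩⟩
  · have e1 := h3 e
    rw [he, h3 e'] at e1
    have e2 := h1 e
    rw [he, h1 e'] at e2
    have hl' := hl e'
    rw [e2] at hl'
    rcases le_total (l e).length (l e').length with hle | hle
    · obtain ⟨h, h'⟩ := C.transverse_unique (hl e) e.2 hl' e'.2 e1.symm hle
      exact Subtype.ext (Prod.ext h h')
    · obtain ⟨h, h'⟩ := C.transverse_unique hl' e'.2 (hl e) e.2 e1 hle
      exact Subtype.ext (Prod.ext h.symm h'.symm)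
  · obtain ⟨z, m, hs, hp, e⟩ := YShaped.exists_pathTo a.right.2 a.hom.mid a.left.1
      a.hom.isChain a.hom.notMem
    obtain ⟨z₁, z₁', l₁, q₁, hf, ht, hto, e'⟩ :=
      C.exists_transverse hp (.nil a.left.2) (.inl a.left.2) hs
    refine ⟨⟨(z₁, z₁'), ht⟩, ?_⟩
    obtain ⟨h4, h5⟩ := C.pathFrom_unique ht.2.1 hf (hl ⟨(z₁, z₁'), ht⟩)
    obtain ⟨h6, h7⟩ := C.pathTo_unique ht.2.2 hto (hq ⟨(z₁, z₁'), ht⟩)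
    refine total_ext ((h1 _).trans h4.symm) ?_
    rw [h3, e, ← h5, ← h7]
    exact e'.symm

end IsContraction

end YShaped

/-! ### Local geometry of a ladder diagram -/

namespace YShaped

/-- The right half of a ladder diagram with cells `A` and vertices `V`: its columns have height
`hgt x` and stand on the `x`-axis, and merging paths at the height of the column that ends at `x`
lead to `a x`. -/
structure IsRightHalf (A V : Set (ℤ × ℤ)) (W H : ℤ) (hgt : ℤ → ℤ) (a : ℤ → ℤ × ℤ) : Prop where
  mem_iff : ∀ x y, 0 ≤ x → ((x, y) ∈ A ↔ 0 ≤ y ∧ y < hgt x)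
  hgt_eq : ∀ x, 0 ≤ x → x < W → hgt x = H
  a_eq : ∀ x, 0 < x → x ≤ W → a x = (W, H)
  zero_mem : (0, 0) ∈ V
  col : ∀ x, 0 < x →
    (hgt (x - 1) ≤ 0 ∧ hgt x ≤ 0 ∧ ∀ y, (x, y) ∉ V) ∨
    (0 < hgt (x - 1) ∧ hgt x = hgt (x - 1) ∧ a (x + 1) = a x ∧
      ∀ y, (x, y) ∈ V ↔ 1 ≤ y ∧ y < hgt (x - 1)) ∨
    (0 < hgt (x - 1) ∧ a x = (x, hgt (x - 1)) ∧
      ∀ y, (x, y) ∈ V ↔ (1 ≤ y ∧ y < hgt (x - 1) ∧ y < hgt x) ∨ y = hgt (x - 1) ∨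
        (y = hgt x ∧ 0 < y ∧ y ≤ hgt (x - 1)))

/-- One of the four cells around a lattice point belongs to `A`. -/
def Incident (A : Set (ℤ × ℤ)) (x y : ℤ) : Prop :=
  (x, y) ∈ A ∨ (x - 1, y) ∈ A ∨ (x, y - 1) ∈ A ∨ (x - 1, y - 1) ∈ A

namespace IsRightHalf

variable {A V : Set (ℤ × ℤ)} {W H : ℤ} {hgt : ℤ → ℤ} {a : ℤ → ℤ × ℤ}
  (D : IsRightHalf A V W H hgt a)

include D

theorem zero_notMem {x : ℤ} (hx : 0 < x) (hi : Incident A x 0) : (x, 0) ∉ V := by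
  have h0 := D.mem_iff x 0 hx.le
  have h1 := D.mem_iff (x - 1) 0 (by omega)
  have h2 := D.mem_iff x (0 - 1) hx.le
  have h3 := D.mem_iff (x - 1) (0 - 1) (by omega)
  unfold Incident at hi
  rw [h0, h1, h2, h3] at hi
  rcases D.col x hx with h | ⟨hp, hq, -, h⟩ | ⟨hp, -, h⟩
  · omega
  · rw [h]; omega
  · rw [h]; omega

/-- There are two kinds of such points: those on the bottom edge, entered from the left, and those
on a wall where the next column is higher than the previous one, entered from below. -/
theorem split {x y : ℤ} (hx : 0 < x) (hV : (x, y) ∉ V) (hi : Incident A x y)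
    (hs : (x, y) ∈ A ∨ (x - 1, y - 1) ∉ A) :
    (y = 0 ∧ (x - 1, y) ∈ A ∧ (x, y - 1) ∉ A ∧ (x - 1, y - 1) ∉ A) ∨
    (1 ≤ y ∧ (x - 1, y) ∉ A ∧ (x, y - 1) ∈ A ∧ (x - 1, y - 1) ∉ A ∧ y - 1 ≠ 0 ∧
      ((x, y - 1) ∈ V → a x = (x, y - 1))) := by
  have h0 := D.mem_iff x y hx.le
  have h1 := D.mem_iff (x - 1) y (by omega)
  have h2 := D.mem_iff x (y - 1) hx.le
  have h3 := D.mem_iff (x - 1) (y - 1) (by omega)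
  unfold Incident at hi
  rw [h0, h1, h2, h3] at hi
  rw [h0, h3] at hs
  rw [h1, h2, h3]
  rcases D.col x hx with h | ⟨hp, hq, -, h⟩ | ⟨hp, ha, h⟩
  · omega
  · rw [h] at hV
    left
    omega
  · rw [h] at hV
    rcases eq_or_ne y 0 with rfl | hy
    · left
      omega
    · right
      refine ⟨by omega, by omega, by omega, by omega, by omega, fun hV' => ?_⟩
      rw [h] at hV'
      rw [ha, show hgt (x - 1) = y - 1 by omega]

/-- There are two kinds of such points: those on the top edge inside a block, left to the right, and
those on a wall where the next column is lower than the previous one, left upwards. -/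
theorem merge {x y : ℤ} (hx : 0 < x) (hV : (x, y) ∉ V)
    (hl : (x - 1, y - 1) ∈ A) (hn : (x, y) ∉ A) :
    1 ≤ y ∧
    (((x - 1, y) ∉ A ∧ (x, y - 1) ∈ A ∧ ((x + 1, y) ∉ V → (x + 1, y) ∉ A) ∧
      a (x + 1) = a x ∧ ((x + 1, y) ∈ V → a x = (x + 1, y))) ∨
    ((x - 1, y) ∈ A ∧ (x, y - 1) ∉ A ∧ ((x, y + 1) ∉ V → (x, y + 1) ∉ A) ∧
      ((x, y + 1) ∈ V → a x = (x, y + 1)))) := by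
  have h0 := D.mem_iff x y hx.le
  have h1 := D.mem_iff (x - 1) y (by omega)
  have h2 := D.mem_iff x (y - 1) hx.le
  have h3 := D.mem_iff (x - 1) (y - 1) (by omega)
  have h4 := D.mem_iff x (y + 1) (by omega)
  have h5 := D.mem_iff (x + 1) y (by omega)
  have hcol := D.col (x + 1) (by omega)
  rw [add_sub_cancel_right] at hcol
  rw [h3] at hl
  rw [h0] at hn
  rw [h1, h2, h4, h5]
  rcases D.col x hx with h | ⟨hp, hq, ha, h⟩ | ⟨hp, ha, h⟩
  · omega
  · rw [h] at hV
    refine ⟨by omega, .inl ⟨by omega, by omega, ?_, ha, ?_⟩⟩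
    · rcases hcol with h' | ⟨hp', hq', ha', h'⟩ | ⟨hp', ha', h'⟩
      · omega
      · omega
      · rw [h']; omega
    · intro hV'
      rcases hcol with h' | ⟨hp', hq', ha', h'⟩ | ⟨hp', ha', h'⟩
      · omega
      · rw [h'] at hV'; omega
      · rw [← ha, ha', show hgt x = y by omega]
  · rw [h] at hV
    refine ⟨by omega, .inr ⟨by omega, by omega, by omega, fun hV' => ?_⟩⟩
    rw [h] at hV'
    rw [ha, show hgt (x - 1) = y + 1 by omega]

theorem mem_of_mem {x y : ℤ} (hx : 0 < x) (hl : (x - 1, y - 1) ∈ A) (h : (x, y) ∈ A) :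
    (x, y) ∈ V := by
  rw [D.mem_iff _ _ (by omega)] at hl h
  rcases D.col x hx with h' | ⟨hp, hq, -, h'⟩ | ⟨hp, -, h'⟩
  · omega
  · rw [h']; omega
  · rw [h']; omega

/-- Interior points and intersection points strictly below the corner have edges in all four
directions. The remaining vertex on a wall is the upper right corner of a block, which `a` fixes. -/
theorem vertex {x y : ℤ} (hx : 0 < x) (hV : (x, y) ∈ V) :
    (y ≠ 0 ∧ a x = (x, y)) ∨ (((x, y) ∈ A ∨ (x, y - 1) ∈ A) ∧ ((x, y) ∈ A ∨ (x - 1, y) ∈ A) ∧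
      ((x - 1, y) ∈ A ∨ (x - 1, y - 1) ∈ A) ∧ ((x, y - 1) ∈ A ∨ (x - 1, y - 1) ∈ A)) := by
  have h0 := D.mem_iff x y hx.le
  have h1 := D.mem_iff (x - 1) y (by omega)
  have h2 := D.mem_iff x (y - 1) hx.le
  have h3 := D.mem_iff (x - 1) (y - 1) (by omega)
  rw [h0, h1, h2, h3]
  rcases D.col x hx with h | ⟨hp, hq, -, h⟩ | ⟨hp, ha, h⟩
  · exact absurd hV (h.2.2 y)
  · rw [h] at hV
    omega
  · rw [h] at hV
    rcases eq_or_ne y (hgt (x - 1)) with rfl | hy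
    · exact .inl ⟨by omega, ha⟩
    · omega

/-- This treats the seam between the two halves, where the top edge passes from `(0, H)` to `(1,
H)`. -/
theorem corner (hW : 0 < W) (hH : 0 < H) : (0, H - 1) ∈ A ∧ ((1, H) ∉ V → (1, H) ∉ A) ∧
    ((1, H) ∈ V → (W, H) = (1, H)) := by
  have h0 := D.hgt_eq 0 le_rfl hW
  have h1 := D.a_eq 1 one_pos (by omega)
  rw [D.mem_iff _ _ le_rfl, D.mem_iff _ _ zero_le_one]
  refine ⟨by omega, ?_⟩
  rcases D.col 1 one_pos with h' | ⟨hp, hq, -, h'⟩ | ⟨hp, ha, h'⟩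
  · rw [sub_self] at h'; omega
  · rw [sub_self] at *
    rw [h']; omega
  · rw [sub_self] at *
    rw [h', ← h1, ha, h0]
    exact ⟨by omega, fun _ => rfl⟩

end IsRightHalf

/-- The rotated set of cells. -/
def rotCells (W H : ℤ) (A : Set (ℤ × ℤ)) : Set (ℤ × ℤ) := {c | (W - 1 - c.1, H - 1 - c.2) ∈ A}

/-- The rotated set of vertices. -/
def rotVertices (W H : ℤ) (V : Set (ℤ × ℤ)) : Set (ℤ × ℤ) := {z | (W - z.1, H - z.2) ∈ V}

theorem mem_rotCells {W H : ℤ} {A : Set (ℤ × ℤ)} {u v x y : ℤ} (hx : x = W - 1 - u)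
    (hy : y = H - 1 - v) : (u, v) ∈ rotCells W H A ↔ (x, y) ∈ A := by
  subst hx hy; rfl

theorem mem_rotVertices {W H : ℤ} {V : Set (ℤ × ℤ)} {u v x y : ℤ} (hx : x = W - u)
    (hy : y = H - v) : (u, v) ∈ rotVertices W H V ↔ (x, y) ∈ V := by
  subst hx hy; rfl

variable {ρ : ℕ} {n : Fin (ρ + 1) → Fin (ρ + 1) → ℕ} {r : Fin (ρ + 1) → ℕ}
  {R : Finset (Fin (ρ + 1))}

/-- The lattice points where paths can only split. -/
def IsSplit (n : Fin (ρ + 1) → Fin (ρ + 1) → ℕ) (r : Fin (ρ + 1) → ℕ)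
    (R : Finset (Fin (ρ + 1))) (z : ℤ × ℤ) : Prop :=
  z ∉ vertices n r R ∧ Incident (cells n r R) z.1 z.2 ∧
    (z ∈ cells n r R ∨ 0 < z.1 ∧ (z.1 - 1, z.2 - 1) ∉ cells n r R)

/-- The lattice points where paths can only merge. -/
def IsMerge (n : Fin (ρ + 1) → Fin (ρ + 1) → ℕ) (r : Fin (ρ + 1) → ℕ)
    (R : Finset (Fin (ρ + 1))) (z : ℤ × ℤ) : Prop :=
  z ∉ vertices n r R ∧ Incident (cells n r R) z.1 z.2 ∧ z ∉ cells n r R ∧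
    (z.1 ≤ 0 ∨ (z.1 - 1, z.2 - 1) ∈ cells n r R)

/-- The vertex to which the lattice points that are not vertices are contracted. -/
def anchor (W H : ℤ) (a a' : ℤ → ℤ × ℤ) (z : ℤ × ℤ) : ℤ × ℤ :=
  if 0 < z.1 then (if z.2 = 0 then (0, 0) else a z.1)
  else if z.2 = H then (W, H) else (W, H) - a' (W - z.1)

open Classical in
/-- The contraction of the lattice points to the vertices. -/
noncomputable def contract (n : Fin (ρ + 1) → Fin (ρ + 1) → ℕ) (r : Fin (ρ + 1) → ℕ)
    (R : Finset (Fin (ρ + 1))) (W H : ℤ) (a a' : ℤ → ℤ × ℤ) (z : ℤ × ℤ) : ℤ × ℤ :=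
  if z ∈ vertices n r R then z else anchor W H a a' z

theorem contract_of_mem {W H : ℤ} {a a' : ℤ → ℤ × ℤ} {z : ℤ × ℤ} (h : z ∈ vertices n r R) :
    contract n r R W H a a' z = z := if_pos h

theorem contract_of_notMem {W H : ℤ} {a a' : ℤ → ℤ × ℤ} {z : ℤ × ℤ} (h : z ∉ vertices n r R) :
    contract n r R W H a a' z = anchor W H a a' z := if_neg h

theorem contract_eq {W H : ℤ} {a a' : ℤ → ℤ × ℤ} {z v : ℤ × ℤ}
    (h : z ∈ vertices n r R → v = z) (h' : anchor W H a a' z = v) :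
    contract n r R W H a a' z = v := by
  by_cases hz : z ∈ vertices n r R
  · rw [contract_of_mem hz, h hz]
  · rw [contract_of_notMem hz, h']

theorem step_iff_right {A : Finset (ℤ × ℤ)} {z₁ : ℤ × ℤ} {x y : ℤ} : Step A z₁ (x, y) ↔
    (z₁ = (x - 1, y) ∧ ((x - 1, y) ∈ A ∨ (x - 1, y - 1) ∈ A)) ∨
    (z₁ = (x, y - 1) ∧ ((x, y - 1) ∈ A ∨ (x - 1, y - 1) ∈ A)) := by
  obtain ⟨u, v⟩ := z₁
  simp only [Step, Prod.mk_add_mk, Prod.mk_sub_mk, Prod.mk.injEq, add_zero, sub_zero]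
  refine or_congr ⟨?_, ?_⟩ ⟨?_, ?_⟩
  all_goals
    rintro ⟨⟨rfl, rfl⟩, h⟩
    simpa using h

theorem step_iff_left {A : Finset (ℤ × ℤ)} {z₁ : ℤ × ℤ} {x y : ℤ} : Step A (x, y) z₁ ↔
    (z₁ = (x + 1, y) ∧ ((x, y) ∈ A ∨ (x, y - 1) ∈ A)) ∨
    (z₁ = (x, y + 1) ∧ ((x, y) ∈ A ∨ (x - 1, y) ∈ A)) := by
  simp [Step]

theorem Step.incident_left {A : Finset (ℤ × ℤ)} {z z' : ℤ × ℤ} (h : Step A z z') :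
    Incident A z.1 z.2 := by
  obtain ⟨x, y⟩ := z
  rw [step_iff_left] at h
  simp only [Incident, Finset.mem_coe]
  tauto

theorem Step.incident_right {A : Finset (ℤ × ℤ)} {z z' : ℤ × ℤ} (h : Step A z z') :
    Incident A z'.1 z'.2 := by
  obtain ⟨x, y⟩ := z'
  rw [step_iff_right] at h
  simp only [Incident, Finset.mem_coe]
  tauto

/-- The two notions are complementary among the points of the diagram that are not vertices. Corners
with neither the upper right nor the lower left cell have one edge in and one edge out and could be
put in either class; they count as split points for positive abscissa and as merge points otherwise,
in agreement with `anchor`. -/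
theorem mem_or_isSplit_or_isMerge {z : ℤ × ℤ} (h : Incident (cells n r R) z.1 z.2) :
    z ∈ vertices n r R ∨ IsSplit n r R z ∨ IsMerge n r R z := by
  unfold IsSplit IsMerge
  have := lt_or_ge 0 z.1
  tauto

theorem isSplit_of_mem {x y : ℤ} (h : (x, y) ∈ cells n r R) (hV : (x, y) ∉ vertices n r R) :
    IsSplit n r R (x, y) := ⟨hV, .inl h, .inl h⟩

/-- Both halves of a ladder diagram, with the left half rotated. -/
structure IsLadder (n : Fin (ρ + 1) → Fin (ρ + 1) → ℕ) (r : Fin (ρ + 1) → ℕ)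
    (R : Finset (Fin (ρ + 1))) (W H : ℤ) (hgt : ℤ → ℤ) (a : ℤ → ℤ × ℤ) (hgt' : ℤ → ℤ)
    (a' : ℤ → ℤ × ℤ) : Prop where
  W_pos : 0 < W
  H_pos : 0 < H
  right : IsRightHalf (cells n r R) (vertices n r R) W H hgt a
  left : IsRightHalf (rotCells W H (cells n r R)) (rotVertices W H (vertices n r R)) W H hgt' a'

namespace IsLadder

variable {W H : ℤ} {hgt hgt' : ℤ → ℤ} {a a' : ℤ → ℤ × ℤ} (L : IsLadder n r R W H hgt a hgt' a')

include L

theorem pred {z : ℤ × ℤ} (hz : IsSplit n r R z) :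
    ∃ z₀, (∀ z₁, Step (cells n r R) z₁ z ↔ z₁ = z₀) ∧
    (z₀ ∈ vertices n r R ∨ IsSplit n r R z₀) ∧
    contract n r R W H a a' z₀ = contract n r R W H a a' z := by
  have hW := L.W_pos
  obtain ⟨x, y⟩ := z
  obtain ⟨hV, hi, hs⟩ := hz
  rw [contract_of_notMem hV]
  simp only at hi hs
  simp only [step_iff_right]
  rcases lt_or_ge 0 x with hx | hx
  · rcases L.right.split hx hV hi (by simpa [hx] using hs) with
      ⟨rfl, h1, h2, h3⟩ | ⟨hy, h1, h2, h3, h4, h5⟩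
    · simp only [Finset.mem_coe] at h1 h2 h3
      refine ⟨(x - 1, 0), by simpa [h1] using And.intro h2 h3, ?_, ?_⟩
      · by_cases hV' : (x - 1, 0) ∈ vertices n r R
        · exact .inl hV'
        · exact .inr (isSplit_of_mem h1 hV')
      · rcases eq_or_ne x 1 with rfl | hx'
        · have := L.right.zero_mem
          rw [sub_self, contract_of_mem this]
          simp [anchor]
        · rw [contract_of_notMem (L.right.zero_notMem (by omega) (.inl h1))]
          simp [anchor, hx, show 1 < x by omega]
    · simp only [Finset.mem_coe] at h1 h2 h3 h5
      refine ⟨(x, y - 1), by simp [h1, h2, h3], ?_, ?_⟩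
      · by_cases hV' : (x, y - 1) ∈ vertices n r R
        · exact .inl hV'
        · exact .inr (isSplit_of_mem h2 hV')
      · have h6 : anchor W H a a' (x, y) = a x := by simp [anchor, hx, show y ≠ 0 by omega]
        rw [h6]
        exact contract_eq h5 (by simp [anchor, hx, h4])
  · have hA : (x, y) ∈ cells n r R := by
      rcases hs with hs | hs
      · exact hs
      · omega
    -- Rotation reverses edges: a split point of the left half is a merge point of the rotated
    -- diagram, where its abscissa `W - x` is positive.
    have hV' : (W - x, H - y) ∉ rotVertices W H (vertices n r R) := by
      rwa [mem_rotVertices (x := x) (y := y) (by ring) (by ring)]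
    have hA' : (W - x - 1, H - y - 1) ∈ rotCells W H (cells n r R) := by
      rwa [mem_rotCells (x := x) (y := y) (by ring) (by ring)]
    have hn : (W - x, H - y) ∉ rotCells W H (cells n r R) := fun h =>
      hV' (L.left.mem_of_mem (by omega) hA' h)
    have hm := L.left.merge (by omega) hV' hA' hn
    rw [mem_rotCells (u := W - x - 1) (x := x) (y := y - 1) (by ring) (by ring),
      mem_rotCells (u := W - x) (v := H - y - 1) (x := x - 1) (y := y) (by ring) (by ring),
      mem_rotVertices (u := W - x + 1) (x := x - 1) (y := y) (by ring) (by ring),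
      mem_rotVertices (u := W - x) (x := x) (y := y - 1) (by ring) (by ring)] at hm
    rw [mem_rotCells (x := x - 1) (y := y - 1) (by ring) (by ring)] at hn
    simp only [Finset.mem_coe] at hm hn
    obtain ⟨hy, hm⟩ := hm
    have h6 : anchor W H a a' (x, y) = (W, H) - a' (W - x) := by
      simp [anchor, hx.not_gt, show y ≠ H by omega]
    rw [h6]
    rcases hm with ⟨h1, h2, -, h3, h4⟩ | ⟨h1, h2, -, h4⟩
    · refine ⟨(x - 1, y), by simp [h1, h2, hn], ?_, contract_eq (fun h => ?_) ?_⟩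
      · by_cases hV' : (x - 1, y) ∈ vertices n r R
        · exact .inl hV'
        · exact .inr (isSplit_of_mem h2 hV')
      · rw [h4 h]
        ext <;> simp
        ring
      · simp [anchor, show ¬ 1 < x by omega, show y ≠ H by omega, ← h3,
          show W - (x - 1) = W - x + 1 by ring]
    · refine ⟨(x, y - 1), by simp [h1, h2, hn], ?_, contract_eq (fun h => ?_) ?_⟩
      · by_cases hV' : (x, y - 1) ∈ vertices n r R
        · exact .inl hV'
        · exact .inr (isSplit_of_mem h1 hV')
      · rw [h4 h]
        ext <;> simp
        ring
      · simp [anchor, hx.not_gt, show y - 1 ≠ H by omega]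

theorem succ {z : ℤ × ℤ} (hz : IsMerge n r R z) :
    ∃ z₀, (∀ z₁, Step (cells n r R) z z₁ ↔ z₁ = z₀) ∧
    (z₀ ∈ vertices n r R ∨ IsMerge n r R z₀) ∧
    contract n r R W H a a' z₀ = contract n r R W H a a' z := by
  have hW := L.W_pos
  obtain ⟨x, y⟩ := z
  obtain ⟨hV, hi, hA, hs⟩ := hz
  rw [contract_of_notMem hV]
  simp only at hi hs
  simp only [step_iff_left]
  rcases lt_or_ge 0 x with hx | hx
  · have hl : (x - 1, y - 1) ∈ cells n r R := hs.resolve_left hx.not_ge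
    obtain ⟨hy, hm⟩ := L.right.merge hx hV hl hA
    simp only [Finset.mem_coe] at hm
    have h6 : anchor W H a a' (x, y) = a x := by simp [anchor, hx, show y ≠ 0 by omega]
    rw [h6]
    rcases hm with ⟨h1, h2, h3, h4, h5⟩ | ⟨h1, h2, h3, h4⟩
    · refine ⟨(x + 1, y), by simp [hA, h1, h2], ?_, contract_eq h5 ?_⟩
      · by_cases hV' : (x + 1, y) ∈ vertices n r R
        · exact .inl hV'
        · exact .inr ⟨hV', by simp [Incident, h2], h3 hV', by simp [h2]⟩
      · simp [anchor, show 0 < x + 1 by omega, show y ≠ 0 by omega, h4]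
    · refine ⟨(x, y + 1), by simp [hA, h1, h2], ?_, contract_eq h4 ?_⟩
      · by_cases hV' : (x, y + 1) ∈ vertices n r R
        · exact .inl hV'
        · exact .inr ⟨hV', by simp [Incident, h1], h3 hV', by simp [h1]⟩
      · simp [anchor, hx, show y + 1 ≠ 0 by omega]
  · have hV' : (W - x, H - y) ∉ rotVertices W H (vertices n r R) := by
      rwa [mem_rotVertices (x := x) (y := y) (by ring) (by ring)]
    have hA' : (W - x - 1, H - y - 1) ∉ rotCells W H (cells n r R) := by
      rwa [mem_rotCells (x := x) (y := y) (by ring) (by ring)]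
    have hi' : Incident (rotCells W H (cells n r R)) (W - x) (H - y) := by
      unfold Incident
      rw [mem_rotCells (x := x - 1) (y := y - 1) (by ring) (by ring),
        mem_rotCells (x := x) (y := y - 1) (by ring) (by ring),
        mem_rotCells (x := x - 1) (y := y) (by ring) (by ring),
        mem_rotCells (x := x) (y := y) (by ring) (by ring)]
      unfold Incident at hi
      tauto
    have hm := L.left.split (by omega) hV' hi' (.inr hA')
    rcases hm with ⟨hy, h1, h2, -⟩ | ⟨hy, h1, h2, h3, h4, h5⟩
    · rw [mem_rotCells (x := x) (y := y - 1) (by ring) (by ring)] at h1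
      rw [mem_rotCells (x := x - 1) (y := y) (by ring) (by ring)] at h2
      simp only [Finset.mem_coe] at h1 h2
      obtain rfl : y = H := by omega
      have h6 : anchor W y a a' (x, y) = (W, y) := by simp [anchor, hx.not_gt]
      rw [h6]
      refine ⟨(x + 1, y), by simp [hA, h1, h2], ?_, ?_⟩
      · by_cases hV' : (x + 1, y) ∈ vertices n r R
        · exact .inl hV'
        · refine .inr ⟨hV', by simp [Incident, h1], ?_, by simp [h1]⟩
          -- For `x = 0` the successor `(1, H)` already belongs to the right half, so the rotated
          -- diagram says nothing about it and `corner` is needed.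
          rcases eq_or_ne x 0 with rfl | hx0
          · exact (L.right.corner hW L.H_pos).2.1 hV'
          · intro h
            have h' : (W - x - 1 - 1, (-1 : ℤ)) ∈ rotCells W y (cells n r R) := by
              rwa [mem_rotCells (x := x + 1) (y := y) (by ring) (by ring)]
            rw [L.left.mem_iff _ _ (by omega)] at h'
            omega
      · rcases eq_or_ne x 0 with rfl | hx0
        · exact contract_eq (L.right.corner hW L.H_pos).2.2
            (by simp [anchor, L.H_pos.ne', L.right.a_eq 1 one_pos hW])
        · refine contract_eq (fun h => ?_) (by simp [anchor, show ¬ 0 < x + 1 by omega])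
          have h' : (W - x - 1, (0 : ℤ)) ∈ rotVertices W y (vertices n r R) := by
            rwa [mem_rotVertices (x := x + 1) (y := y) (by ring) (by ring)]
          refine absurd h' (L.left.zero_notMem (by omega) (.inl ?_))
          rwa [mem_rotCells (x := x) (y := y - 1) (by ring) (by ring)]
    · have hd : (W - x, H - y - 1) ∉ rotVertices W H (vertices n r R) →
          (W - x - 1, H - y - 1 - 1) ∉ rotCells W H (cells n r R) := fun h h' =>
        h (L.left.mem_of_mem (by omega) h' h2)
      rw [mem_rotVertices (x := x) (y := y + 1) (by ring) (by ring)] at hd h5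
      rw [mem_rotCells (x := x) (y := y + 1) (by ring) (by ring)] at hd
      rw [mem_rotCells (x := x) (y := y - 1) (by ring) (by ring)] at h1
      rw [mem_rotCells (x := x - 1) (y := y) (by ring) (by ring)] at h2
      simp only [Finset.mem_coe] at h1 h2 h5 hd
      have h6 : anchor W H a a' (x, y) = (W, H) - a' (W - x) := by
        simp [anchor, hx.not_gt, show y ≠ H by omega]
      rw [h6]
      refine ⟨(x, y + 1), by simp [hA, h1, h2], ?_, contract_eq (fun h => ?_) ?_⟩
      · by_cases hV' : (x, y + 1) ∈ vertices n r R
        · exact .inl hV'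
        · exact .inr ⟨hV', by simp [Incident, h2], hd hV', .inl hx⟩
      · rw [h5 h]
        ext <;> simp
        ring
      · simp [anchor, hx.not_gt, show y + 1 ≠ H by omega]

theorem isContraction : IsContraction n r R (IsSplit n r R) (IsMerge n r R)
    (contract n r R W H a a') where
  cases_left h := mem_or_isSplit_or_isMerge h.incident_left
  cases_right h := mem_or_isSplit_or_isMerge h.incident_right
  sp_notMem h := h.1
  mg_notMem h := h.1
  not_mg {z} h h' := by
    rcases h.2.2 with h1 | ⟨h1, h2⟩
    · exact h'.2.2.1 h1
    · exact h'.2.2.2.elim h1.not_ge h2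
  of_mem h := contract_of_mem h
  pred := L.pred
  succ := L.succ

end IsLadder

end YShaped

/-! ### Sums of differences over the edges of the diagram -/

namespace YShaped

/-- The left ends of the horizontal edges of a set of cells. -/
def horizontal (A : Finset (ℤ × ℤ)) : Finset (ℤ × ℤ) := A ∪ A.image fun p => p + (0, 1)

/-- The lower ends of the vertical edges of a set of cells. -/
def vertical (A : Finset (ℤ × ℤ)) : Finset (ℤ × ℤ) := A ∪ A.image fun p => p + (1, 0)

theorem mem_horizontal {A : Finset (ℤ × ℤ)} {p : ℤ × ℤ} :
    p ∈ horizontal A ↔ p ∈ A ∨ p - (0, 1) ∈ A := by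
  simp only [horizontal, Finset.mem_union, Finset.mem_image]
  refine or_congr Iff.rfl ⟨?_, fun h => ⟨_, h, sub_add_cancel _ _⟩⟩
  rintro ⟨c, hc, rfl⟩
  rwa [add_sub_cancel_right]

theorem mem_vertical {A : Finset (ℤ × ℤ)} {p : ℤ × ℤ} :
    p ∈ vertical A ↔ p ∈ A ∨ p - (1, 0) ∈ A := by
  simp only [vertical, Finset.mem_union, Finset.mem_image]
  refine or_congr Iff.rfl ⟨?_, fun h => ⟨_, h, sub_add_cancel _ _⟩⟩
  rintro ⟨c, hc, rfl⟩
  rwa [add_sub_cancel_right]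

/-- The sum over all edges of a set of cells of the differences of a function at their ends. -/
def edgeSum (A : Finset (ℤ × ℤ)) (g : ℤ × ℤ → ℤ) : ℤ :=
  ∑ p ∈ horizontal A, (g (p + (1, 0)) - g p) + ∑ p ∈ vertical A, (g (p + (0, 1)) - g p)

/-- The edges of a set of cells. -/
def edges (A : Finset (ℤ × ℤ)) : Finset ((ℤ × ℤ) × (ℤ × ℤ)) :=
  (horizontal A).image (fun p => (p, p + (1, 0))) ∪ (vertical A).image fun p => (p, p + (0, 1))

theorem mem_edges {A : Finset (ℤ × ℤ)} {e : (ℤ × ℤ) × (ℤ × ℤ)} :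
    e ∈ edges A ↔ Step A e.1 e.2 := by
  obtain ⟨z, z'⟩ := e
  simp only [edges, Finset.mem_union, Finset.mem_image, mem_horizontal, mem_vertical, Step,
    Prod.mk.injEq]
  refine or_congr ⟨?_, fun h => ⟨z, h.2, rfl, h.1.symm⟩⟩ ⟨?_, fun h => ⟨z, h.2, rfl, h.1.symm⟩⟩
  all_goals
    rintro ⟨_, h, rfl, rfl⟩
    exact ⟨rfl, h⟩

theorem sum_edges (A : Finset (ℤ × ℤ)) (g : ℤ × ℤ → ℤ) :
    ∑ e ∈ edges A, (g e.2 - g e.1) = edgeSum A g := by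
  rw [edges, Finset.sum_union, Finset.sum_image, Finset.sum_image]
  · rfl
  · exact fun p _ q _ h => (Prod.mk.inj h).1
  · exact fun p _ q _ h => (Prod.mk.inj h).1
  · rw [Finset.disjoint_left]
    intro e h h'
    rw [Finset.mem_image] at h h'
    obtain ⟨p, -, rfl⟩ := h
    obtain ⟨q, -, h⟩ := h'
    rw [Prod.mk.injEq] at h
    obtain ⟨rfl, h⟩ := h
    have := congrArg Prod.fst h
    simp at this

theorem sum_shift {S T : Finset (ℤ × ℤ)} {d : ℤ × ℤ} (h : ∀ p ∈ T, p + d ∈ S) (g : ℤ × ℤ → ℤ) :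
    ∑ p ∈ T, g (p + d) = ∑ z ∈ S, if z - d ∈ T then g z else 0 := by
  rw [← Finset.sum_filter]
  refine Finset.sum_nbij' (fun p => p + d) (fun z => z - d) ?_ ?_ ?_ ?_ ?_
  · intro p hp
    rw [Finset.mem_filter, add_sub_cancel_right]
    exact ⟨h p hp, hp⟩
  · intro z hz
    exact (Finset.mem_filter.1 hz).2
  · exact fun p _ => add_sub_cancel_right _ _
  · exact fun z _ => sub_add_cancel _ _
  · exact fun p _ => rfl

/-- The sum over all edges vanishes if all lattice points where the function is not zero have edges
in all four directions. -/
theorem edgeSum_eq_zero {A : Finset (ℤ × ℤ)} {g : ℤ × ℤ → ℤ}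
    (h : ∀ z, g z ≠ 0 → z ∈ horizontal A ∧ z ∈ vertical A ∧ z - (1, 0) ∈ horizontal A ∧
      z - (0, 1) ∈ vertical A) : edgeSum A g = 0 := by
  let S := (horizontal A ∪ (horizontal A).image fun p => p + (1, 0)) ∪
    (vertical A ∪ (vertical A).image fun p => p + (0, 1))
  have h1 := sum_shift (S := S) (T := horizontal A) (d := (1, 0)) (fun p hp =>
    Finset.mem_union_left _ (Finset.mem_union_right _ (Finset.mem_image_of_mem _ hp))) g
  have h2 := sum_shift (S := S) (T := horizontal A) (d := 0) (fun p hp => by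
    rw [add_zero]
    exact Finset.mem_union_left _ (Finset.mem_union_left _ hp)) g
  have h3 := sum_shift (S := S) (T := vertical A) (d := (0, 1)) (fun p hp =>
    Finset.mem_union_right _ (Finset.mem_union_right _ (Finset.mem_image_of_mem _ hp))) g
  have h4 := sum_shift (S := S) (T := vertical A) (d := 0) (fun p hp => by
    rw [add_zero]
    exact Finset.mem_union_right _ (Finset.mem_union_left _ hp)) g
  simp only [add_zero, sub_zero] at h2 h4
  rw [edgeSum, Finset.sum_sub_distrib, Finset.sum_sub_distrib, h1, h2, h3, h4,
    ← Finset.sum_sub_distrib, ← Finset.sum_sub_distrib, ← Finset.sum_add_distrib]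
  refine Finset.sum_eq_zero fun z _ => ?_
  by_cases hz : g z = 0
  · simp [hz]
  · obtain ⟨h1, h2, h3, h4⟩ := h z hz
    simp [h1, h2, h3, h4]

/-- At a point with edges in all four directions two edges end and two begin, so the value of the
function there cancels. -/
theorem edgeSum_congr {A : Finset (ℤ × ℤ)} {g g' : ℤ × ℤ → ℤ}
    (h : ∀ z, g z ≠ g' z → z ∈ horizontal A ∧ z ∈ vertical A ∧ z - (1, 0) ∈ horizontal A ∧
      z - (0, 1) ∈ vertical A) : edgeSum A g = edgeSum A g' := by
  have := edgeSum_eq_zero (A := A) (g := fun z => g z - g' z) fun z hz => h z (sub_ne_zero.1 hz)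
  rw [← sub_eq_zero, ← this]
  simp only [edgeSum, Finset.sum_sub_distrib]
  ring

variable {ρ : ℕ} {n : Fin (ρ + 1) → Fin (ρ + 1) → ℕ} {r : Fin (ρ + 1) → ℕ}
  {R : Finset (Fin (ρ + 1))}

/-- Arrows are transverse edges, and every other edge has both ends contracted to the same vertex
and contributes nothing. -/
theorem IsContraction.sum_arrows {sp mg : ℤ × ℤ → Prop} {φ : ℤ × ℤ → ℤ × ℤ}
    (C : IsContraction n r R sp mg φ) [Fintype (Quiver.Total (Vertex n r R))] (f : ℤ × ℤ → ℤ) :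
    ∑ a : Quiver.Total (Vertex n r R), (f a.right.1 - f a.left.1) =
      edgeSum (cells n r R) fun z => f (φ z) := by
  classical
  obtain ⟨E, hE⟩ := C.exists_equiv
  rw [← sum_edges]
  have hT : ∀ e : (ℤ × ℤ) × (ℤ × ℤ), e ∈ (edges (cells n r R)).filter
      (fun e => Transverse n r R sp mg e.1 e.2) ↔ Transverse n r R sp mg e.1 e.2 := fun e => by
    rw [Finset.mem_filter, mem_edges]
    exact ⟨fun h => h.2, fun h => ⟨h.1, h⟩⟩
  have hsum := Finset.sum_subset (Finset.filter_subset
    (fun e : (ℤ × ℤ) × (ℤ × ℤ) => Transverse n r R sp mg e.1 e.2) (edges (cells n r R)))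
    (f := fun e => f (φ e.2) - f (φ e.1)) fun e he he' => by
      rw [hT] at he'
      rw [C.eq_of_not_transverse (mem_edges.1 he) he', sub_self]
  rw [← hsum]
  symm
  refine Finset.sum_bij (fun e he => E ⟨e, (hT e).1 he⟩) (fun _ _ => Finset.mem_univ _) ?_ ?_ ?_
  · intro e he e' he' h
    exact congrArg Subtype.val (E.injective h)
  · intro a _
    exact ⟨(E.symm a).1, (hT _).2 (E.symm a).2, E.apply_symm_apply a⟩
  · intro e he
    rw [(hE _).1, (hE _).2]

/-- The two functions differ only at vertices that are not corners of blocks, and these have edges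
in all four directions. This is how the interior vertices disappear from the anticanonical class. -/
theorem IsLadder.edgeSum_contract {W H : ℤ} {hgt hgt' : ℤ → ℤ} {a a' : ℤ → ℤ × ℤ}
    (L : IsLadder n r R W H hgt a hgt' a') (f : ℤ × ℤ → ℤ) :
    edgeSum (cells n r R) (fun z => f (contract n r R W H a a' z)) =
      edgeSum (cells n r R) fun z => f (anchor W H a a' z) := by
  refine edgeSum_congr fun z hz => ?_
  have hV : z ∈ vertices n r R := by
    by_contra h
    rw [contract_of_notMem h] at hz
    exact hz rfl
  rw [contract_of_mem hV] at hz
  obtain ⟨x, y⟩ := z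
  simp only [mem_horizontal, mem_vertical, Prod.mk_sub_mk, sub_zero]
  have hW := L.W_pos
  rcases lt_or_ge 0 x with hx | hx
  · rcases L.right.vertex hx hV with ⟨h, h'⟩ | h
    · simp [anchor, hx, h, h'] at hz
    · exact h
  · have hV' : (W - x, H - y) ∈ rotVertices W H (vertices n r R) := by
      rwa [mem_rotVertices (x := x) (y := y) (by ring) (by ring)]
    rcases L.left.vertex (by omega) hV' with ⟨h, h'⟩ | h
    · simp [anchor, hx.not_gt, h', show y ≠ H by omega] at hz
    · rw [mem_rotCells (x := x - 1) (y := y - 1) (by ring) (by ring),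
        mem_rotCells (x := x - 1) (y := y) (by ring) (by ring),
        mem_rotCells (x := x) (y := y - 1) (by ring) (by ring),
        mem_rotCells (x := x) (y := y) (by ring) (by ring)] at h
      simp only [Finset.mem_coe] at h
      tauto

end YShaped

/-! ### Edge sums along a leg -/

namespace YShaped

/-- A leg with set of vertices `s` and first vertex `o`: the block of `i` consists of the columns
from `q i` to `w i`, which have height `h i`, and follows the block of `p i`. -/
structure IsLeg {ι : Type} (s : Finset ι) (o : ι) (p : ι → ι) (q w h : ι → ℤ) : Prop where
  mem : o ∈ s
  q_zero : q o = 0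
  p_mem : ∀ i ∈ s, i ≠ o → p i ∈ s
  q_eq : ∀ i ∈ s, i ≠ o → q i = w (p i)
  lt : ∀ i ∈ s, q i < w i
  pos : ∀ i ∈ s, 0 < h i
  le : ∀ i ∈ s, i ≠ o → w o ≤ q i
  disj : ∀ i ∈ s, ∀ j ∈ s, i ≠ j → w i ≤ q j ∨ w j ≤ q i

namespace IsLeg

variable {ι : Type} [DecidableEq ι] {s : Finset ι} {o : ι} {p : ι → ι}
  {q w h : ι → ℤ} (G : IsLeg s o p q w h)

include G

omit [DecidableEq ι] in
theorem eq_of_lt {i j : ι} (hi : i ∈ s) (hj : j ∈ s) (h1 : q i < w j) (h2 : q j < w i) :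
    i = j := by
  by_contra hne
  rcases G.disj i hi j hj hne with h | h <;> omega

/-- Off the bottom row `g` is constant on each block, so only the edges that leave the wall between
the blocks of `p i` and `i` count. There are `h i` of them, at heights `1` to `h i`. -/
theorem sum_horizontal {g : ℤ × ℤ → ℤ} {α : ℤ} {f : ι → ℤ} {T : Finset (ℤ × ℤ)}
    (hg : ∀ x, w o ≤ x → g (x, 0) = α)
    (hf : ∀ i ∈ s, ∀ x y, q i < x → x ≤ w i → w o ≤ x → y ≠ 0 → g (x, y) = f i)
    (hT : ∀ x y, (x, y) ∈ T ↔ w o ≤ x ∧ ∃ i ∈ s, q i ≤ x ∧ x < w i ∧ 0 ≤ y ∧ y ≤ h i) :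
    ∑ z ∈ T, (g (z + (1, 0)) - g z) = ∑ i ∈ s.erase o, h i * (f i - f (p i)) := by
  have hterm (i) (hi : i ∈ s.erase o) :
      h i * (f i - f (p i)) = ∑ _y ∈ Finset.Icc 1 (h i), (f i - f (p i)) := by
    have := G.pos i (Finset.mem_of_mem_erase hi)
    rw [Finset.sum_const, Int.card_Icc, nsmul_eq_mul]
    congr 1
    omega
  rw [Finset.sum_congr rfl hterm, Finset.sum_sigma']
  have key : ∀ i ∈ s, i ≠ o → ∀ y, y ≠ 0 → g ((q i, y) + (1, 0)) - g (q i, y) = f i - f (p i) := by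
    intro i hi hio y hy
    have h1 := G.le i hi hio
    have h2 := G.lt i hi
    have h3 := G.lt _ (G.p_mem i hi hio)
    have h4 := G.q_eq i hi hio
    rw [Prod.mk_add_mk, hf i hi _ _ (by omega) (by omega) (by omega) (by omega),
      hf (p i) (G.p_mem i hi hio) _ _ (by omega) (by omega) (by omega) (by omega)]
  symm
  refine Finset.sum_of_injOn (fun c => (q c.1, c.2)) ?_ ?_ ?_ ?_
  · rintro ⟨i, y⟩ hi ⟨j, y'⟩ hj he
    simp only [Finset.coe_sigma, Set.mem_sigma_iff, Finset.mem_coe, Finset.mem_erase,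
      Prod.mk.injEq] at hi hj he
    have h1 := G.lt i hi.1.2
    have h2 := G.lt j hj.1.2
    obtain rfl := G.eq_of_lt hi.1.2 hj.1.2 (by omega) (by omega)
    rw [he.2]
  · rintro ⟨i, y⟩ hi
    simp only [Finset.coe_sigma, Set.mem_sigma_iff, Finset.mem_coe, Finset.mem_erase,
      Finset.mem_Icc] at hi
    have h1 := G.lt i hi.1.2
    change (q i, y) ∈ T
    rw [hT]
    exact ⟨G.le i hi.1.2 hi.1.1, i, hi.1.2, le_rfl, h1, by omega, by omega⟩
  · rintro ⟨x, y⟩ hz hn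
    obtain ⟨hx, i, hi, h1, h2, h3, h4⟩ := (hT x y).1 hz
    rcases eq_or_ne y 0 with rfl | hy
    · rw [Prod.mk_add_mk, add_zero, hg _ hx, hg _ (by omega), sub_self]
    · rcases h1.eq_or_lt with rfl | h1
      · refine absurd ⟨⟨i, y⟩, ?_, rfl⟩ hn
        simp only [Finset.coe_sigma, Set.mem_sigma_iff, Finset.mem_coe, Finset.mem_erase,
          Finset.mem_Icc]
        refine ⟨⟨?_, hi⟩, by omega, by omega⟩
        rintro rfl
        omega
      · rw [Prod.mk_add_mk, hf i hi _ _ (by omega) (by omega) (by omega) (by omega),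
          hf i hi _ _ (by omega) (by omega) (by omega) (by omega), sub_self]
  · rintro ⟨i, y⟩ hi
    simp only [Finset.mem_sigma, Finset.mem_erase, Finset.mem_Icc] at hi
    exact (key i hi.1.2 hi.1.1 y (by omega)).symm

/-- Only the lowest edge of each vertical line counts, as `g` is constant above the bottom row. Of
the first block only the line `x = w o` lies in the range. -/
theorem sum_vertical {g : ℤ × ℤ → ℤ} {α : ℤ} {f : ι → ℤ} {T : Finset (ℤ × ℤ)}
    (hg : ∀ x, w o ≤ x → g (x, 0) = α) (hw : 0 < w o)
    (hf : ∀ i ∈ s, ∀ x y, q i < x → x ≤ w i → w o ≤ x → y ≠ 0 → g (x, y) = f i)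
    (hT : ∀ x y, (x, y) ∈ T ↔ w o ≤ x ∧ ((∃ i ∈ s, q i ≤ x ∧ x < w i ∧ 0 ≤ y ∧ y < h i) ∨
      ∃ i ∈ s, q i < x ∧ x ≤ w i ∧ 0 ≤ y ∧ y < h i)) :
    ∑ z ∈ T, (g (z + (0, 1)) - g z) =
      (f o - α) + ∑ i ∈ s.erase o, (w i - q i) * (f i - α) := by
  -- The maximum treats all blocks alike: it is `q i` for `i ≠ o`, and `w o - 1` for the first
  -- block, of which only one line remains.
  have hterm (i) (hi : i ∈ s.erase o) :
      (w i - q i) * (f i - α) = ∑ _x ∈ Finset.Ioc (max (q i) (w o - 1)) (w i), (f i - α) := by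
    rw [Finset.mem_erase] at hi
    have := G.lt i hi.2
    have := G.le i hi.2 hi.1
    rw [Finset.sum_const, Int.card_Ioc, nsmul_eq_mul, max_eq_left (by omega)]
    congr 1
    omega
  have hterm' : f o - α = ∑ _x ∈ Finset.Ioc (max (q o) (w o - 1)) (w o), (f o - α) := by
    have := G.q_zero
    rw [Finset.sum_const, Int.card_Ioc, nsmul_eq_mul, max_eq_right (by omega)]
    norm_num
  -- A wall between two blocks is assigned to the block on its left.
  have hcover {x y : ℤ} (hx : w o ≤ x) (h : (∃ i ∈ s, q i ≤ x ∧ x < w i ∧ 0 ≤ y ∧ y < h i) ∨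
      ∃ i ∈ s, q i < x ∧ x ≤ w i ∧ 0 ≤ y ∧ y < h i) :
      0 ≤ y ∧ ∃ i ∈ s, q i < x ∧ x ≤ w i := by
    rcases h with ⟨i, hi, h1, h2, h3, -⟩ | ⟨i, hi, h1, h2, h3, -⟩
    · refine ⟨h3, ?_⟩
      rcases h1.eq_or_lt with rfl | h1
      · have hio : i ≠ o := by
          rintro rfl
          omega
        have h4 := G.lt _ (G.p_mem i hi hio)
        have h5 := G.q_eq i hi hio
        exact ⟨p i, G.p_mem i hi hio, by omega, by omega⟩
      · exact ⟨i, hi, h1, h2.le⟩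
    · exact ⟨h3, i, hi, h1, h2⟩
  rw [Finset.sum_congr rfl hterm]
  have hs : (∑ _x ∈ Finset.Ioc (max (q o) (w o - 1)) (w o), (f o - α)) +
      ∑ i ∈ s.erase o, ∑ _x ∈ Finset.Ioc (max (q i) (w o - 1)) (w i), (f i - α) =
      ∑ i ∈ s, ∑ _x ∈ Finset.Ioc (max (q i) (w o - 1)) (w i), (f i - α) := by
    rw [Finset.add_sum_erase s
      (fun i => ∑ _x ∈ Finset.Ioc (max (q i) (w o - 1)) (w i), (f i - α)) G.mem]
  rw [hterm', hs, Finset.sum_sigma']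
  symm
  refine Finset.sum_of_injOn (fun c => (c.2, 0)) ?_ ?_ ?_ ?_
  · rintro ⟨i, x⟩ hi ⟨j, x'⟩ hj he
    simp only [Finset.coe_sigma, Set.mem_sigma_iff, Finset.mem_coe, Finset.mem_Ioc,
      Prod.mk.injEq] at hi hj he
    obtain rfl := he.1
    obtain rfl := G.eq_of_lt hi.1 hj.1 (by omega) (by omega)
    rfl
  · rintro ⟨i, x⟩ hi
    simp only [Finset.coe_sigma, Set.mem_sigma_iff, Finset.mem_coe, Finset.mem_Ioc] at hi
    change (x, (0 : ℤ)) ∈ T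
    rw [hT]
    exact ⟨by omega, .inr ⟨i, hi.1, by omega, by omega, le_rfl, G.pos i hi.1⟩⟩
  · rintro ⟨x, y⟩ hz hn
    obtain ⟨hx, hz⟩ := (hT x y).1 hz
    obtain ⟨hy, i, hi, h1, h2⟩ := hcover hx hz
    rcases eq_or_ne y 0 with rfl | hy'
    · refine absurd ⟨⟨i, x⟩, ?_, rfl⟩ hn
      simp only [Finset.coe_sigma, Set.mem_sigma_iff, Finset.mem_coe, Finset.mem_Ioc]
      exact ⟨hi, by omega, h2⟩
    · rw [Prod.mk_add_mk, hf i hi _ _ (by omega) (by omega) (by omega) (by omega),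
          hf i hi _ _ (by omega) (by omega) (by omega) (by omega), sub_self]
  · rintro ⟨i, x⟩ hi
    simp only [Finset.mem_sigma, Finset.mem_Ioc] at hi
    change _ = g ((x, 0) + (0, 1)) - g (x, 0)
    rw [Prod.mk_add_mk, add_zero, hg _ (by omega),
      hf i hi.1 _ _ (by omega) (by omega) (by omega) (by omega)]

end IsLeg

end YShaped

/-! ### The two legs form a ladder diagram -/

namespace YShaped

variable {ρ : ℕ} {n : Fin (ρ + 1) → Fin (ρ + 1) → ℕ} {r : Fin (ρ + 1) → ℕ}

theorem mem_legCells {s : Finset (Fin (ρ + 1))} {x y : ℤ} : (x, y) ∈ legCells n r s ↔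
    ∃ i ∈ s, prevWidth n r i ≤ x ∧ x < width n r i ∧ 0 ≤ y ∧ y < r i := by
  simp only [legCells, Finset.mem_biUnion, Finset.mem_product, Finset.mem_Ico, and_assoc]

theorem mem_legVertices {s : Finset (Fin (ρ + 1))} {x y : ℤ} : (x, y) ∈ legVertices n r s ↔
    (x, y) = (0, 0) ∨
    ((x, y) ∈ legCells n r s ∧ (x - 1, y) ∈ legCells n r s ∧ (x, y - 1) ∈ legCells n r s ∧
      (x - 1, y - 1) ∈ legCells n r s) ∨
    (∃ i ∈ s, x = width n r i ∧ y = r i) ∨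
    ∃ i ∈ s, r i ≤ prevHeight n r i ∧ x = prevWidth n r i ∧ y = r i := by
  simp only [legVertices, Finset.mem_union, Finset.mem_singleton, Finset.mem_filter,
    Finset.mem_image, Prod.mk.injEq, Prod.mk_sub_mk, sub_zero, or_assoc, and_assoc]
  refine or_congr Iff.rfl (or_congr Iff.rfl (or_congr ?_ ?_))
  · exact exists_congr fun i => and_congr Iff.rfl (and_congr eq_comm eq_comm)
  · exact exists_congr fun i => and_congr Iff.rfl (and_congr Iff.rfl (and_congr eq_comm eq_comm))

/-- The leg with set of vertices `s`, where `p` is the preceding vertex. -/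
structure IsLegOf (n : Fin (ρ + 1) → Fin (ρ + 1) → ℕ) (r : Fin (ρ + 1) → ℕ)
    (s : Finset (Fin (ρ + 1))) (p : Fin (ρ + 1) → Fin (ρ + 1)) : Prop where
  isLeg : IsLeg s 1 p (prevWidth n r) (width n r) fun i => (r i : ℤ)
  prevHeight_one : prevHeight n r 1 = 0
  prevHeight_eq : ∀ i ∈ s, i ≠ 1 → prevHeight n r i = r (p i)

open Classical in
/-- The height of the column of a leg that begins at `x`. -/
noncomputable def legHeight (n : Fin (ρ + 1) → Fin (ρ + 1) → ℕ) (r : Fin (ρ + 1) → ℕ)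
    (s : Finset (Fin (ρ + 1))) (x : ℤ) : ℤ :=
  if h : ∃ i ∈ s, prevWidth n r i ≤ x ∧ x < width n r i then r h.choose else 0

open Classical in
/-- The upper right corner of the block of a leg that contains the column that ends at `x`. -/
noncomputable def legCorner (n : Fin (ρ + 1) → Fin (ρ + 1) → ℕ) (r : Fin (ρ + 1) → ℕ)
    (s : Finset (Fin (ρ + 1))) (x : ℤ) : ℤ × ℤ :=
  if h : ∃ i ∈ s, prevWidth n r i < x ∧ x ≤ width n r i then
    (width n r h.choose, (r h.choose : ℤ)) else 0

namespace IsLegOf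

variable {s : Finset (Fin (ρ + 1))} {p : Fin (ρ + 1) → Fin (ρ + 1)} (G : IsLegOf n r s p)

include G

theorem legHeight_eq {i : Fin (ρ + 1)} (hi : i ∈ s) {x : ℤ} (h1 : prevWidth n r i ≤ x)
    (h2 : x < width n r i) : legHeight n r s x = r i := by
  have h : ∃ i ∈ s, prevWidth n r i ≤ x ∧ x < width n r i := ⟨i, hi, h1, h2⟩
  rw [legHeight, dif_pos h]
  obtain ⟨hs, h3, h4⟩ := h.choose_spec
  rw [G.isLeg.eq_of_lt hs hi (by omega) (by omega)]

theorem legCorner_eq {i : Fin (ρ + 1)} (hi : i ∈ s) {x : ℤ} (h1 : prevWidth n r i < x)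
    (h2 : x ≤ width n r i) : legCorner n r s x = (width n r i, (r i : ℤ)) := by
  have h : ∃ i ∈ s, prevWidth n r i < x ∧ x ≤ width n r i := ⟨i, hi, h1, h2⟩
  rw [legCorner, dif_pos h]
  obtain ⟨hs, h3, h4⟩ := h.choose_spec
  rw [G.isLeg.eq_of_lt hs hi (by omega) (by omega)]

omit G in
theorem legHeight_eq_zero {x : ℤ} (h : ¬ ∃ i ∈ s, prevWidth n r i ≤ x ∧ x < width n r i) :
    legHeight n r s x = 0 := dif_neg h

theorem mem_legCells_iff {x y : ℤ} :
    (x, y) ∈ legCells n r s ↔ 0 ≤ y ∧ y < legHeight n r s x := by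
  rw [mem_legCells]
  by_cases h : ∃ i ∈ s, prevWidth n r i ≤ x ∧ x < width n r i
  · obtain ⟨i, hi, h1, h2⟩ := h
    rw [G.legHeight_eq hi h1 h2]
    refine ⟨?_, fun h => ⟨i, hi, h1, h2, h⟩⟩
    rintro ⟨j, hj, h3, h4, h5⟩
    rwa [G.isLeg.eq_of_lt hj hi (by omega) (by omega)] at h5
  · rw [legHeight_eq_zero h]
    refine ⟨?_, fun h => by omega⟩
    rintro ⟨j, hj, h3, h4, h5⟩
    exact absurd ⟨j, hj, h3, h4⟩ h

theorem width_one_pos : 0 < width n r 1 := by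
  have h := G.isLeg.lt 1 G.isLeg.mem
  rwa [G.isLeg.q_zero] at h

theorem eq_one {i : Fin (ρ + 1)} (hi : i ∈ s) (h : prevWidth n r i < width n r 1) : i = 1 := by
  by_contra hne
  exact absurd (G.isLeg.le i hi hne) h.not_ge

/-- In the right half-plane, the rotated second leg adds nothing to the first leg. -/
theorem mem_cells_iff {s' : Finset (Fin (ρ + 1))} {p' : Fin (ρ + 1) → Fin (ρ + 1)}
    (G' : IsLegOf n r s' p') {x y : ℤ} (hx : 0 ≤ x) :
    (x, y) ∈ (legCells n r s : Set (ℤ × ℤ)) ∪ rotCells (width n r 1) (r 1) (legCells n r s') ↔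
      (x, y) ∈ legCells n r s := by
  refine ⟨?_, fun h => .inl h⟩
  rintro (h | h)
  · exact h
  · change (_, _) ∈ legCells n r s' at h
    rw [mem_legCells] at h
    obtain ⟨i, hi, h1, h2, h3, h4⟩ := h
    obtain rfl := G'.eq_one hi (by omega)
    have := G.isLeg.q_zero
    have := G'.isLeg.q_zero
    rw [mem_legCells]
    exact ⟨1, G.isLeg.mem, by omega, by omega, by omega, by omega⟩

/-- To the right of the `y`-axis only the first block of the rotated leg matters, and the two legs
share it: the rotated origin is `v_1`, interior points stay interior, and the rotated external
vertex of `1` is the origin, which `0 < x` excludes. -/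
theorem mem_vertices_iff {s' : Finset (Fin (ρ + 1))} {p' : Fin (ρ + 1) → Fin (ρ + 1)}
    (G' : IsLegOf n r s' p') {x y : ℤ} (hx : 0 < x) :
    (x, y) ∈ (legVertices n r s : Set (ℤ × ℤ)) ∪
      rotVertices (width n r 1) (r 1) (legVertices n r s') ↔ (x, y) ∈ legVertices n r s := by
  refine ⟨?_, fun h => .inl h⟩
  rintro (h | h)
  · exact h
  · change (_, _) ∈ legVertices n r s' at h
    rw [mem_legVertices] at h ⊢
    have h0 := G.isLeg.q_zero
    rcases h with h | ⟨h1, -, -, h2⟩ | ⟨i, hi, h1, h2⟩ | ⟨i, hi, h1, h2, h3⟩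
    · rw [Prod.mk.injEq] at h
      simp only at h
      exact .inr (.inr (.inl ⟨1, G.isLeg.mem, by omega, by omega⟩))
    · rw [mem_legCells] at h1 h2
      obtain ⟨i, hi, h1⟩ := h1
      obtain ⟨j, hj, h2⟩ := h2
      simp only at h1 h2
      obtain rfl := G'.eq_one hi (by omega)
      obtain rfl := G'.eq_one hj (by omega)
      simp only [mem_legCells]
      refine .inr (.inl ⟨?_, ?_, ?_, ?_⟩)
      all_goals exact ⟨1, G.isLeg.mem, by omega, by omega, by omega, by omega⟩
    · simp only at h1 h2
      have h3 := G'.isLeg.lt i hi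
      obtain rfl := G'.eq_one hi (by omega)
      omega
    · simp only at h2 h3
      obtain rfl := G'.eq_one hi (by omega)
      have h4 := G.prevHeight_one
      have h5 := G.isLeg.pos 1 G.isLeg.mem
      omega

theorem isRightHalf {s' : Finset (Fin (ρ + 1))} {p' : Fin (ρ + 1) → Fin (ρ + 1)}
    (G' : IsLegOf n r s' p') :
    IsRightHalf (legCells n r s ∪ rotCells (width n r 1) (r 1) (legCells n r s'))
      (legVertices n r s ∪ rotVertices (width n r 1) (r 1) (legVertices n r s'))
      (width n r 1) (r 1) (legHeight n r s) (legCorner n r s) where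
  mem_iff x y hx := (G.mem_cells_iff G' hx).trans G.mem_legCells_iff
  hgt_eq x h1 h2 := G.legHeight_eq G.isLeg.mem (by rwa [G.isLeg.q_zero]) h2
  a_eq x h1 h2 := G.legCorner_eq G.isLeg.mem (by rwa [G.isLeg.q_zero]) h2
  zero_mem := .inl (by simp [legVertices])
  col x hx := by
    simp only [G.mem_vertices_iff G' hx, mem_legVertices, G.mem_legCells_iff, Prod.mk.injEq]
    have hprev {j} (hj : j ∈ s) (h1 : prevWidth n r j = x) : j ≠ 1 ∧ p j ∈ s ∧
        prevWidth n r (p j) ≤ x - 1 ∧ x - 1 < width n r (p j) ∧ x = width n r (p j) := by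
      have hj1 : j ≠ 1 := by
        rintro rfl
        have := G.isLeg.q_zero
        omega
      have h2 := G.isLeg.p_mem j hj hj1
      have h3 := G.isLeg.q_eq j hj hj1
      have h4 := G.isLeg.lt _ h2
      exact ⟨hj1, h2, by omega, by omega, by omega⟩
    -- Either the column ending at `x` belongs to a block, and then `x` is inside that block or on
    -- its right edge, or `x` is beyond the leg.
    by_cases hc : ∃ i ∈ s, prevWidth n r i ≤ x - 1 ∧ x - 1 < width n r i
    · obtain ⟨i, hi, h1, h2⟩ := hc
      have hP := G.legHeight_eq hi h1 h2
      have hpos := G.isLeg.pos i hi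
      have huniq {j} (hj : j ∈ s) (h3 : prevWidth n r j ≤ x - 1) (h4 : x - 1 < width n r j) :
          j = i := G.isLeg.eq_of_lt hj hi (by omega) (by omega)
      right
      rw [hP]
      rcases (show x ≤ width n r i by omega).lt_or_eq with h3 | h3
      · left
        have hQ := G.legHeight_eq hi (x := x) (by omega) h3
        refine ⟨hpos, hQ, ?_, fun y => ?_⟩
        · rw [G.legCorner_eq hi (by omega) (by omega), G.legCorner_eq hi (by omega) (by omega)]
        · rw [hQ]
          constructor
          · rintro (h | h | ⟨j, hj, h4, -⟩ | ⟨j, hj, -, h4, -⟩)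
            · omega
            · omega
            · have := G.isLeg.lt j hj
              obtain rfl := huniq hj (by omega) (by omega)
              omega
            · obtain ⟨-, hj1, hj2, hj3, hj4⟩ := hprev hj h4.symm
              rw [huniq hj1 hj2 hj3] at hj4
              omega
          · intro h
            right; left
            omega
      · right
        refine ⟨hpos, ?_, fun y => ?_⟩
        · rw [G.legCorner_eq hi (by omega) (by omega), h3]
        · constructor
          · rintro (h | h | ⟨j, hj, h4, h5⟩ | ⟨j, hj, h4, h5, h6⟩)
            · omega
            · omega
            · have := G.isLeg.lt j hj
              obtain rfl := huniq hj (by omega) (by omega)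
              omega
            · obtain ⟨hj0, hj1, hj2, hj3, hj4⟩ := hprev hj h5.symm
              have hpj := huniq hj1 hj2 hj3
              have := G.legHeight_eq hj h5.ge (by have := G.isLeg.lt j hj; omega)
              rw [G.prevHeight_eq j hj hj0, hpj] at h4
              have := G.isLeg.pos j hj
              omega
          · rintro (h | h | ⟨h4, h5, h6⟩)
            · right; left
              omega
            · exact .inr (.inr (.inl ⟨i, hi, h3, h⟩))
            · by_cases hd : ∃ j ∈ s, prevWidth n r j ≤ x ∧ x < width n r j
              · obtain ⟨j, hj, h7, h8⟩ := hd
                have h9 := G.legHeight_eq hj h7 h8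
                have h10 : prevWidth n r j = x := by
                  by_contra hne
                  obtain rfl := huniq hj (by omega) (by omega)
                  omega
                obtain ⟨hj0, hj1, hj2, hj3, hj4⟩ := hprev hj h10
                refine .inr (.inr (.inr ⟨j, hj, ?_, h10.symm, by omega⟩))
                rw [G.prevHeight_eq j hj hj0, huniq hj1 hj2 hj3]
                omega
              · rw [legHeight_eq_zero hd] at h4
                omega
    · left
      rw [legHeight_eq_zero hc, legHeight_eq_zero]
      · refine ⟨le_rfl, le_rfl, fun y => ?_⟩
        rintro (h | h | ⟨j, hj, h4, -⟩ | ⟨j, hj, -, h4, -⟩)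
        · omega
        · omega
        · have := G.isLeg.lt j hj
          exact hc ⟨j, hj, by omega, by omega⟩
        · obtain ⟨-, hj1, hj2, hj3, -⟩ := hprev hj h4.symm
          exact hc ⟨_, hj1, hj2, hj3⟩
      · rintro ⟨j, hj, h7, h8⟩
        have h10 : prevWidth n r j = x := by
          by_contra hne
          exact hc ⟨j, hj, by omega, by omega⟩
        obtain ⟨-, hj1, hj2, hj3, -⟩ := hprev hj h10
        exact hc ⟨_, hj1, hj2, hj3⟩

end IsLegOf

theorem coe_cells (R : Finset (Fin (ρ + 1))) : (cells n r R : Set (ℤ × ℤ)) =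
    (legCells n r (leg R) : Set (ℤ × ℤ)) ∪
      rotCells (width n r 1) (r 1) (legCells n r (insert 1 R)) := by
  ext ⟨x, y⟩
  simp only [cells, Finset.coe_union, Set.mem_union, Finset.coe_image, Set.mem_image,
    Finset.mem_coe, rotate, rotCells, Set.mem_ofPred_eq]
  refine or_congr Iff.rfl ⟨?_, fun h => ⟨_, h, by ext <;> simp <;> ring⟩⟩
  rintro ⟨c, hc, h⟩
  rw [Prod.ext_iff] at h
  simp only [Prod.fst_sub, Prod.snd_sub] at h
  convert hc using 1
  ext <;> simp <;> omega

theorem coe_vertices (R : Finset (Fin (ρ + 1))) : (vertices n r R : Set (ℤ × ℤ)) =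
    (legVertices n r (leg R) : Set (ℤ × ℤ)) ∪
      rotVertices (width n r 1) (r 1) (legVertices n r (insert 1 R)) := by
  ext ⟨x, y⟩
  simp only [vertices, Finset.coe_union, Set.mem_union, Finset.coe_image, Set.mem_image,
    Finset.mem_coe, rotate, rotVertices, Set.mem_ofPred_eq]
  refine or_congr Iff.rfl ⟨?_, fun h => ⟨_, h, by ext <;> simp⟩⟩
  rintro ⟨c, hc, h⟩
  rw [Prod.ext_iff] at h
  simp only [Prod.fst_sub, Prod.snd_sub] at h
  convert hc using 1
  ext <;> simp <;> omega

theorem rotCells_union_rotCells {W H : ℤ} {A B : Set (ℤ × ℤ)} :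
    rotCells W H (A ∪ rotCells W H B) = B ∪ rotCells W H A := by
  ext ⟨x, y⟩
  simp only [rotCells, Set.mem_union, Set.mem_ofPred_eq, sub_sub_cancel]
  exact or_comm

theorem rotVertices_union_rotVertices {W H : ℤ} {A B : Set (ℤ × ℤ)} :
    rotVertices W H (A ∪ rotVertices W H B) = B ∪ rotVertices W H A := by
  ext ⟨x, y⟩
  simp only [rotVertices, Set.mem_union, Set.mem_ofPred_eq, sub_sub_cancel]
  exact or_comm

/-- Rotating the whole diagram exchanges the two legs, so the left half is the right half for the
other leg. -/
theorem isLadder {R : Finset (Fin (ρ + 1))} {p p' : Fin (ρ + 1) → Fin (ρ + 1)}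
    (G : IsLegOf n r (leg R) p) (G' : IsLegOf n r (insert 1 R) p') :
    IsLadder n r R (width n r 1) (r 1) (legHeight n r (leg R)) (legCorner n r (leg R))
      (legHeight n r (insert 1 R)) (legCorner n r (insert 1 R)) where
  W_pos := G.width_one_pos
  H_pos := G.isLeg.pos 1 G.isLeg.mem
  right := by
    rw [coe_cells, coe_vertices]
    exact G.isRightHalf G'
  left := by
    rw [coe_cells, coe_vertices, rotCells_union_rotCells, rotVertices_union_rotVertices]
    exact G'.isRightHalf G

end YShaped

/-! ### The anticanonical class of the ladder quiver -/

namespace YShaped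

variable {ρ : ℕ} {n : Fin (ρ + 1) → Fin (ρ + 1) → ℕ} {r : Fin (ρ + 1) → ℕ}
  {R : Finset (Fin (ρ + 1))} {p p' : Fin (ρ + 1) → Fin (ρ + 1)}

theorem mem_cells_right (G : IsLegOf n r (leg R) p) (G' : IsLegOf n r (insert 1 R) p') {x y : ℤ}
    (hx : 0 ≤ x) : (x, y) ∈ cells n r R ↔ (x, y) ∈ legCells n r (leg R) := by
  rw [← G.mem_cells_iff G' hx, ← coe_cells, Finset.mem_coe]

theorem mem_cells_left (G : IsLegOf n r (leg R) p) (G' : IsLegOf n r (insert 1 R) p')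
    {x y u v : ℤ} (hx : 0 ≤ x) (hu : u = width n r 1 - 1 - x) (hv : v = r 1 - 1 - y) :
    (u, v) ∈ cells n r R ↔ (x, y) ∈ legCells n r (insert 1 R) := by
  rw [← G'.mem_cells_iff G hx, ← rotCells_union_rotCells, ← coe_cells, mem_rotCells hu hv,
    Finset.mem_coe]

/-- The sum over the edges to the right of the first block. -/
theorem IsLegOf.sum_right {s : Finset (Fin (ρ + 1))} (G : IsLegOf n r s p) {f : ℤ × ℤ → ℤ}
    {g : ℤ × ℤ → ℤ} {S T : Finset (ℤ × ℤ)} {α : ℤ}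
    (hg : ∀ x y, width n r 1 ≤ x → g (x, y) = if y = 0 then α else f (legCorner n r s x))
    (hS : ∀ x y, (x, y) ∈ S ↔ width n r 1 ≤ x ∧
      ((x, y) ∈ legCells n r s ∨ (x, y - 1) ∈ legCells n r s))
    (hT : ∀ x y, (x, y) ∈ T ↔ width n r 1 ≤ x ∧
      ((x, y) ∈ legCells n r s ∨ (x - 1, y) ∈ legCells n r s)) :
    ∑ z ∈ S, (g (z + (1, 0)) - g z) + ∑ z ∈ T, (g (z + (0, 1)) - g z) =
      (f (width n r 1, r 1) - α) + ∑ i ∈ s.erase 1,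
        ((width n r i - prevWidth n r i) * (f (width n r i, r i) - α) +
          r i * (f (width n r i, r i) - f (width n r (p i), r (p i)))) := by
  have hg0 (x : ℤ) (hx : width n r 1 ≤ x) : g (x, 0) = α := by rw [hg x 0 hx, if_pos rfl]
  have hf (i) (hi : i ∈ s) (x y : ℤ) (h1 : prevWidth n r i < x) (h2 : x ≤ width n r i)
      (h3 : width n r 1 ≤ x) (hy : y ≠ 0) : g (x, y) = f (width n r i, r i) := by
    rw [hg x y h3, if_neg hy, G.legCorner_eq hi h1 h2]
  rw [G.isLeg.sum_horizontal (f := fun i => f (width n r i, r i)) hg0 hf,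
    G.isLeg.sum_vertical (f := fun i => f (width n r i, r i)) hg0 G.width_one_pos hf,
    Finset.sum_add_distrib]
  · ring
  · intro x y
    rw [hT, mem_legCells, mem_legCells]
    refine and_congr Iff.rfl (or_congr Iff.rfl ?_)
    refine exists_congr fun i => and_congr Iff.rfl ?_
    omega
  · intro x y
    rw [hS, mem_legCells, mem_legCells, ← exists_or]
    refine and_congr Iff.rfl (exists_congr fun i => ?_)
    have := G.isLeg.pos i
    constructor
    · rintro (⟨hi, h⟩ | ⟨hi, h⟩)
      · exact ⟨hi, by omega⟩
      · exact ⟨hi, by omega⟩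
    · rintro ⟨hi, h⟩
      have := this hi
      rw [← and_or_left]
      exact ⟨hi, by omega⟩

/-- The sum over the edges inside the first block. -/
theorem sum_middle {W H α β : ℤ} (hW : 0 < W) (hH : 0 < H) {g : ℤ × ℤ → ℤ}
    {S T : Finset (ℤ × ℤ)} (h0 : ∀ y, g (0, y) = if y = H then β else α)
    (hg : ∀ x y, 0 < x → x ≤ W → g (x, y) = if y = 0 then α else β)
    (hS : ∀ x y, (x, y) ∈ S ↔ 0 ≤ x ∧ x < W ∧ 0 ≤ y ∧ y ≤ H)
    (hT : ∀ x y, (x, y) ∈ T ↔ 0 < x ∧ x < W ∧ 0 ≤ y ∧ y < H) :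
    ∑ z ∈ S, (g (z + (1, 0)) - g z) + ∑ z ∈ T, (g (z + (0, 1)) - g z) =
      (W + H - 2) * (β - α) := by
  -- Between the wall `x = 0` and the line `x = 1` the function jumps only strictly between bottom
  -- and top, hence `H - 1` times; the vertical edges similarly give `W - 1` jumps.
  have h1 : ∑ y ∈ Finset.Ioo 0 H, (β - α) = ∑ z ∈ S, (g (z + (1, 0)) - g z) := by
    refine Finset.sum_of_injOn (fun y => (0, y)) (fun a _ b _ h => (Prod.mk.inj h).2) ?_ ?_ ?_
    · intro y hy
      rw [Finset.mem_coe, Finset.mem_Ioo] at hy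
      exact (hS 0 y).2 (by omega)
    · rintro ⟨x, y⟩ hz hn
      have := (hS x y).1 hz
      rw [Prod.mk_add_mk, hg _ _ (by omega) (by omega), add_zero]
      rcases this.1.eq_or_lt with rfl | hx
      · have hy : ¬ (0 < y ∧ y < H) := fun hy => hn ⟨y, by simpa using hy, rfl⟩
        rw [h0]
        split_ifs <;> omega
      · rw [hg _ _ (by omega) (by omega), sub_self]
    · intro y hy
      rw [Finset.mem_Ioo] at hy
      rw [Prod.mk_add_mk, hg _ _ (by omega) (by omega), h0, if_neg (by omega), if_neg (by omega)]
  have h2 : ∑ x ∈ Finset.Ioo 0 W, (β - α) = ∑ z ∈ T, (g (z + (0, 1)) - g z) := by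
    refine Finset.sum_of_injOn (fun x => (x, 0)) (fun a _ b _ h => (Prod.mk.inj h).1) ?_ ?_ ?_
    · intro x hx
      rw [Finset.mem_coe, Finset.mem_Ioo] at hx
      exact (hT x 0).2 (by omega)
    · rintro ⟨x, y⟩ hz hn
      have := (hT x y).1 hz
      have hy : y ≠ 0 := by
        rintro rfl
        exact hn ⟨x, by simp; omega, rfl⟩
      rw [Prod.mk_add_mk, hg _ _ (by omega) (by omega), hg _ _ (by omega) (by omega),
        if_neg (by omega), if_neg hy, sub_self]
    · intro x hx
      rw [Finset.mem_Ioo] at hx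
      rw [Prod.mk_add_mk, hg _ _ (by omega) (by omega), hg _ _ (by omega) (by omega),
        if_neg (by omega), if_pos rfl]
  rw [← h1, ← h2, Finset.sum_const, Finset.sum_const, Int.card_Ioo, Int.card_Ioo, nsmul_eq_mul,
    nsmul_eq_mul, Int.toNat_of_nonneg (by omega), Int.toNat_of_nonneg (by omega)]
  ring

/-- The sum over all edges of a ladder diagram. -/
theorem edgeSum_anchor (G : IsLegOf n r (leg R) p) (G' : IsLegOf n r (insert 1 R) p')
    (f : ℤ × ℤ → ℤ) :
    edgeSum (cells n r R) (fun z => f (anchor (width n r 1) (r 1) (legCorner n r (leg R))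
      (legCorner n r (insert 1 R)) z)) =
    (width n r 1 + r 1) * (f (width n r 1, r 1) - f (0, 0)) +
    ∑ i ∈ (leg R).erase 1,
      ((width n r i - prevWidth n r i) * (f (width n r i, r i) - f (0, 0)) +
        r i * (f (width n r i, r i) - f (width n r (p i), r (p i)))) +
    ∑ i ∈ (insert 1 R).erase 1,
      ((width n r i - prevWidth n r i) * (f (width n r 1, r 1) - f (rotate n r (width n r i, r i))) +
        r i * (f (rotate n r (width n r (p' i), r (p' i))) - f (rotate n r (width n r i, r i)))) := by
  have hW := G.width_one_pos
  have hH : (0 : ℤ) < r 1 := G.isLeg.pos 1 G.isLeg.mem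
  have hq := G.isLeg.q_zero
  set W := width n r 1 with hWdef
  set H := (r 1 : ℤ) with hHdef
  set g : ℤ × ℤ → ℤ := fun z => f (anchor W H (legCorner n r (leg R))
    (legCorner n r (insert 1 R)) z) with hgdef
  let S := horizontal (cells n r R)
  let T := vertical (cells n r R)
  have hone {s q} (G : IsLegOf n r s q) (x : ℤ) (h1 : 0 < x) (h2 : x ≤ W) :
      legCorner n r s x = (W, H) := G.legCorner_eq G.isLeg.mem (by rwa [G.isLeg.q_zero]) h2
  have hblock (x y : ℤ) (h1 : 0 ≤ x) (h2 : x < W) :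
      (x, y) ∈ cells n r R ↔ 0 ≤ y ∧ y < H := by
    rw [mem_cells_right G G' h1, G.mem_legCells_iff,
      G.legHeight_eq G.isLeg.mem (by rwa [G.isLeg.q_zero]) h2]
  have hright := G.sum_right (f := f) (g := g) (α := f (0, 0))
    (S := S.filter fun z => W ≤ z.1) (T := T.filter fun z => W ≤ z.1)
    (fun x y hx => by
      simp only [hgdef, anchor]
      rw [if_pos (by omega)]
      split_ifs <;> rfl)
    (fun x y => by
      rw [Finset.mem_filter, mem_horizontal, Prod.mk_sub_mk, sub_zero, and_comm]
      refine and_congr_right fun hx => ?_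
      rw [mem_cells_right G G' (by omega), mem_cells_right G G' (by omega)])
    (fun x y => by
      rw [Finset.mem_filter, mem_vertical, Prod.mk_sub_mk, sub_zero, and_comm]
      refine and_congr_right fun hx => ?_
      rw [mem_cells_right G G' (by omega), mem_cells_right G G' (by omega)])
  -- Rotation swaps the two ends of an edge: `σ` takes the left end of a horizontal edge to the left
  -- end of the rotated edge, and `τ` does the same for lower ends of vertical edges. The swap
  -- explains the signs in `e1` and `e2`.
  let σ : ℤ × ℤ → ℤ × ℤ := fun z => (W - 1 - z.1, H - z.2)
  let τ : ℤ × ℤ → ℤ × ℤ := fun z => (W - z.1, H - 1 - z.2)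
  have hσ : Function.Involutive σ := fun z => by ext <;> simp [σ]
  have hτ : Function.Involutive τ := fun z => by ext <;> simp [τ]
  have hmem {σ : ℤ × ℤ → ℤ × ℤ} (hσ : Function.Involutive σ) {S : Finset (ℤ × ℤ)} {z : ℤ × ℤ} :
      z ∈ S.image σ ↔ σ z ∈ S := by
    rw [Finset.mem_image]
    refine ⟨?_, fun h => ⟨_, h, hσ _⟩⟩
    rintro ⟨z, hz, rfl⟩
    rwa [hσ]
  let g' : ℤ × ℤ → ℤ := fun z => g (rotate n r z)
  have hleft := G'.sum_right (f := fun z => f (rotate n r z)) (g := g') (α := f (W, H))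
    (S := (S.filter fun z => z.1 < 0).image σ) (T := (T.filter fun z => z.1 ≤ 0).image τ)
    (fun x y hx => by
      have hx' : ¬ 0 < W - x := by omega
      simp only [g', hgdef, anchor, rotate, Prod.fst_sub, Prod.snd_sub, ← hWdef, ← hHdef, if_neg hx',
        sub_sub_cancel, sub_eq_self]
      split_ifs <;> rfl)
    (fun x y => by
      rw [hmem hσ, Finset.mem_filter, mem_horizontal, and_comm]
      refine (and_congr_left' (show (σ (x, y)).1 < 0 ↔ W ≤ x by simp only [σ]; omega)).trans
        (and_congr_right fun hx => ?_)
      rw [or_comm, mem_cells_left (x := x) (y := y) G G' (by omega) (by simp [σ, hWdef])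
        (by simp [σ, hHdef]; ring), mem_cells_left (x := x) (y := y - 1) G G' (by omega)
        (by simp [hWdef]) (by simp [hHdef])])
    (fun x y => by
      rw [hmem hτ, Finset.mem_filter, mem_vertical, and_comm]
      refine (and_congr_left' (show (τ (x, y)).1 ≤ 0 ↔ W ≤ x by simp only [τ]; omega)).trans
        (and_congr_right fun hx => ?_)
      rw [or_comm, mem_cells_left (x := x) (y := y) G G' (by omega) (by simp [τ, hWdef]; ring)
        (by simp [τ, hHdef]), mem_cells_left (x := x - 1) (y := y) G G' (by omega)
        (by simp [hWdef]) (by simp [hHdef])])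
  have hmiddle := sum_middle (α := f (0, 0)) (β := f (W, H)) hW hH (g := g)
    (S := S.filter fun z => ¬ W ≤ z.1 ∧ ¬ z.1 < 0) (T := T.filter fun z => ¬ W ≤ z.1 ∧ ¬ z.1 ≤ 0)
    (fun y => by
      simp only [hgdef, anchor, lt_irrefl, if_false, sub_zero]
      rw [hone G' W hW le_rfl, sub_self]
      split_ifs <;> rfl)
    (fun x y h1 h2 => by
      simp only [hgdef, anchor]
      rw [if_pos h1, hone G x h1 h2]
      split_ifs <;> rfl)
    (fun x y => by
      rw [Finset.mem_filter, mem_horizontal, Prod.mk_sub_mk, sub_zero]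
      by_cases hx : 0 ≤ x ∧ x < W
      · rw [hblock _ _ hx.1 hx.2, hblock _ _ hx.1 hx.2]
        omega
      · simp only
        omega)
    (fun x y => by
      rw [Finset.mem_filter, mem_vertical, Prod.mk_sub_mk, sub_zero]
      by_cases hx : 0 < x ∧ x < W
      · rw [hblock _ _ hx.1.le hx.2, hblock _ _ (by omega) (by omega)]
        omega
      · simp only
        omega)
  rw [Finset.sum_image hσ.injective.injOn, Finset.sum_image hτ.injective.injOn] at hleft
  have e1 : ∑ z ∈ S with z.1 < 0, (g' (σ z + (1, 0)) - g' (σ z)) =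
      - ∑ z ∈ S with z.1 < 0, (g (z + (1, 0)) - g z) := by
    rw [← Finset.sum_neg_distrib]
    refine Finset.sum_congr rfl fun z _ => ?_
    have h1 : rotate n r (σ z + (1, 0)) = z := by
      ext <;> simp [rotate, σ, ← hWdef, ← hHdef] <;> ring
    have h2 : rotate n r (σ z) = z + (1, 0) := by
      ext <;> simp [rotate, σ, ← hWdef, ← hHdef] <;> ring
    simp only [g', h1, h2, neg_sub]
  have e2 : ∑ z ∈ T with z.1 ≤ 0, (g' (τ z + (0, 1)) - g' (τ z)) =
      - ∑ z ∈ T with z.1 ≤ 0, (g (z + (0, 1)) - g z) := by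
    rw [← Finset.sum_neg_distrib]
    refine Finset.sum_congr rfl fun z _ => ?_
    have h1 : rotate n r (τ z + (0, 1)) = z := by
      ext <;> simp [rotate, τ, ← hWdef, ← hHdef] <;> ring
    have h2 : rotate n r (τ z) = z + (0, 1) := by
      ext <;> simp [rotate, τ, ← hWdef, ← hHdef] <;> ring
    simp only [g', h1, h2, neg_sub]
  have e3 : ∑ z ∈ S, (g (z + (1, 0)) - g z) = ∑ z ∈ S with W ≤ z.1, (g (z + (1, 0)) - g z) +
      (∑ z ∈ S with z.1 < 0, (g (z + (1, 0)) - g z) +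
        ∑ z ∈ S with ¬ W ≤ z.1 ∧ ¬ z.1 < 0, (g (z + (1, 0)) - g z)) := by
    rw [← Finset.sum_filter_add_sum_filter_not S (fun z => W ≤ z.1)]
    congr 1
    rw [← Finset.sum_filter_add_sum_filter_not (S.filter _) (fun z => z.1 < 0),
      Finset.filter_filter, Finset.filter_filter]
    congr 2
    refine Finset.filter_congr fun z _ => ?_
    omega
  have e4 : ∑ z ∈ T, (g (z + (0, 1)) - g z) = ∑ z ∈ T with W ≤ z.1, (g (z + (0, 1)) - g z) +
      (∑ z ∈ T with z.1 ≤ 0, (g (z + (0, 1)) - g z) +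
        ∑ z ∈ T with ¬ W ≤ z.1 ∧ ¬ z.1 ≤ 0, (g (z + (0, 1)) - g z)) := by
    rw [← Finset.sum_filter_add_sum_filter_not T (fun z => W ≤ z.1)]
    congr 1
    rw [← Finset.sum_filter_add_sum_filter_not (T.filter _) (fun z => z.1 ≤ 0),
      Finset.filter_filter, Finset.filter_filter]
    congr 2
    refine Finset.filter_congr fun z _ => ?_
    omega
  have e5 : rotate n r (W, H) = (0, 0) := by ext <;> simp [rotate, ← hWdef, ← hHdef]
  have e6 : ∑ i ∈ (insert 1 R).erase 1,
      ((width n r i - prevWidth n r i) * (f (W, H) - f (rotate n r (width n r i, r i))) +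
        r i * (f (rotate n r (width n r (p' i), r (p' i))) - f (rotate n r (width n r i, r i)))) =
      - ∑ i ∈ (insert 1 R).erase 1,
      ((width n r i - prevWidth n r i) * (f (rotate n r (width n r i, r i)) - f (W, H)) +
        r i * (f (rotate n r (width n r i, r i)) -
          f (rotate n r (width n r (p' i), r (p' i))))) := by
    rw [← Finset.sum_neg_distrib]
    exact Finset.sum_congr rfl fun i _ => by ring
  rw [e1, e2] at hleft
  simp only [← hWdef, ← hHdef, e5] at hleft hright
  change ∑ z ∈ S, (g (z + (1, 0)) - g z) + ∑ z ∈ T, (g (z + (0, 1)) - g z) = _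
  rw [e3, e4, e6]
  -- The coefficient `W + H` arises from `W + H - 2` in the middle and one lowest or highest
  -- vertical edge on each of the walls `x = W` and `x = 0`.
  linear_combination hright - hleft + hmiddle

end YShaped

/-! ### Cuts, and the paths that a flow carries -/

namespace ToricQuiver

variable {V : Type} [Quiver.{0} V]

theorem pathFlow_comp {u v w : V} (p : Quiver.Path u v) (q : Quiver.Path v w) :
    pathFlow (p.comp q) = pathFlow p + pathFlow q := by
  induction q with
  | nil => rw [Quiver.Path.comp_nil, pathFlow, add_zero]
  | cons q a ih => rw [Quiver.Path.comp_cons, pathFlow, ih, pathFlow, add_assoc]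

/-- Summation by parts. For the indicator function of a set of vertices the right side is the net
flow into the set. -/
theorem sum_mul_divergence [Fintype V] [Fintype (Quiver.Total V)] (f : V → ℤ)
    (b : Quiver.Total V →₀ ℕ) :
    ∑ v, f v * divergence b v = ∑ a, (b a : ℤ) * (f a.right - f a.left) := by
  classical
  induction b using Finsupp.induction_linear with
  | zero => simp
  | add b c hb hc =>
    simp only [map_add, Pi.add_apply, mul_add, Finset.sum_add_distrib, hb, hc, Finsupp.add_apply,
      Nat.cast_add, add_mul]
  | single a k =>
    simp only [divergence_single, Pi.smul_apply, Pi.sub_apply, Pi.single_apply, Finsupp.single_apply]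
    simp [mul_sub, Finset.sum_sub_distrib]
    ring

/-- The flow through a cut is the same for all stable flows of the same multiplicity. -/
theorem IsStableFlow.sum_eq [Fintype V] [Fintype (Quiver.Total V)] {m : ℕ}
    {b : Quiver.Total V →₀ ℕ} (hb : IsStableFlow V m b) (f : V → ℤ) :
    ∑ a, (b a : ℤ) * (f a.right - f a.left) =
      m * ∑ a : Quiver.Total V, (f a.right - f a.left) := by
  rw [← sum_mul_divergence, hb.2]
  have := sum_mul_divergence f (unitFlow V)
  simp only [unitFlow_apply, Nat.cast_one, one_mul] at this
  rw [← this, Finset.mul_sum]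
  refine Finset.sum_congr rfl fun v _ => ?_
  simp only [Pi.smul_apply, nsmul_eq_mul]
  ring

/-- Some path from `u` to `v` runs along arrows that the flow `b` uses. -/
def Carries (b : Quiver.Total V →₀ ℕ) (u v : V) : Prop :=
  ∃ p : Quiver.Path u v, ∀ a, pathFlow p a ≠ 0 → b a ≠ 0

variable {b : Quiver.Total V →₀ ℕ}

theorem Carries.refl (u : V) : Carries b u u := ⟨.nil, fun _ h => absurd rfl h⟩

theorem Carries.trans {u v w : V} (h : Carries b u v) (h' : Carries b v w) : Carries b u w := by
  obtain ⟨p, hp⟩ := h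
  obtain ⟨q, hq⟩ := h'
  refine ⟨p.comp q, fun a ha => ?_⟩
  rw [pathFlow_comp, Finsupp.add_apply] at ha
  by_cases h : pathFlow p a = 0
  · exact hq a (by omega)
  · exact hp a h

theorem pathFlow_toPath {u v : V} (a : u ⟶ v) :
    pathFlow a.toPath = Finsupp.single ⟨u, v, a⟩ 1 := zero_add _

theorem Carries.of_arrow {a : Quiver.Total V} (h : b a ≠ 0) : Carries b a.left a.right := by
  classical
  refine ⟨a.hom.toPath, fun c hc => ?_⟩
  rw [pathFlow_toPath, Finsupp.single_apply] at hc
  split_ifs at hc with hac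
  · rwa [← hac]
  · exact absurd rfl hc

theorem Carries.induction {u : V} {P : V → Prop} (h0 : P u)
    (h1 : ∀ a : Quiver.Total V, b a ≠ 0 → P a.left → P a.right) {v : V} (h : Carries b u v) :
    P v := by
  classical
  obtain ⟨p, hp⟩ := h
  induction p with
  | nil => exact h0
  | cons p c ih =>
    refine h1 ⟨_, _, c⟩ (hp _ ?_) (ih fun a ha => hp a ?_)
    · simp [pathFlow]
    · rw [pathFlow, Finsupp.add_apply]
      omega

/-- Exchanging one path for another one with the same ends gives a stable flow. -/
theorem exists_isStableFlow_eq_zero [Finite (Quiver.Total V)] {ht : V → ℤ}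
    (hht : ∀ {u v : V}, (u ⟶ v) → ht u < ht v) {u v : V} (p q : Quiver.Path u v)
    {a : Quiver.Total V} (hp : pathFlow p a ≠ 0) (hq : pathFlow q a = 0) :
    ∃ m b, IsStableFlow V m b ∧ b a = 0 := by
  classical
  have hle : pathFlow p ≤ unitFlow V := fun c => pathFlow_le_one hht p c
  obtain ⟨d, hd⟩ := exists_add_of_le hle
  refine ⟨1, d + pathFlow q, ⟨one_pos, ?_⟩, ?_⟩
  · rw [one_smul, hd, map_add, map_add, divergence_pathFlow, divergence_pathFlow, add_comm]
  · have h1 : unitFlow V a = pathFlow p a + d a := by rw [hd]; rfl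
    rw [unitFlow_apply] at h1
    rw [Finsupp.add_apply, hq]
    omega

end ToricQuiver

/-! ### Crossing lattice paths, and exchanging the sides of a cell -/

namespace YShaped

open ToricQuiver

section Crossing

variable {S : ℤ × ℤ → ℤ × ℤ → Prop}
  (hS : ∀ z z', S z z' → level z' = level z + 1 ∧ z.1 ≤ z'.1 ∧ z'.1 ≤ z.1 + 1)

include hS

theorem exists_level_eq {z z' : ℤ × ℤ} (h : Relation.ReflTransGen S z z') {k : ℤ}
    (h1 : level z ≤ k) (h2 : k ≤ level z') :
    ∃ y, Relation.ReflTransGen S z y ∧ Relation.ReflTransGen S y z' ∧ level y = k := by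
  induction h using Relation.ReflTransGen.head_induction_on with
  | refl => exact ⟨z', .refl, .refl, le_antisymm h1 h2⟩
  | @head z y hs h ih =>
    rcases h1.eq_or_lt with h1 | h1
    · exact ⟨z, .refl, .head hs h, h1⟩
    · obtain ⟨t, h3, h4, h5⟩ := ih (by have := (hS z y hs).1; omega)
      exact ⟨t, .head hs h3, h4, h5⟩

theorem fst_le_of_reflTransGen {z z' : ℤ × ℤ} (h : Relation.ReflTransGen S z z') : z.1 ≤ z'.1 := by
  induction h with
  | refl => exact le_rfl
  | tail _ hs ih => exact ih.trans (hS _ _ hs).2.1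

variable {W H : ℤ} (hreg : ∀ z z', S z z' → z.1 < W → z.2 ≤ H)

include hreg

/-- Both paths climb one level per step and their abscissas grow by `0` or `1`, so the gap `y.1 -
z.1` changes by at most one and cannot become negative without vanishing. The second path cannot end
first: the first would then be on the level of `(W, H)` to the left of it, hence above height `H`,
against `hreg`. -/
theorem exists_crossing_of_level_eq {z z' y : ℤ × ℤ} (h : Relation.ReflTransGen S z z')
    (hz' : W ≤ z'.1) (hy : Relation.ReflTransGen S y (W, H)) (hl : level y = level z)
    (hle : z.1 ≤ y.1) :
    ∃ t, Relation.ReflTransGen S z t ∧ Relation.ReflTransGen S t z' ∧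
      Relation.ReflTransGen S y t ∧ Relation.ReflTransGen S t (W, H) := by
  induction h using Relation.ReflTransGen.head_induction_on generalizing y with
  | refl =>
    have h1 := fst_le_of_reflTransGen hS hy
    have h2 : z' = y := by
      unfold level at hl
      ext
      · simp only at h1; omega
      · simp only at h1; omega
    exact ⟨z', .refl, .refl, by rw [h2], by rwa [h2]⟩
  | @head z z₁ hs h ih =>
    by_cases hzy : z = y
    · subst hzy
      exact ⟨z, .refl, .head hs h, .refl, hy⟩
    · have hlt : z.1 < y.1 := by
        refine hle.lt_of_ne fun he => hzy ?_
        unfold level at hl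
        ext <;> omega
      rcases Relation.ReflTransGen.cases_head hy with rfl | ⟨y₁, hs', hy₁⟩
      · have := hreg _ _ hs hlt
        simp only [level] at hl hlt
        omega
      · have h1 := hS _ _ hs
        have h2 := hS _ _ hs'
        obtain ⟨t, h3, h4, h5, h6⟩ := ih hy₁ (by omega) (by omega)
        exact ⟨t, .head hs h3, h4, .head hs' h5, h6⟩

/-- A lattice path that leads from the left to the right crosses a lattice path from the origin to
`(W, H)`. -/
theorem exists_crossing (hW : 0 < W)
    (hreg' : ∀ z z', S z z' → 0 < z.1 → 0 ≤ z.2) {z z' : ℤ × ℤ}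
    (h : Relation.ReflTransGen S z z') (hz : z.1 < 0) (hz' : W ≤ z'.1) (hz'' : 0 ≤ z'.2)
    (hy : Relation.ReflTransGen S (0, 0) (W, H)) :
    ∃ t, Relation.ReflTransGen S z t ∧ Relation.ReflTransGen S t z' ∧
      Relation.ReflTransGen S (0, 0) t ∧ Relation.ReflTransGen S t (W, H) := by
  -- Whichever path starts on the lower level is followed to the level where the other starts; there
  -- the path from `z` is not to the right of the path from the origin.
  rcases le_total (level z) 0 with hl | hl
  · obtain ⟨y, h1, h2, h3⟩ := exists_level_eq hS h hl (by unfold level; omega)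
    have hy1 : y.1 ≤ 0 := by
      by_contra! hpos
      rcases Relation.ReflTransGen.cases_head h2 with rfl | ⟨y₁, hs, -⟩
      · unfold level at h3
        omega
      · have := hreg' _ _ hs hpos
        unfold level at h3
        omega
    obtain ⟨t, h4, h5, h6, h7⟩ := exists_crossing_of_level_eq hS hreg h2 hz' hy
      (by rw [h3]; rfl) hy1
    exact ⟨t, h1.trans h4, h5, h6, h7⟩
  · have hzH : z.2 ≤ H := by
      rcases Relation.ReflTransGen.cases_head h with rfl | ⟨y₁, hs, -⟩
      · omega
      · exact hreg _ _ hs (by omega)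
    obtain ⟨y, h1, h2, h3⟩ := exists_level_eq hS hy (k := level z) (by simpa [level] using hl)
      (by simp only [level]; omega)
    have h8 := fst_le_of_reflTransGen hS h1
    obtain ⟨t, h4, h5, h6, h7⟩ := exists_crossing_of_level_eq hS hreg h hz' h2 h3
      (by simp only at h8; omega)
    exact ⟨t, h4, h5, h1.trans h6, h7⟩

end Crossing

variable {ρ : ℕ} {n : Fin (ρ + 1) → Fin (ρ + 1) → ℕ} {r : Fin (ρ + 1) → ℕ}
  {R : Finset (Fin (ρ + 1))}

namespace IsContraction

variable {sp mg : ℤ × ℤ → Prop} {φ : ℤ × ℤ → ℤ × ℤ} (C : IsContraction n r R sp mg φ)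
  {E : {e : (ℤ × ℤ) × (ℤ × ℤ) // Transverse n r R sp mg e.1 e.2} ≃ Quiver.Total (Vertex n r R)}
  (hE : ∀ e, (E e).left.1 = φ e.1.1 ∧ (E e).right.1 = φ e.1.2)

include C hE

/-- An edge gives a path of at most one arrow. -/
theorem exists_path_of_step {z z' : ℤ × ℤ} (hs : Step (cells n r R) z z') {u v : Vertex n r R}
    (hu : u.1 = φ z) (hv : v.1 = φ z') : ∃ p : Quiver.Path u v, ∀ c, pathFlow p c ≠ 0 ↔
      ∃ h : Transverse n r R sp mg z z', E ⟨(z, z'), h⟩ = c := by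
  classical
  by_cases h : Transverse n r R sp mg z z'
  · have he := hE ⟨(z, z'), h⟩
    obtain rfl : (E ⟨(z, z'), h⟩).left = u := Subtype.ext (he.1.trans hu.symm)
    obtain rfl : (E ⟨(z, z'), h⟩).right = v := Subtype.ext (he.2.trans hv.symm)
    refine ⟨(E ⟨(z, z'), h⟩).hom.toPath, fun c => ?_⟩
    rw [pathFlow_toPath, Finsupp.single_apply]
    simp [h]
  · obtain rfl : u = v := Subtype.ext (by rw [hu, hv, C.eq_of_not_transverse hs h])
    exact ⟨.nil, fun c => ⟨fun h' => absurd rfl h', fun ⟨h', _⟩ => absurd h' h⟩⟩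

/-- No arrow belongs to all stable flows: the path along two sides of a cell can be exchanged for
the path along the other two sides. -/
theorem exists_isStableFlow_of_cell {z₀ z₁ z₂ y : ℤ × ℤ} (h1 : Step (cells n r R) z₀ z₁)
    (h2 : Step (cells n r R) z₁ z₂) (h3 : Step (cells n r R) z₀ y) (h4 : Step (cells n r R) y z₂)
    (hy : z₁ ≠ y) {e : {e : (ℤ × ℤ) × (ℤ × ℤ) // Transverse n r R sp mg e.1 e.2}}
    (he : e.1 = (z₀, z₁) ∨ e.1 = (z₁, z₂)) :
    ∃ m b, IsStableFlow (Vertex n r R) m b ∧ b (E e) = 0 := by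
  have hv {z} (h : φ z ∈ vertices n r R) : ∃ u : Vertex n r R, u.1 = φ z := ⟨⟨_, h⟩, rfl⟩
  obtain ⟨u₀, hu₀⟩ := hv (C.mem_left h1)
  obtain ⟨u₁, hu₁⟩ := hv (C.mem_left h2)
  obtain ⟨u₂, hu₂⟩ := hv (C.mem_right h2)
  obtain ⟨v, hv⟩ := hv (C.mem_left h4)
  obtain ⟨p₁, hp₁⟩ := C.exists_path_of_step hE h1 hu₀ hu₁
  obtain ⟨p₂, hp₂⟩ := C.exists_path_of_step hE h2 hu₁ hu₂
  obtain ⟨q₁, hq₁⟩ := C.exists_path_of_step hE h3 hu₀ hv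
  obtain ⟨q₂, hq₂⟩ := C.exists_path_of_step hE h4 hv hu₂
  have l1 := h1.lt
  have l2 := h2.lt
  obtain ⟨e, ht⟩ := e
  refine exists_isStableFlow_eq_zero (ht := fun u : Vertex n r R => level u.1) level_lt
    (p₁.comp p₂) (q₁.comp q₂) ?_ ?_
  · rw [pathFlow_comp, Finsupp.add_apply]
    simp only at he
    rcases he with rfl | rfl
    · have := (hp₁ _).2 ⟨ht, rfl⟩
      omega
    · have := (hp₂ _).2 ⟨ht, rfl⟩
      omega
  · rw [pathFlow_comp, Finsupp.add_apply, Nat.add_eq_zero_iff]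
    constructor
    · by_contra hn
      obtain ⟨h, h'⟩ := (hq₁ _).1 hn
      have := congrArg Subtype.val (E.injective h')
      simp only at this he
      rw [← this] at he
      rcases he with he | he
      · exact hy (Prod.mk.inj he).2.symm
      · exact l1.ne (Prod.mk.inj he).1
    · by_contra hn
      obtain ⟨h, h'⟩ := (hq₂ _).1 hn
      have := congrArg Subtype.val (E.injective h')
      simp only at this he
      rw [← this] at he
      rcases he with he | he
      · exact l2.ne (Prod.mk.inj he).2.symm
      · exact hy (Prod.mk.inj he).1.symm

-- Every edge is a side of a cell, and going around the cell the other way avoids it.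
omit hE in
theorem exists_isStableFlow_eq_zero (a : Quiver.Total (Vertex n r R)) :
    ∃ m b, IsStableFlow (Vertex n r R) m b ∧ b a = 0 := by
  obtain ⟨E, hE⟩ := C.exists_equiv
  obtain ⟨e, rfl⟩ := E.surjective a
  obtain ⟨x, y, h, he⟩ : ∃ x y, (x, y) ∈ cells n r R ∧
      ((e.1 = ((x, y), (x + 1, y)) ∨ e.1 = ((x + 1, y), (x + 1, y + 1))) ∨
        e.1 = ((x, y), (x, y + 1)) ∨ e.1 = ((x, y + 1), (x + 1, y + 1))) := by
    obtain ⟨⟨⟨x, y⟩, z⟩, ht⟩ := e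
    rcases step_iff_left.1 ht.1 with ⟨h, h' | h'⟩ | ⟨h, h' | h'⟩ <;> simp only at h <;> subst h
    · exact ⟨x, y, h', .inl (.inl rfl)⟩
    · exact ⟨x, y - 1, h', .inr (.inr (by simp))⟩
    · exact ⟨x, y, h', .inr (.inl rfl)⟩
    · exact ⟨x - 1, y, h', .inl (.inr (by simp))⟩
  have h1 : Step (cells n r R) (x, y) (x + 1, y) := step_iff_left.2 (.inl ⟨rfl, .inl h⟩)
  have h2 : Step (cells n r R) (x, y) (x, y + 1) := step_iff_left.2 (.inr ⟨rfl, .inl h⟩)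
  have h3 : Step (cells n r R) (x + 1, y) (x + 1, y + 1) :=
    step_iff_left.2 (.inr ⟨rfl, .inr (by simpa using h)⟩)
  have h4 : Step (cells n r R) (x, y + 1) (x + 1, y + 1) :=
    step_iff_left.2 (.inl ⟨rfl, .inr (by simpa using h)⟩)
  rcases he with he | he
  · exact C.exists_isStableFlow_of_cell hE h1 h3 h2 h4 (by simp) he
  · exact C.exists_isStableFlow_of_cell hE h2 h4 h1 h3 (by simp) he

/-- The edges that a flow uses, and the edges that are contracted. -/
def _root_.YShaped.UsesEdge (sp mg : ℤ × ℤ → Prop)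
    (E : {e : (ℤ × ℤ) × (ℤ × ℤ) // Transverse n r R sp mg e.1 e.2} ≃ Quiver.Total (Vertex n r R))
    (b : Quiver.Total (Vertex n r R) →₀ ℕ) (z z' : ℤ × ℤ) : Prop :=
  Step (cells n r R) z z' ∧ ∀ h : Transverse n r R sp mg z z', b (E ⟨(z, z'), h⟩) ≠ 0

variable {b : Quiver.Total (Vertex n r R) →₀ ℕ}

/-- The contraction `φ` turns a lattice path into a path of the quiver: transverse edges become
arrows and all other edges disappear. -/
theorem carries_of_reflTransGen {z z' : ℤ × ℤ}
    (h : Relation.ReflTransGen (UsesEdge sp mg E b) z z') {u v : Vertex n r R}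
    (hu : u.1 = φ z) (hv : v.1 = φ z') : Carries b u v := by
  induction h generalizing v with
  | refl =>
    obtain rfl : u = v := Subtype.ext (hu.trans hv.symm)
    exact .refl u
  | @tail y y' _ hs ih =>
    refine (ih (v := ⟨_, C.mem_left hs.1⟩) rfl).trans ?_
    obtain ⟨p, hp⟩ := C.exists_path_of_step hE hs.1 (u := ⟨_, C.mem_left hs.1⟩) (v := v) rfl hv
    refine ⟨p, fun a ha => ?_⟩
    obtain ⟨h, rfl⟩ := (hp a).1 ha
    exact hs.2 h

theorem reflTransGen_of_carries {u v : Vertex n r R} (h : Carries b u v) :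
    Relation.ReflTransGen (UsesEdge sp mg E b) u.1 v.1 := by
  have mono : ∀ {z z'}, Relation.ReflTransGen
      (fun z z' => Step (cells n r R) z z' ∧ ¬ Transverse n r R sp mg z z') z z' →
      Relation.ReflTransGen (UsesEdge sp mg E b) z z' := fun h =>
    Relation.ReflTransGen.mono (fun z z' h => ⟨h.1, fun h' => absurd h' h.2⟩) _ _ h
  refine h.induction (P := fun v => Relation.ReflTransGen (UsesEdge sp mg E b) u.1 v.1) .refl
    fun a ha hl => ?_
  obtain ⟨⟨⟨z, z'⟩, ht⟩, rfl⟩ := E.surjective a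
  obtain ⟨h1, h2⟩ := C.reflTransGen ht
  have he := hE ⟨(z, z'), ht⟩
  rw [he.1] at hl
  rw [he.2]
  exact ((hl.trans (mono h1)).tail ⟨ht.1, fun _ => ha⟩).trans (mono h2)

end IsContraction

end YShaped

/-! ### Positivity of the anticanonical class and the cut argument -/

namespace YShaped

open ToricQuiver

variable {ρ : ℕ} {n : Fin (ρ + 1) → Fin (ρ + 1) → ℕ} {r : Fin (ρ + 1) → ℕ}
  {R : Finset (Fin (ρ + 1))}

namespace IsLadder

variable {W H : ℤ} {hgt hgt' : ℤ → ℤ} {a a' : ℤ → ℤ × ℤ} (L : IsLadder n r R W H hgt a hgt' a')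

include L

theorem snd_nonneg {z z' : ℤ × ℤ} (h : Step (cells n r R) z z') (hz : 0 < z.1) : 0 ≤ z.2 := by
  obtain ⟨x, y⟩ := z
  simp only at hz ⊢
  have h1 (u v : ℤ) (hu : 0 ≤ u) (h : (u, v) ∈ cells n r R) : 0 ≤ v :=
    ((L.right.mem_iff u v hu).1 h).1
  rcases h.incident_left with h | h | h | h
  · exact h1 _ _ (by omega) h
  · exact h1 _ _ (by omega) h
  · have := h1 _ _ (by omega) h
    omega
  · have := h1 _ _ (by omega) h
    omega

theorem snd_le {z z' : ℤ × ℤ} (h : Step (cells n r R) z z') (hz : z.1 < W) : z.2 ≤ H := by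
  obtain ⟨x, y⟩ := z
  simp only at hz ⊢
  have h1 (u v : ℤ) (hu : u < W) (h : (u, v) ∈ cells n r R) : v < H := by
    have h2 : (W - 1 - u, H - 1 - v) ∈ rotCells W H (cells n r R) := by
      rwa [mem_rotCells (x := u) (y := v) (by ring) (by ring)]
    have := ((L.left.mem_iff _ _ (by omega)).1 h2).1
    omega
  rcases h.incident_left with h | h | h | h
  · exact (h1 _ _ (by omega) h).le
  · exact (h1 _ _ (by omega) h).le
  · have := h1 _ _ (by omega) h
    omega
  · have := h1 _ _ (by omega) h
    omega

/-- A path that a flow carries from the left to the right crosses a path that it carries from the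
origin to the upper right corner of the first block. -/
theorem exists_crossing {b : Quiver.Total (Vertex n r R) →₀ ℕ} {o t u v : Vertex n r R}
    (ho : o.1 = (0, 0)) (ht : t.1 = (W, H)) (hot : Carries b o t) (huv : Carries b u v)
    (hu : u.1.1 < 0) (hv : W ≤ v.1.1) (hv' : 0 ≤ v.1.2) : Carries b o v ∧ Carries b u t := by
  have C := L.isContraction
  obtain ⟨E, hE⟩ := C.exists_equiv
  have h1 := C.reflTransGen_of_carries hE huv
  have h2 := C.reflTransGen_of_carries hE hot
  rw [ho, ht] at h2
  have hS (z z' : ℤ × ℤ) (h : UsesEdge (IsSplit n r R) (IsMerge n r R) E b z z') :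
      level z' = level z + 1 ∧ z.1 ≤ z'.1 ∧ z'.1 ≤ z.1 + 1 := by
    refine ⟨h.1.level_eq, ?_⟩
    rcases h.1 with ⟨rfl, -⟩ | ⟨rfl, -⟩ <;> simp
  obtain ⟨z, h3, h4, h5, h6⟩ := YShaped.exists_crossing hS (fun z z' h => L.snd_le h.1) L.W_pos
    (fun z z' h => L.snd_nonneg h.1) h1 hu hv hv' h2
  have hz : contract n r R W H a a' z ∈ vertices n r R := by
    rcases Relation.ReflTransGen.cases_head h6 with rfl | ⟨y, hs, -⟩
    · rw [← ht, contract_of_mem t.2]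
      exact t.2
    · exact C.mem_left hs.1
  obtain ⟨y, hy⟩ : ∃ y : Vertex n r R, y.1 = contract n r R W H a a' z := ⟨⟨_, hz⟩, rfl⟩
  rw [← ho] at h5
  rw [← ht] at h6
  have hcon (w : Vertex n r R) : w.1 = contract n r R W H a a' w.1 := (contract_of_mem w.2).symm
  exact ⟨(C.carries_of_reflTransGen hE h5 (hcon o) hy).trans
      (C.carries_of_reflTransGen hE h4 hy (hcon v)),
    (C.carries_of_reflTransGen hE h3 (hcon u) hy).trans
      (C.carries_of_reflTransGen hE h6 hy (hcon t))⟩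

end IsLadder

/-- The sum of the heights of the blocks of a leg that follow the block of `i`. -/
def nextHeights (r : Fin (ρ + 1) → ℕ) (s : Finset (Fin (ρ + 1))) (p : Fin (ρ + 1) → Fin (ρ + 1))
    (i : Fin (ρ + 1)) : ℤ := ∑ k ∈ s.erase 1 with p k = i, (r k : ℤ)

/-- Collecting the coefficient of each `F j`: the value `F j` also enters with the factor `-r k` for
every block `k` that follows `j`. -/
theorem IsLegOf.sum_eq {s : Finset (Fin (ρ + 1))} {p : Fin (ρ + 1) → Fin (ρ + 1)}
    (G : IsLegOf n r s p) (F : Fin (ρ + 1) → ℤ) (α : ℤ) :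
    ∑ i ∈ s.erase 1, ((width n r i - prevWidth n r i) * (F i - α) + r i * (F i - F (p i))) =
      ∑ i ∈ s.erase 1, (width n r i - prevWidth n r i + r i - nextHeights r s p i) * (F i - α) -
        nextHeights r s p 1 * (F 1 - α) := by
  have h1 : ∑ i ∈ s.erase 1, (r i : ℤ) * (F (p i) - α) =
      ∑ j ∈ s, nextHeights r s p j * (F j - α) := by
    rw [← Finset.sum_fiberwise_of_maps_to (g := p) (t := s) (s := s.erase 1) fun i hi =>
      G.isLeg.p_mem i (Finset.mem_of_mem_erase hi) (Finset.ne_of_mem_erase hi)]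
    refine Finset.sum_congr rfl fun j _ => ?_
    rw [nextHeights, Finset.sum_mul]
    refine Finset.sum_congr rfl fun i hi => ?_
    rw [(Finset.mem_filter.1 hi).2]
  rw [← Finset.add_sum_erase s (fun j => nextHeights r s p j * (F j - α)) G.isLeg.mem] at h1
  have h2 : ∑ i ∈ s.erase 1, ((width n r i - prevWidth n r i) * (F i - α) + r i * (F i - F (p i))) =
      ∑ i ∈ s.erase 1, (width n r i - prevWidth n r i + r i) * (F i - α) -
        ∑ i ∈ s.erase 1, (r i : ℤ) * (F (p i) - α) := by
    rw [← Finset.sum_sub_distrib]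
    exact Finset.sum_congr rfl fun i _ => by ring
  rw [h2, h1]
  simp only [sub_mul _ (nextHeights r s p _), Finset.sum_sub_distrib]
  ring

/-- Both legs of a Fano quiver flag variety. -/
structure IsPositive (n : Fin (ρ + 1) → Fin (ρ + 1) → ℕ) (r : Fin (ρ + 1) → ℕ)
    (R : Finset (Fin (ρ + 1))) (p p' : Fin (ρ + 1) → Fin (ρ + 1)) : Prop where
  right : IsLegOf n r (leg R) p
  left : IsLegOf n r (insert 1 R) p'
  pos_one : nextHeights r (leg R) p 1 + nextHeights r (insert 1 R) p' 1 < width n r 1 + r 1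
  pos_right : ∀ i ∈ (leg R).erase 1,
    nextHeights r (leg R) p i < width n r i - prevWidth n r i + r i
  pos_left : ∀ i ∈ (insert 1 R).erase 1,
    nextHeights r (insert 1 R) p' i < width n r i - prevWidth n r i + r i

namespace IsPositive

variable {p p' : Fin (ρ + 1) → Fin (ρ + 1)} (P : IsPositive n r R p p')

include P

/-- The anticanonical class of `X(Q)` as a positive combination of the classes `D_i`. -/
theorem exists_sum_eq [Fintype (Quiver.Total (Vertex n r R))] :
    ∃ (D : ℤ) (d d' : Fin (ρ + 1) → ℤ), (0 < D ∧ (∀ i ∈ (leg R).erase 1, 0 < d i) ∧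
      ∀ i ∈ (insert 1 R).erase 1, 0 < d' i) ∧ ∀ f : ℤ × ℤ → ℤ,
    ∑ a : Quiver.Total (Vertex n r R), (f a.right.1 - f a.left.1) =
      D * (f (width n r 1, r 1) - f (0, 0)) +
      ∑ i ∈ (leg R).erase 1, d i * (f (width n r i, r i) - f (0, 0)) +
      ∑ i ∈ (insert 1 R).erase 1,
        d' i * (f (width n r 1, r 1) - f (rotate n r (width n r i, r i))) := by
  refine ⟨width n r 1 + r 1 - nextHeights r (leg R) p 1 - nextHeights r (insert 1 R) p' 1,
    fun i => width n r i - prevWidth n r i + r i - nextHeights r (leg R) p i,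
    fun i => width n r i - prevWidth n r i + r i - nextHeights r (insert 1 R) p' i,
    ⟨by linarith [P.pos_one], fun i hi => sub_pos.2 (P.pos_right i hi),
      fun i hi => sub_pos.2 (P.pos_left i hi)⟩, fun f => ?_⟩
  have L := isLadder P.right P.left
  rw [L.isContraction.sum_arrows, L.edgeSum_contract, edgeSum_anchor P.right P.left,
    P.right.sum_eq (fun i => f (width n r i, r i))]
  have h := P.left.sum_eq (fun i => - f (rotate n r (width n r i, r i))) (- f (width n r 1, r 1))
  simp only [neg_sub_neg] at h
  have h3 : rotate n r (width n r 1, (r 1 : ℤ)) = (0, 0) := by ext <;> simp [rotate]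
  rw [h, h3]
  ring

/-- A set of vertices that the arrows that a stable flow uses do not leave separates the two ends
of some class `D_i`. -/
theorem not_all_neg {m : ℕ} {b : Quiver.Total (Vertex n r R) →₀ ℕ}
    (hb : IsStableFlow (Vertex n r R) m b) {U : ℤ × ℤ → Prop}
    (hU : ∀ a, b a ≠ 0 → U a.left.1 → U a.right.1)
    (h1 : U (width n r 1, r 1) → U (0, 0))
    (h2 : ∀ i ∈ (leg R).erase 1, U (width n r i, r i) → U (0, 0))
    (h3 : ∀ i ∈ (insert 1 R).erase 1,
      U (width n r 1, r 1) → U (rotate n r (width n r i, r i)))  :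
    (U (0, 0) → U (width n r 1, r 1)) ∧
    (∀ i ∈ (leg R).erase 1, U (0, 0) → U (width n r i, r i)) ∧
    (∀ i ∈ (insert 1 R).erase 1,
      U (rotate n r (width n r i, r i)) → U (width n r 1, r 1)) := by
  classical
  have := Fintype.ofFinite (Vertex n r R)
  have := Fintype.ofFinite (Quiver.Total (Vertex n r R))
  obtain ⟨D, d, d', ⟨hd1, hd2, hd3⟩, hd⟩ := P.exists_sum_eq
  -- No arrow that `b` uses leaves `U`, so the net flow into `U` is nonnegative. By `exists_sum_eq`
  -- it is also `m` times a sum of nonpositive terms with positive coefficients, so every term is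
  -- zero.
  let f : ℤ × ℤ → ℤ := fun z => if U z then 1 else 0
  have hf {z z' : ℤ × ℤ} (h : U z → U z') : f z - f z' ≤ 0 := by
    by_cases hz : U z
    · simp [f, hz, h hz]
    · simp only [f, if_neg hz]
      split_ifs <;> simp
  have hf' {z z' : ℤ × ℤ} (h : ¬ (U z' → U z)) : f z - f z' < 0 := by
    rw [Classical.not_imp] at h
    simp [f, h.1, h.2]
  have hsum := hb.sum_eq fun u => f u.1
  have h0 : 0 ≤ ∑ a : Quiver.Total (Vertex n r R), (b a : ℤ) * (f a.right.1 - f a.left.1) := by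
    refine Finset.sum_nonneg fun a _ => ?_
    by_cases ha : b a = 0
    · simp [ha]
    · have := hf (hU a ha)
      exact mul_nonneg (by positivity) (by linarith)
  rw [hsum, hd f] at h0
  have hm : (0 : ℤ) < m := by exact_mod_cast hb.1
  have h0' := nonneg_of_mul_nonneg_right h0 hm
  have t1 : D * (f (width n r 1, r 1) - f (0, 0)) ≤ 0 :=
    mul_nonpos_of_nonneg_of_nonpos hd1.le (hf h1)
  have t2 (i) (hi : i ∈ (leg R).erase 1) : d i * (f (width n r i, r i) - f (0, 0)) ≤ 0 :=
    mul_nonpos_of_nonneg_of_nonpos (hd2 i hi).le (hf (h2 i hi))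
  have t3 (i) (hi : i ∈ (insert 1 R).erase 1) :
      d' i * (f (width n r 1, r 1) - f (rotate n r (width n r i, r i))) ≤ 0 :=
    mul_nonpos_of_nonneg_of_nonpos (hd3 i hi).le (hf (h3 i hi))
  refine ⟨?_, fun i hi => ?_, fun i hi => ?_⟩
  · by_contra h
    have := mul_neg_of_pos_of_neg hd1 (hf' h)
    linarith [Finset.sum_nonpos t2, Finset.sum_nonpos t3]
  · by_contra h
    have := Finset.sum_neg' t2 ⟨i, hi, mul_neg_of_pos_of_neg (hd2 i hi) (hf' h)⟩
    linarith [Finset.sum_nonpos t3]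
  · by_contra h
    have := Finset.sum_neg' t3 ⟨i, hi, mul_neg_of_pos_of_neg (hd3 i hi) (hf' h)⟩
    linarith [Finset.sum_nonpos t2]

end IsPositive

end YShaped

/-! ### Legs of a Y-shaped Fano quiver -/

namespace YShaped

variable {ρ : ℕ} {n : Fin (ρ + 1) → Fin (ρ + 1) → ℕ} {r : Fin (ρ + 1) → ℕ}
  {R : Finset (Fin (ρ + 1))}

namespace IsYShaped

variable (hY : IsYShaped n)

include hY

theorem one_ne_zero : (1 : Fin (ρ + 1)) ≠ 0 := by
  have := hY.one_le
  have h : ((1 : Fin (ρ + 1)) : ℕ) = 1 := Nat.mod_eq_of_lt (Nat.lt_succ_of_le this)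
  exact fun h0 => by simp [h0] at h

omit hY in
theorem one_le_of_ne_zero {i : Fin (ρ + 1)} (hi : i ≠ 0) : 1 ≤ i := by
  rw [Fin.le_def]
  have h1 : i.1 ≠ 0 := Fin.val_ne_zero_iff.2 hi
  exact (Nat.mod_le _ _).trans (Nat.one_le_iff_ne_zero.2 h1)

theorem one_pos : (0 : Fin (ρ + 1)) < 1 := Fin.pos_iff_ne_zero.2 hY.one_ne_zero

theorem lt_of_pos {i j : Fin (ρ + 1)} (h : 0 < n i j) : i < j := by
  by_contra hn
  rw [hY.acyclic i j (not_lt.1 hn)] at h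
  exact h.false

theorem le_of_reflTransGen {i j : Fin (ρ + 1)}
    (h : Relation.ReflTransGen (fun i j => 0 < n i j) i j) : i ≤ j := by
  induction h with
  | refl => exact le_rfl
  | tail _ h ih => exact ih.trans (hY.lt_of_pos h).le

/-- Every vertex after `1` has exactly one arrow in whose source is not `0`. -/
theorem exists_prev : ∃ p : Fin (ρ + 1) → Fin (ρ + 1), ∀ j, 1 < j →
    p j ≠ 0 ∧ n (p j) j = 1 ∧ ∀ k, k ≠ 0 → k ≠ p j → n k j = 0 := by
  have h (j) (hj : 1 < j) : ∃ i, i ≠ 0 ∧ n i j = 1 ∧ ∀ k, k ≠ 0 → k ≠ i → n k j = 0 := by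
    rcases Relation.ReflTransGen.cases_tail (hY.path j hj) with h | ⟨i, h, hi⟩
    · exact absurd h hj.ne'
    · have h0 : i ≠ 0 := (hY.one_pos.trans_le (hY.le_of_reflTransGen h)).ne'
      have h1 := hY.in_le j
      rw [← Finset.add_sum_erase _ _ (Finset.mem_erase.2 ⟨h0, Finset.mem_univ i⟩)] at h1
      refine ⟨i, h0, by omega, fun k hk hki => ?_⟩
      have h2 : ∑ x ∈ (Finset.univ.erase 0).erase i, n x j = 0 := by omega
      exact Finset.sum_eq_zero_iff.1 h2 k
        (Finset.mem_erase.2 ⟨hki, Finset.mem_erase.2 ⟨hk, Finset.mem_univ k⟩⟩)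
  exact ⟨fun j => if hj : 1 < j then (h j hj).choose else 0, fun j hj => by
    simp only [dif_pos hj]
    exact (h j hj).choose_spec⟩

theorem sTilde_eq {i : Fin (ρ + 1)} (hi : i ≠ 0) :
    sTilde n i = n 0 i + ∑ j ∈ Finset.univ.erase 0, n j i * sTilde n j := by
  have h0 : sTilde n 0 = 1 := by rw [sTilde, if_pos rfl]
  have h1 : sTilde n i = ∑ j, n j i * sTilde n j := by
    rw [sTilde, if_neg hi,
      ← Finset.sum_subtype (Finset.univ.filter (· < i)) (by simp) fun j => n j i * sTilde n j]
    refine Finset.sum_subset (Finset.subset_univ _) fun j _ hj => ?_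
    rw [hY.acyclic j i (by simpa using hj), zero_mul]
  rw [h1, ← Finset.add_sum_erase _ _ (Finset.mem_univ 0), h0, mul_one]

/-- Paths from `0` to `i` either come through the preceding vertex, and then cancel against the
previous width, or are arrows from `0`. Hence `r_i < s_i` says that blocks have positive width, and
`s'_i < s_i` gives the positive coefficients of the anticanonical class. -/
theorem width_sub_prevWidth (hr : r 0 = 1) {i : Fin (ρ + 1)} (hi : i ≠ 0) :
    width n r i - prevWidth n r i + r i = sIn n r i := by
  have h1 : prevWidth n r i = ∑ j ∈ Finset.univ.erase 0, (n j i : ℤ) * sTilde n j -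
      ∑ j ∈ Finset.univ.erase 0, (n j i : ℤ) * r j := by
    simp only [prevWidth, width, mul_sub, Finset.sum_sub_distrib]
  rw [h1, width, hY.sTilde_eq hi, sIn, ← Finset.add_sum_erase _ _ (Finset.mem_univ 0), hr]
  push_cast
  ring

theorem sum_one {M : Type} [AddCommMonoid M] (F : ℕ → Fin (ρ + 1) → M) (hF : ∀ j, F 0 j = 0) :
    ∑ j ∈ Finset.univ.erase 0, F (n j 1) j = 0 := by
  refine Finset.sum_eq_zero fun j hj => ?_
  rw [hY.acyclic j 1 (one_le_of_ne_zero (Finset.ne_of_mem_erase hj)), hF]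

end IsYShaped

/-- The vertices of a leg, where `p` is the preceding vertex. -/
structure IsChainOf (n : Fin (ρ + 1) → Fin (ρ + 1) → ℕ) (s : Finset (Fin (ρ + 1)))
    (p : Fin (ρ + 1) → Fin (ρ + 1)) : Prop where
  zero_notMem : 0 ∉ s
  one_mem : 1 ∈ s
  p_mem : ∀ i ∈ s, i ≠ 1 → p i ∈ s
  apply_eq : ∀ i ∈ s, i ≠ 1 → n (p i) i = 1
  eq_zero : ∀ i ∈ s, i ≠ 1 → ∀ k, k ≠ 0 → k ≠ p i → n k i = 0
  inj : ∀ i ∈ s, ∀ j ∈ s, i ≠ 1 → j ≠ 1 → p i = p j → i = j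

namespace IsChainOf

variable {s : Finset (Fin (ρ + 1))} {p : Fin (ρ + 1) → Fin (ρ + 1)} (C : IsChainOf n s p)

include C

theorem one_le {i : Fin (ρ + 1)} (hi : i ∈ s) : 1 ≤ i :=
  IsYShaped.one_le_of_ne_zero fun h => C.zero_notMem (h ▸ hi)

theorem p_lt (hY : IsYShaped n) {i : Fin (ρ + 1)} (hi : i ∈ s) (h1 : i ≠ 1) : p i < i :=
  hY.lt_of_pos (by rw [C.apply_eq i hi h1]; exact Nat.one_pos)

theorem sum_eq {M : Type} [AddCommMonoid M] (F : ℕ → Fin (ρ + 1) → M) (hF : ∀ j, F 0 j = 0)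
    {i : Fin (ρ + 1)} (hi : i ∈ s) (h1 : i ≠ 1) :
    ∑ j ∈ Finset.univ.erase 0, F (n j i) j = F 1 (p i) := by
  have h0 : p i ≠ 0 := fun h => C.zero_notMem (h ▸ C.p_mem i hi h1)
  rw [Finset.sum_eq_single (p i), C.apply_eq i hi h1]
  · intro j hj hji
    rw [C.eq_zero i hi h1 j (Finset.ne_of_mem_erase hj) hji, hF]
  · exact fun h => absurd (Finset.mem_erase.2 ⟨h0, Finset.mem_univ _⟩) h

/-- The numbering of the vertices increases along the leg without gaps. If `i` lay strictly between
`p j` and `j`, then `p i < p j` contradicts the claim for `i`, equality contradicts injectivity of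
`p`, and otherwise `p i` is a smaller counterexample. -/
theorem le_p (hY : IsYShaped n) (j : Fin (ρ + 1)) :
    j ∈ s → ∀ i ∈ s, i < j → i ≤ p j := by
  induction j using WellFoundedLT.induction with
  | _ j ih =>
  intro hj i hi hij
  have hj1 : j ≠ 1 := ((C.one_le hi).trans_lt hij).ne'
  by_contra hn
  rw [not_le] at hn
  induction i using WellFoundedLT.induction with
  | _ i ih' =>
  have hi1 : i ≠ 1 := ((C.one_le (C.p_mem j hj hj1)).trans_lt hn).ne'
  have h1 := C.p_lt hY hi hi1
  rcases lt_trichotomy (p i) (p j) with h | h | h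
  · exact absurd (ih i hij hi (p j) (C.p_mem j hj hj1) hn) h.not_ge
  · exact hij.ne (C.inj i hi j hj hi1 hj1 h)
  · exact ih' (p i) h1 (C.p_mem i hi hi1) (h1.trans hij) h

theorem isLegOf (hY : IsYShaped n) (hF : IsFano n r) : IsLegOf n r s p := by
  have h1 : prevWidth n r 1 = 0 := hY.sum_one (fun m j => (m : ℤ) * width n r j) (by simp)
  have hne (i) (hi : i ∈ s) : i ≠ 0 := fun h => C.zero_notMem (h ▸ hi)
  have h2 (i) (hi : i ∈ s) (hi1 : i ≠ 1) : prevWidth n r i = width n r (p i) := by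
    rw [prevWidth, C.sum_eq (fun m j => (m : ℤ) * width n r j) (by simp) hi hi1, Nat.cast_one,
      one_mul]
  have hlt (i) (hi : i ∈ s) : prevWidth n r i < width n r i := by
    have h3 := hY.width_sub_prevWidth hF.1 (hne i hi)
    have h4 := (hF.2 i (hne i hi)).2.1
    omega
  have hmono (j : Fin (ρ + 1)) : j ∈ s → ∀ i ∈ s, i ≤ j → width n r i ≤ width n r j := by
    induction j using WellFoundedLT.induction with
    | _ j ih =>
    intro hj i hi hij
    rcases hij.lt_or_eq with h | rfl
    · have hj1 : j ≠ 1 := ((C.one_le hi).trans_lt h).ne'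
      have h3 := ih (p j) (C.p_lt hY hj hj1) (C.p_mem j hj hj1) i hi (C.le_p hY j hj i hi h)
      rw [← h2 j hj hj1] at h3
      exact h3.trans (hlt j hj).le
    · exact le_rfl
  have hdisj (i) (hi : i ∈ s) (j) (hj : j ∈ s) (h : i < j) : width n r i ≤ prevWidth n r j := by
    have hj1 : j ≠ 1 := ((C.one_le hi).trans_lt h).ne'
    rw [h2 j hj hj1]
    exact hmono _ (C.p_mem j hj hj1) i hi (C.le_p hY j hj i hi h)
  refine ⟨⟨C.one_mem, h1, C.p_mem, h2, hlt, fun i hi => ?_, fun i hi hi1 => ?_,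
    fun i hi j hj h => ?_⟩, ?_, fun i hi hi1 => ?_⟩
  · have := (hF.2 i (hne i hi)).1
    positivity
  · exact hdisj 1 C.one_mem i hi ((C.one_le hi).lt_of_ne hi1.symm)
  · rcases lt_or_gt_of_ne h with h | h
    · exact .inl (hdisj i hi j hj h)
    · exact .inr (hdisj j hj i hi h)
  · exact hY.sum_one (fun m j => m * r j) (by simp)
  · rw [prevHeight, C.sum_eq (fun m j => m * r j) (by simp) hi hi1, one_mul]

theorem nextHeights_eq (i : Fin (ρ + 1)) :
    nextHeights r s p i = ∑ k ∈ s.erase 1 with p k = i, (n i k : ℤ) * r k := by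
  refine Finset.sum_congr rfl fun k hk => ?_
  obtain ⟨hk', rfl⟩ := Finset.mem_filter.1 hk
  rw [C.apply_eq k (Finset.mem_of_mem_erase hk') (Finset.ne_of_mem_erase hk'), Nat.cast_one, one_mul]

theorem nextHeights_le (i : Fin (ρ + 1)) : nextHeights r s p i ≤ sOut n r i := by
  rw [C.nextHeights_eq, sOut]
  push_cast
  exact Finset.sum_le_sum_of_subset_of_nonneg (Finset.subset_univ _) fun _ _ _ => by positivity

/-- Used at the vertex `1`, which lies on both legs: its successors on the two legs are different
and together contribute at most `s'_1`. -/
theorem nextHeights_add_le {s' : Finset (Fin (ρ + 1))} (C' : IsChainOf n s' p)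
    (hd : Disjoint (s.erase 1) (s'.erase 1)) (i : Fin (ρ + 1)) :
    nextHeights r s p i + nextHeights r s' p i ≤ sOut n r i := by
  rw [C.nextHeights_eq, C'.nextHeights_eq, sOut,
    ← Finset.sum_union (Finset.disjoint_filter_filter hd)]
  push_cast
  exact Finset.sum_le_sum_of_subset_of_nonneg (Finset.subset_univ _) fun _ _ _ => by positivity

theorem nextHeights_lt (hY : IsYShaped n) (hF : IsFano n r) {i : Fin (ρ + 1)} (hi : i ≠ 0) :
    nextHeights r s p i < width n r i - prevWidth n r i + r i := by
  have h1 := C.nextHeights_le (r := r) i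
  have h2 := (hF.2 i hi).2.2
  rw [hY.width_sub_prevWidth hF.1 hi]
  omega

end IsChainOf

/-- A vertex other than `0` and `1` has at most one successor, and of the at most two successors of
`1` each leg receives at most one; so preceding vertices are distinct along each leg. -/
theorem IsYShaped.exists_isChainOf (hY : IsYShaped n) (hR : IsRotatedBranch n R) :
    ∃ p, IsChainOf n (leg R) p ∧ IsChainOf n (insert 1 R) p := by
  obtain ⟨p, hp⟩ := hY.exists_prev
  have hlt {j : Fin (ρ + 1)} (h0 : j ≠ 0) (h1 : j ≠ 1) : 1 < j :=
    (IsYShaped.one_le_of_ne_zero h0).lt_of_ne h1.symm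
  have hpred {i j} (h1 : 1 < j) (h0 : i ≠ 0) (h : 0 < n i j) : p j = i := by
    by_contra hne
    have := (hp j h1).2.2 i h0 (Ne.symm hne)
    omega
  have htwo (c i j) (h : i ≠ j) : n c i + n c j ≤ ∑ k, n c k := by
    rw [← Finset.sum_pair h (f := n c)]
    exact Finset.sum_le_sum_of_subset (Finset.subset_univ _)
  have hinj (i j) (hi : 1 < i) (hj : 1 < j) (h : p i = p j)
      (h' : p i = 1 → p j = 1 → i = j) : i = j := by
    by_contra hne
    obtain ⟨h0, h1, -⟩ := hp i hi
    have h3 := (hp j hj).2.1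
    rw [← h] at h3
    have h4 := htwo (p i) _ _ hne
    have h5 := hY.out_le (p i) h0 fun h6 => hne (h' h6 (h ▸ h6))
    omega
  rcases hR with ⟨hout, rfl⟩ | ⟨hout, b, hb, hR⟩
  · refine ⟨p, ⟨by simp [leg], by simp [leg, hY.one_ne_zero], fun i hi h1 => ?_, fun i hi h1 => ?_,
      fun i hi h1 => ?_, fun i hi j hj h1 h2 h => ?_⟩, ⟨?_, by simp, by simp, by simp, by simp, ?_⟩⟩
    · have h0 : i ≠ 0 := by simpa [leg] using hi
      simpa [leg] using (hp i (hlt h0 h1)).1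
    · have h0 : i ≠ 0 := by simpa [leg] using hi
      exact (hp i (hlt h0 h1)).2.1
    · have h0 : i ≠ 0 := by simpa [leg] using hi
      exact (hp i (hlt h0 h1)).2.2
    · have h3 := hlt (by simpa [leg] using hi) h1
      have h4 := hlt (by simpa [leg] using hj) h2
      refine hinj i j h3 h4 h fun h5 h6 => ?_
      by_contra hne
      have h7 := htwo 1 _ _ hne
      have h8 := (hp i h3).2.1
      have h9 := (hp j h4).2.1
      rw [h5] at h8
      rw [h6] at h9
      omega
    · simpa using hY.one_ne_zero.symm
    · intro i hi j hj h1
      exact absurd (by simpa using hi) h1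
  · have hb1 := hY.lt_of_pos hb
    have hRlt {j} (hj : j ∈ R) : 1 < j := hb1.trans_le (hY.le_of_reflTransGen ((hR j).1 hj))
    have hR0 : (0 : Fin (ρ + 1)) ∉ R := fun h => (hRlt h).not_gt hY.one_pos
    have hR1 : (1 : Fin (ρ + 1)) ∉ R := fun h => (hRlt h).false
    have hpR {j} (hj : j ∈ R) : (j = b ∧ p j = 1) ∨ p j ∈ R := by
      rcases Relation.ReflTransGen.cases_tail ((hR j).1 hj) with rfl | ⟨c, hc, h⟩
      · exact .inl ⟨rfl, hpred hb1 hY.one_ne_zero hb⟩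
      · right
        have hc' := (hR c).2 hc
        rwa [hpred (hRlt hj) (fun h0 => hR0 (h0 ▸ hc')) h]
    have hleg {j} (hj : j ∈ leg R) : j ≠ 0 ∧ j ∉ R := by simpa [leg, not_or] using hj
    have hins {j} (hj : j ∈ insert 1 R) (h1 : j ≠ 1) : j ∈ R :=
      (Finset.mem_insert.1 hj).resolve_left h1
    refine ⟨p, ⟨by simp [leg], by simp [leg, hY.one_ne_zero, hR1], fun i hi h1 => ?_,
      fun i hi h1 => (hp i (hlt (hleg hi).1 h1)).2.1,
      fun i hi h1 => (hp i (hlt (hleg hi).1 h1)).2.2, fun i hi j hj h1 h2 h => ?_⟩,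
      ⟨by simp [hY.one_ne_zero.symm, hR0], by simp, fun i hi h1 => ?_,
      fun i hi h1 => (hp i (hRlt (hins hi h1))).2.1,
      fun i hi h1 => (hp i (hRlt (hins hi h1))).2.2, fun i hi j hj h1 h2 h => ?_⟩⟩
    · have h3 := hp i (hlt (hleg hi).1 h1)
      have h4 : p i ∉ R := fun h => (hleg hi).2
        ((hR i).2 (((hR _).1 h).tail (by rw [h3.2.1]; exact Nat.one_pos)))
      simp [leg, h3.1, h4]
    · have h3 := hlt (hleg hi).1 h1
      have h4 := hlt (hleg hj).1 h2
      refine hinj i j h3 h4 h fun h5 h6 => ?_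
      by_contra hne
      have h8 := (hp i h3).2.1
      have h9 := (hp j h4).2.1
      rw [h5] at h8
      rw [h6] at h9
      have hbR := (hR b).2 .refl
      have hbi : b ≠ i := fun h => (hleg hi).2 (h ▸ hbR)
      have hbj : b ≠ j := fun h => (hleg hj).2 (h ▸ hbR)
      -- Besides `b`, two further successors of `1` outside the branch would give three arrows out
      -- of `1`.
      have h10 : ∑ k ∈ {b, i, j}, n 1 k ≤ ∑ k, n 1 k :=
        Finset.sum_le_sum_of_subset (Finset.subset_univ _)
      rw [Finset.sum_insert (by simp [hbi, hbj]), Finset.sum_pair hne] at h10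
      omega
    · rcases hpR (hins hi h1) with h | h
      · simp [h.2]
      · simp [h]
    · refine hinj i j (hRlt (hins hi h1)) (hRlt (hins hj h2)) h fun h5 h6 => ?_
      rcases hpR (hins hi h1) with h3 | h3
      · rcases hpR (hins hj h2) with h4 | h4
        · exact h3.1.trans h4.1.symm
        · exact absurd (h6 ▸ h4) hR1
      · exact absurd (h5 ▸ h3) hR1

theorem exists_isPositive (hY : IsYShaped n) (hF : IsFano n r) (hR : IsRotatedBranch n R) :
    ∃ p p', IsPositive n r R p p' := by
  obtain ⟨p, C, C'⟩ := hY.exists_isChainOf hR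
  have hne {i} {s : Finset (Fin (ρ + 1))} (C : IsChainOf n s p) (hi : i ∈ s.erase 1) : i ≠ 0 :=
    fun h => C.zero_notMem (h ▸ Finset.mem_of_mem_erase hi)
  refine ⟨p, p, C.isLegOf hY hF, C'.isLegOf hY hF, ?_, fun i hi => C.nextHeights_lt hY hF (hne C hi),
    fun i hi => C'.nextHeights_lt hY hF (hne C' hi)⟩
  have h1 := C.nextHeights_add_le (r := r) C' (Finset.disjoint_left.2 fun i hi hi' => by
    simp only [leg, Finset.mem_erase, Finset.mem_sdiff, Finset.mem_insert] at hi hi'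
    tauto) 1
  have h2 := (hF.2 1 hY.one_ne_zero).2.2
  have h3 := hY.width_sub_prevWidth hF.1 hY.one_ne_zero
  have h4 := (C.isLegOf hY hF).isLeg.q_zero
  omega

end YShaped

/-! ### Stable flows carry the required paths -/

namespace YShaped

open ToricQuiver

variable {ρ : ℕ} {n : Fin (ρ + 1) → Fin (ρ + 1) → ℕ} {r : Fin (ρ + 1) → ℕ}
  {R : Finset (Fin (ρ + 1))}

/-- The flow `b` carries a path from `u` to the point `z`. -/
def CarriesTo (b : Quiver.Total (Vertex n r R) →₀ ℕ) (u : Vertex n r R) (z : ℤ × ℤ) : Prop :=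
  ∃ v : Vertex n r R, v.1 = z ∧ Carries b u v

/-- The flow `b` carries a path from the point `z` to `v`. -/
def CarriesFrom (b : Quiver.Total (Vertex n r R) →₀ ℕ) (v : Vertex n r R) (z : ℤ × ℤ) : Prop :=
  ∃ u : Vertex n r R, u.1 = z ∧ Carries b u v

section

variable {b : Quiver.Total (Vertex n r R) →₀ ℕ} {u v : Vertex n r R}

theorem carriesTo_iff : CarriesTo b u v.1 ↔ Carries b u v :=
  ⟨fun ⟨_, h, h'⟩ => Subtype.ext h ▸ h', fun h => ⟨v, rfl, h⟩⟩

theorem carriesFrom_iff : CarriesFrom b v u.1 ↔ Carries b u v :=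
  ⟨fun ⟨_, h, h'⟩ => Subtype.ext h ▸ h', fun h => ⟨u, rfl, h⟩⟩

theorem carriesTo_right {a : Quiver.Total (Vertex n r R)} (ha : b a ≠ 0)
    (h : CarriesTo b u a.left.1) : CarriesTo b u a.right.1 :=
  carriesTo_iff.2 ((carriesTo_iff.1 h).trans (.of_arrow ha))

theorem carriesFrom_left {a : Quiver.Total (Vertex n r R)} (ha : b a ≠ 0)
    (h : CarriesFrom b v a.right.1) : CarriesFrom b v a.left.1 :=
  carriesFrom_iff.2 ((Carries.of_arrow ha).trans (carriesFrom_iff.1 h))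

end

namespace IsPositive

variable {p p' : Fin (ρ + 1) → Fin (ρ + 1)} (P : IsPositive n r R p p')
  {m : ℕ} {b : Quiver.Total (Vertex n r R) →₀ ℕ} (hb : IsStableFlow (Vertex n r R) m b)

include P hb

/-- The cut consists of the vertices reachable from `x₀`. If `v_1` were not among them, the
indicator would not increase along any class, so `not_all_neg` would force `v_1` into the set. -/
theorem carries_one : Carries b (origin n r R) (extOne n r R) := by
  by_contra hn
  have h1 : CarriesTo b (origin n r R) (0, 0) := ⟨_, rfl, .refl _⟩
  have h2 : ¬ CarriesTo b (origin n r R) (width n r 1, r 1) := fun h => hn (carriesTo_iff.1 h)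
  exact h2 ((P.not_all_neg hb (U := CarriesTo b (origin n r R)) (fun a => carriesTo_right)
    (fun _ => h1) (fun _ _ _ => h1) (fun _ _ h => absurd h h2)).1 h1)

/-- The cut consists of the vertices that do not reach `v`. If `x₀` were one of them, so would be
all `v_j` of the rotated branch, because a path from such a `v_j` to `v` crosses the path from `x₀`
to `v_1` and could be entered from `x₀`. Then `not_all_neg` says that `v` does not reach itself. -/
theorem carries_right {i : Fin (ρ + 1)} (hi : i ∈ (leg R).erase 1) {v : Vertex n r R}
    (hv : v.1 = (width n r i, (r i : ℤ))) : Carries b (origin n r R) v := by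
  by_contra hn
  have h1 : ¬ CarriesFrom b v (0, 0) := fun h => hn (carriesFrom_iff.1 h)
  have h2 (j) (hj : j ∈ (insert 1 R).erase 1) :
      ¬ CarriesFrom b v (rotate n r (width n r j, r j)) := by
    rintro ⟨u, hu, h⟩
    refine hn ((isLadder P.right P.left).exists_crossing (t := extOne n r R) rfl rfl
      (P.carries_one hb) h ?_ ?_ ?_).1
    · rw [Finset.mem_erase] at hj
      have h1 := P.left.isLeg.le j hj.2 hj.1
      have h2 := P.left.isLeg.lt j hj.2
      rw [hu]
      simp only [rotate, Prod.fst_sub]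
      omega
    · rw [Finset.mem_erase] at hi
      have h1 := P.right.isLeg.le i hi.2 hi.1
      have h2 := P.right.isLeg.lt i hi.2
      rw [hv]
      simp only
      omega
    · rw [hv]
      positivity
  refine (P.not_all_neg hb (U := fun z => ¬ CarriesFrom b v z)
    (fun a ha h h' => h (carriesFrom_left ha h')) (fun _ => h1) (fun _ _ _ => h1)
    (fun j hj _ => h2 j hj)).2.1 i hi h1 ⟨v, hv, .refl v⟩

/-- The mirror image of `carries_right`, with the vertices reachable from `u` as the cut. -/
theorem carries_left {i : Fin (ρ + 1)} (hi : i ∈ (insert 1 R).erase 1) {u : Vertex n r R}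
    (hu : u.1 = rotate n r (width n r i, (r i : ℤ))) : Carries b u (extOne n r R) := by
  by_contra hn
  have h1 : ¬ CarriesTo b u (width n r 1, r 1) := fun h => hn (carriesTo_iff.1 h)
  have h2 (j) (hj : j ∈ (leg R).erase 1) : ¬ CarriesTo b u (width n r j, r j) := by
    rintro ⟨v, hv, h⟩
    refine hn ((isLadder P.right P.left).exists_crossing (o := origin n r R) rfl rfl
      (P.carries_one hb) h ?_ ?_ ?_).2
    · rw [Finset.mem_erase] at hi
      have h1 := P.left.isLeg.le i hi.2 hi.1
      have h2 := P.left.isLeg.lt i hi.2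
      rw [hu]
      simp only [rotate, Prod.fst_sub]
      omega
    · rw [Finset.mem_erase] at hj
      have h1 := P.right.isLeg.le j hj.2 hj.1
      have h2 := P.right.isLeg.lt j hj.2
      rw [hv]
      simp only
      omega
    · rw [hv]
      positivity
  exact h1 ((P.not_all_neg hb (U := CarriesTo b u) (fun a => carriesTo_right)
    (fun h => absurd h h1) (fun j hj h => absurd h (h2 j hj)) (fun _ _ h => absurd h h1)).2.2 i hi
    ⟨u, hu, .refl u⟩)

/-- Every stable flow carries a path between the two ends that belong to `i`. -/
theorem carries_path (i : Fin (ρ + 1)) (hi : i ≠ 0) :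
    Carries b (pathStart n r R i hi) (pathEnd n r R i hi) := by
  by_cases hR : i ∈ R
  · have h1 : i ≠ 1 := by
      rintro rfl
      have := P.right.isLeg.mem
      simp [leg, hR] at this
    rw [pathStart, pathEnd, if_pos hR, if_pos hR]
    exact P.carries_left hb (Finset.mem_erase.2 ⟨h1, Finset.mem_insert_of_mem hR⟩)
      (congrArg Subtype.val (dif_pos hR))
  · rw [pathStart, pathEnd, if_neg hR, if_neg hR]
    by_cases h1 : i = 1
    · subst h1
      have : ext n r R 1 hi = extOne n r R := dif_neg hR
      rw [this]
      exact P.carries_one hb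
    · exact P.carries_right hb (Finset.mem_erase.2 ⟨h1, by simp [leg, hi, hR]⟩)
        (congrArg Subtype.val (dif_neg hR))

end IsPositive

end YShaped

theorem mainTheorem8 {ρ : ℕ} (n : Fin (ρ + 1) → Fin (ρ + 1) → ℕ) (r : Fin (ρ + 1) → ℕ)
    (hY : YShaped.IsYShaped n) (hF : YShaped.IsFano n r)
    (R : Finset (Fin (ρ + 1))) (hR : YShaped.IsRotatedBranch n R)
    (i : Fin (ρ + 1)) (hi : i ≠ 0) :
    SheafNotions.IsLineBundle (YShaped.ladderSheaf n r R i hi) ∧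
    SheafNotions.IsNef (YShaped.ladderStructureMap n r R) (YShaped.ladderSheaf n r R i hi) ∧
    SheafNotions.IsGloballyGenerated (YShaped.ladderSheaf n r R i hi) ∧
    ∃ b : Module.Basis
        (Quiver.Path (YShaped.pathStart n r R i hi) (YShaped.pathEnd n r R i hi)) ℂ
        Γ(YShaped.ladderSheaf n r R i hi, ⊤),
      ∀ p, b p = YShaped.pathSection n r R i hi p := by
  obtain ⟨p, p', P⟩ := YShaped.exists_isPositive hY hF hR
  have hht {u v : YShaped.Vertex n r R} (a : u ⟶ v) : YShaped.level u.1 < YShaped.level v.1 :=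
    YShaped.level_lt a
  have hpath := fun m b (hb : ToricQuiver.IsStableFlow (YShaped.Vertex n r R) m b) =>
    P.carries_path hb i hi
  have h1 : SheafNotions.IsLineBundle (YShaped.ladderSheaf n r R i hi) :=
    ToricQuiver.isLineBundle_sheaf (YShaped.origin n r R) hht hpath
  have h2 : SheafNotions.IsGloballyGenerated (YShaped.ladderSheaf n r R i hi) :=
    ToricQuiver.isGloballyGenerated_sheaf (YShaped.origin n r R) hht hpath
  exact ⟨h1, h1.isNef _ h2, h2, ToricQuiver.exists_basis_sections (YShaped.origin n r R) hht
    (YShaped.isLadder P.right P.left).isContraction.exists_isStableFlow_eq_zero⟩
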